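/- Let $\alpha,\beta,g_3,\delta$ be real numbers with $\delta\neq 0$. On $\mathbb{R}^5$ with coordinates $(w,y,z,p,q)$ put $Y=\alpha w+\beta\left(w^3+\frac{g_3}{2}\right)$, and let $U$ be any non-empty open set on which $Y\neq 0$ and $4w^3-g_3\neq 0$. Consider on $U$ the distribution $\mathcal D$ spanned by $$X^1=\partial_q,\qquad X^2=\frac{Y^2}{2(4w^3-g_3)}\partial_w+p\,\partial_y+q\,\partial_p+\frac{(4w^3-g_3)^3}{Y^4}q^2\,\partial_z$$ (the $k=\frac32$ generalised Chazy distribution parametrised by Halphen's solution of the spin-$\frac32$ equianharmonic Lamé equation). Put $$c_1=\frac{1}{4\delta^3Y^3}\left(-2Y^3\left(\alpha w+\tfrac{3g_3}{8}\beta\right)y+Y^2(8w^3+g_3)wp+2w^2(4w^3-g_3)^2q\right),$$ $$\begin{aligned}c_2={}&6z-12\beta\left(\alpha w+\tfrac{3g_3\beta}{16}\right)y^2+\frac{12w^2(16w^3+5g_3)}{Y^2}p^2+12\frac{(4w^3-g_3)^4w}{Y^6}q^2\\&+\frac{6w(\beta(8w^3+g_3)-8\alpha w)}{Y}yp-\frac{4(4w^3-g_3)^2(2\alpha-3\beta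 w^2)}{Y^3}yq+16\frac{(5w^3+g_3)(4w^3-g_3)^2}{Y^4}pq,\end{aligned}$$ $$c_3=\frac{1}{\delta Y^3}\left(\tfrac12\alpha Y^3y-(2w^3+g_3)Y^2p-w(4w^3-g_3)^2q\right),$$ $$Z^1=-\frac{2\delta w}{Y}\partial_y+\frac{4\delta(4w^3-g_3)^2}{Y^3}q\,\partial_z+\frac{\delta(\beta(8w^3+g_3)+4\alpha w)}{2(4w^3-g_3)}\partial_p-\frac{12\delta Y^3w^2}{(4w^3-g_3)^3}\partial_q,$$ $$\begin{aligned}S^1={}&\left(\frac{6\beta\delta^2Y^3}{(4w^3-g_3)^2}y+\frac{24\delta^2wY^2}{(4w^3-g_3)^2}p+\frac{12\delta^2(\alpha(8w^3+g_3)+9\beta g_3w^2)}{(4w^3-g_3)Y}q\right)X^1-\frac{8\delta^2(4w^3-g_3)}{Y^2}X^2,\end{aligned}$$ $$S^2=\frac{Y^3}{4\delta(4w^3-g_3)^2}X^1,\qquad S^3=-c_1S^1+c_2S^2-c_3^2Z^1.$$ Then: 1. $\mathcal D$ is a $(2,3,5)$-distribution on $U$ (that is, $\mathcal D$, $[\mathcal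 D,\mathcal D]$, $[\mathcal D,[\mathcal D,\mathcal D]]$ have ranks $2,3,5$ at every point) and it is maximally symmetric, that is, locally equivalent by diffeomorphisms to the flat Cartan distribution on $\mathbb{R}^5$, the common kernel of $da_1+(a_3+\frac12a_4a_5)da_4$, $da_2+(a_3-\frac12a_4a_5)da_5$, $da_3+\frac12a_4da_5-\frac12a_5da_4$. At every point of $U$ it is the common kernel of $$\omega_1=dy-\frac{2p}{Y^2}(4w^3-g_3)dw,\quad \omega_2=dp-\frac{2q}{Y^2}(4w^3-g_3)dw,\quad \omega_3=dz-\frac{2q^2}{Y^6}(4w^3-g_3)^4dw.$$ 2. $S^1,S^2,S^3$ pairwise bracket-generate split $\mathfrak g_2$ in the real Lie algebra of smooth vector fields on $U$. This means the following. Put $S^4=[S^1,S^2]$, $S^5=[S^2,S^3]$, $S^6=[S^3,S^1]$, $L^1=[S^1,S^4]$, $L^2=[S^2,S^4]$, $L^3=[S^2,S^5]$, $L^4=[S^3,S^5]$, $L^5=[S^3,S^6]$, $L^6=[S^1,S^6]$, $H=[S^2,S^6]$, $h=[S^4,S^3]$, $h^1=\frac14(h-H)$, $h^2=\frac{\sqrt3}{12}(h+H)$.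 Then the fourteen fields $S^1,\dots,S^6,h^1,h^2,L^1,\dots,L^6$ are linearly independent over $\mathbb R$ and span the Lie algebra generated by $S^1,S^2,S^3$; this Lie algebra is isomorphic to the split real Lie algebra $\mathfrak g_2$; $h^1,h^2$ span a Cartan subalgebra of it; and each of the fourteen fields $V$ satisfies $[h^1,V]=aV$, $[h^2,V]=bV$, where $(a,b)$ is its position in the root diagram: $(0,0)$ for $h^1,h^2$, and $$\begin{aligned}&S^1:(1,0),\quad S^2:(-\tfrac12,\tfrac{\sqrt3}2),\quad S^3:(-\tfrac12,-\tfrac{\sqrt3}2),\quad S^4:(\tfrac12,\tfrac{\sqrt3}2),\quad S^5:(-1,0),\quad S^6:(\tfrac12,-\tfrac{\sqrt3}2),\\&L^1:(\tfrac32,\tfrac{\sqrt3}2),\quad L^2:(0,\sqrt3),\quad L^3:(-\tfrac32,\tfrac{\sqrt3}2),\quad L^4:(-\tfrac32,-\tfrac{\sqrt3}2),\quad L^5:(0,-\sqrt3),\quad L^6:(\tfrac32,-\tfrac{\sqrt3}2).\end{aligned}$$ -/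

import Mathlib

open scoped ContDiff
open TopologicalSpace

namespace HalphenG2

section LieAlgebraOfVectorFields

variable {E : Type*} [NormedAddCommGroup E] [NormedSpace ℝ E]

/-- The real vector space of smooth vector fields on an open subset `U` of a normed space.  A field
is represented by its extension by zero to the whole space, so that two fields are equal exactly
when they agree on `U`. -/
def SmoothVectorField (U : Opens E) : Submodule ℝ (E → E) where
  carrier := {V | ContDiffOn ℝ ∞ V U ∧ ∀ x ∉ U, V x = 0}
  add_mem' := by
    rintro V W ⟨hV, hV'⟩ ⟨hW, hW'⟩
    exact ⟨hV.add hW, fun x hx => by simp [hV' x hx, hW' x hx]⟩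
  zero_mem' := ⟨contDiffOn_const, fun _ _ => rfl⟩
  smul_mem' := by
    rintro c V ⟨hV, hV'⟩
    exact ⟨contDiffOn_const.smul hV, fun x hx => by simp [hV' x hx]⟩

namespace SmoothVectorField

variable {U : Opens E}

theorem contDiffAt (V : SmoothVectorField U) {x : E} (hx : x ∈ U) :
    ContDiffAt ℝ ∞ (V : E → E) x :=
  V.2.1.contDiffAt (U.isOpen.mem_nhds hx)

theorem differentiableAt (V : SmoothVectorField U) {x : E} (hx : x ∈ U) :
    DifferentiableAt ℝ (V : E → E) x :=
  (contDiffAt V hx).differentiableAt (by simp)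

theorem apply_eq_zero (V : SmoothVectorField U) {x : E} (hx : x ∉ U) : (V : E → E) x = 0 :=
  V.2.2 x hx

/-- The Lie bracket of vector fields, `[V, W] = DW(V) - DV(W)`. -/
noncomputable instance : Bracket (SmoothVectorField U) (SmoothVectorField U) where
  bracket V W := ⟨VectorField.lieBracket ℝ (V : E → E) (W : E → E), by
    refine ⟨fun x hx => ?_, fun x hx => ?_⟩
    · exact (ContDiffAt.lieBracket_vectorField (m := ∞) (n := ∞) (contDiffAt V hx)
        (contDiffAt W hx) (by simp)).contDiffWithinAt
    · exact VectorField.lieBracket_eq_zero_of_eq_zero (apply_eq_zero V hx)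
        (apply_eq_zero W hx)⟩

theorem coe_bracket (V W : SmoothVectorField U) :
    ((⁅V, W⁆ : SmoothVectorField U) : E → E) = VectorField.lieBracket ℝ (V : E → E) (W : E → E) :=
  rfl

theorem ext_on {V W : SmoothVectorField U} (h : ∀ x ∈ U, (V : E → E) x = (W : E → E) x) :
    V = W := by
  apply Subtype.ext
  funext x
  by_cases hx : x ∈ U
  · exact h x hx
  · rw [apply_eq_zero V hx, apply_eq_zero W hx]

noncomputable instance : LieRing (SmoothVectorField U) where
  add_lie V W Z := ext_on fun x hx => by
    simpa [coe_bracket] using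
      VectorField.lieBracket_add_left (differentiableAt V hx) (differentiableAt W hx)
  lie_add V W Z := ext_on fun x hx => by
    simpa [coe_bracket] using
      VectorField.lieBracket_add_right (differentiableAt W hx) (differentiableAt Z hx)
  lie_self V := ext_on fun x _ => by simp [coe_bracket]
  leibniz_lie V W Z := ext_on fun x hx => by
    simpa [coe_bracket] using
      VectorField.leibniz_identity_lieBracket (𝕜 := ℝ) (n := ∞) (by
          rw [minSmoothness_of_isRCLikeNormedField]
          exact WithTop.coe_le_coe.2 (le_top : (2 : ℕ∞) ≤ ⊤))
        (contDiffAt V hx) (contDiffAt W hx) (contDiffAt Z hx)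

noncomputable instance : LieAlgebra ℝ (SmoothVectorField U) where
  lie_smul c V W := ext_on fun x hx => by
    simpa [coe_bracket] using
      VectorField.lieBracket_const_smul_right (c := c) (differentiableAt W hx)

/-- The smooth vector field on `U` given by a function that is smooth on `U`. -/
noncomputable def ofContDiffOn (f : E → E) (hf : ContDiffOn ℝ ∞ f U) : SmoothVectorField U :=
  ⟨(U : Set E).indicator f,
    hf.congr fun _ hx => Set.indicator_of_mem hx f,
    fun _ hx => Set.indicator_of_notMem hx f⟩

end SmoothVectorField

end LieAlgebraOfVectorFields

section SplitG2

variable {L : Type*} [LieRing L] [LieAlgebra ℝ L]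

/-- The elements `S₁, …, S₆, h¹, h², L₁, …, L₆` built from `S₁, S₂, S₃` by iterated brackets. -/
noncomputable def g2Frame (S₁ S₂ S₃ : L) : Fin 14 → L :=
  let S₄ := ⁅S₁, S₂⁆
  let S₅ := ⁅S₂, S₃⁆
  let S₆ := ⁅S₃, S₁⁆
  let L₁ := ⁅S₁, S₄⁆
  let L₃ := ⁅S₂, S₅⁆
  let L₅ := ⁅S₃, S₆⁆
  let L₂ := ⁅S₂, S₄⁆
  let L₄ := ⁅S₃, S₅⁆
  let L₆ := ⁅S₁, S₆⁆
  let H := ⁅S₂, S₆⁆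
  let h := ⁅S₄, S₃⁆
  ![S₁, S₂, S₃, S₄, S₅, S₆, (1 / 4 : ℝ) • (h - H), (√3 / 12 : ℝ) • (h + H),
    L₁, L₂, L₃, L₄, L₅, L₆]

/-- The root diagram of type `G₂` in the plane: the position of each of the elements of `g2Frame`
(the two Cartan elements sit at the origin). -/
noncomputable def g2Diagram : Fin 14 → ℝ × ℝ :=
  ![(1, 0), (-1 / 2, √3 / 2), (-1 / 2, -√3 / 2), (1 / 2, √3 / 2), (-1, 0), (1 / 2, -√3 / 2),
    (0, 0), (0, 0),
    (3 / 2, √3 / 2), (0, √3), (-3 / 2, √3 / 2), (-3 / 2, -√3 / 2), (0, -√3), (3 / 2, -√3 / 2)]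

/-- `S₁, S₂, S₃` pairwise bracket-generate the split real Lie algebra of type `G₂`: the fourteen
elements of `g2Frame` form a basis of the Lie algebra generated by `S₁, S₂, S₃`; this Lie algebra is
isomorphic to split `𝔤₂`; the elements `h¹, h²` of the frame span a Cartan subalgebra; and the
frame consists of simultaneous eigenvectors of `ad h¹, ad h²` with eigenvalues given by the root
diagram. -/
def PairwiseBracketGenerateSplitG2 (S₁ S₂ S₃ : L) : Prop :=
  let b : Fin 14 → L := g2Frame S₁ S₂ S₃
  let 𝔤 : LieSubalgebra ℝ L := LieSubalgebra.lieSpan ℝ L {S₁, S₂, S₃}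
  LinearIndependent ℝ b ∧
  𝔤.toSubmodule = Submodule.span ℝ (Set.range b) ∧
  Nonempty (𝔤 ≃ₗ⁅ℝ⁆ LieAlgebra.g₂ ℝ) ∧
  (∃ 𝔥 : LieSubalgebra ℝ 𝔤, 𝔥.IsCartanSubalgebra ∧
    𝔥.toSubmodule.map 𝔤.toSubmodule.subtype = Submodule.span ℝ {b 6, b 7}) ∧
  ∀ i, ⁅b 6, b i⁆ = (g2Diagram i).1 • b i ∧ ⁅b 7, b i⁆ = (g2Diagram i).2 • b i

end SplitG2

/-- `ℝ⁵`. -/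
abbrev R5 : Type := Fin 5 → ℝ

/-- The coordinate one-form `dxᵢ` on `ℝ⁵`. -/
noncomputable def dx (i : Fin 5) : R5 →L[ℝ] ℝ := ContinuousLinearMap.proj i

section Distributions

/-- The rank two distribution spanned by `X₁, X₂` is a `(2,3,5)`-distribution on `U`: at each point
`𝒟`, `[𝒟, 𝒟]`, `[𝒟, [𝒟, 𝒟]]` have ranks `2`, `3`, `5`. -/
def IsTwoThreeFive (U : Opens R5) (X₁ X₂ : R5 → R5) : Prop :=
  let X₃ := VectorField.lieBracket ℝ X₁ X₂
  let X₄ := VectorField.lieBracket ℝ X₁ X₃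
  let X₅ := VectorField.lieBracket ℝ X₂ X₃
  ∀ x ∈ U,
    Module.finrank ℝ (Submodule.span ℝ {X₁ x, X₂ x}) = 2 ∧
    Module.finrank ℝ (Submodule.span ℝ {X₁ x, X₂ x, X₃ x}) = 3 ∧
    Submodule.span ℝ {X₁ x, X₂ x, X₃ x, X₄ x, X₅ x} = ⊤

/-- The distribution annihilated by three one-forms. -/
def annihilatedBy (η : Fin 3 → R5 → (R5 →L[ℝ] ℝ)) (x : R5) : Submodule ℝ R5 :=
  ⨅ i, LinearMap.ker (η i x).toLinearMap

/-- The one-forms `θ₁, θ₂, θ₃` of the flat Cartan distribution, in the coordinates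
`(a₁, a₂, a₃, a₄, a₅)`. -/
noncomputable def flatForm : Fin 3 → R5 → (R5 →L[ℝ] ℝ) :=
  ![fun a => dx 0 + (a 2 + 1 / 2 * a 3 * a 4) • dx 3,
    fun a => dx 1 + (a 2 - 1 / 2 * a 3 * a 4) • dx 4,
    fun a => dx 2 + (1 / 2 * a 3) • dx 4 - (1 / 2 * a 4) • dx 3]

/-- `D` is maximally symmetric on `U`, that is, locally equivalent to the flat Cartan distribution:
near each point of `U` some smooth local diffeomorphism maps `D` onto it. -/
def IsMaximallySymmetric (U : Opens R5) (D : R5 → Submodule ℝ R5) : Prop :=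
  ∀ x ∈ U, ∃ φ : OpenPartialHomeomorph R5 R5,
    x ∈ φ.source ∧ φ.source ⊆ U ∧
    ContDiffOn ℝ ∞ φ φ.source ∧ ContDiffOn ℝ ∞ φ.symm φ.target ∧
    ∀ u ∈ φ.source, (D u).map (fderiv ℝ φ u).toLinearMap = annihilatedBy flatForm (φ u)

end Distributions

/-! The coordinates `(w, y, z, p, q)` of a point `x` of `ℝ⁵` are `x 0, x 1, x 2, x 3, x 4`, and the
components of a vector field are listed in this order. -/

section Fields

/-- `Y = α w + β (w³ + g₃ / 2)`. -/
noncomputable def Y (α β g₃ w : ℝ) : ℝ := α * w + β * (w ^ 3 + g₃ / 2)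

/-- The points of `ℝ⁵` where the denominators `Y` and `4 w³ - g₃` do not vanish. -/
def regularSet (α β g₃ : ℝ) : Set R5 :=
  {x | Y α β g₃ (x 0) ≠ 0 ∧ 4 * x 0 ^ 3 - g₃ ≠ 0}

variable (α β g₃ δ : ℝ)

/-- The one-forms `ω₁, ω₂, ω₃`. -/
noncomputable def omega : Fin 3 → R5 → (R5 →L[ℝ] ℝ) :=
  ![fun x => dx 1 - (2 * x 3 / Y α β g₃ (x 0) ^ 2 * (4 * x 0 ^ 3 - g₃)) • dx 0,
    fun x => dx 3 - (2 * x 4 / Y α β g₃ (x 0) ^ 2 * (4 * x 0 ^ 3 - g₃)) • dx 0,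
    fun x => dx 2 - (2 * x 4 ^ 2 / Y α β g₃ (x 0) ^ 6 * (4 * x 0 ^ 3 - g₃) ^ 4) • dx 0]

/-- `X¹ = ∂_q`. -/
def X1 (_ : R5) : R5 := ![0, 0, 0, 0, 1]

/-- `X² = Y² / (2 (4w³ - g₃)) ∂_w + p ∂_y + q ∂_p + (4w³ - g₃)³ / Y⁴ q² ∂_z`. -/
noncomputable def X2 (x : R5) : R5 :=
  let w := x 0
  let p := x 3
  let q := x 4
  let Y := Y α β g₃ w
  ![Y ^ 2 / (2 * (4 * w ^ 3 - g₃)), p, (4 * w ^ 3 - g₃) ^ 3 / Y ^ 4 * q ^ 2, q, 0]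

noncomputable def c1 (x : R5) : ℝ :=
  let w := x 0
  let y := x 1
  let p := x 3
  let q := x 4
  let Y := Y α β g₃ w
  1 / (4 * δ ^ 3 * Y ^ 3) *
    (-2 * Y ^ 3 * (α * w + 3 * g₃ / 8 * β) * y + Y ^ 2 * (8 * w ^ 3 + g₃) * w * p
      + 2 * w ^ 2 * (4 * w ^ 3 - g₃) ^ 2 * q)

noncomputable def c2 (x : R5) : ℝ :=
  let w := x 0
  let y := x 1
  let z := x 2
  let p := x 3
  let q := x 4
  let Y := Y α β g₃ w
  6 * z - 12 * β * (α * w + 3 * g₃ * β / 16) * y ^ 2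
    + 12 * w ^ 2 * (16 * w ^ 3 + 5 * g₃) / Y ^ 2 * p ^ 2
    + 12 * ((4 * w ^ 3 - g₃) ^ 4 * w / Y ^ 6) * q ^ 2
    + 6 * w * (β * (8 * w ^ 3 + g₃) - 8 * α * w) / Y * y * p
    - 4 * (4 * w ^ 3 - g₃) ^ 2 * (2 * α - 3 * β * w ^ 2) / Y ^ 3 * y * q
    + 16 * ((5 * w ^ 3 + g₃) * (4 * w ^ 3 - g₃) ^ 2 / Y ^ 4) * p * q

noncomputable def c3 (x : R5) : ℝ :=
  let w := x 0
  let y := x 1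
  let p := x 3
  let q := x 4
  let Y := Y α β g₃ w
  1 / (δ * Y ^ 3) *
    (1 / 2 * α * Y ^ 3 * y - (2 * w ^ 3 + g₃) * Y ^ 2 * p - w * (4 * w ^ 3 - g₃) ^ 2 * q)

noncomputable def Z1 (x : R5) : R5 :=
  let w := x 0
  let q := x 4
  let Y := Y α β g₃ w
  ![0,
    -(2 * δ * w / Y),
    4 * δ * (4 * w ^ 3 - g₃) ^ 2 / Y ^ 3 * q,
    δ * (β * (8 * w ^ 3 + g₃) + 4 * α * w) / (2 * (4 * w ^ 3 - g₃)),
    -(12 * δ * Y ^ 3 * w ^ 2 / (4 * w ^ 3 - g₃) ^ 3)]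

noncomputable def S1 (x : R5) : R5 :=
  let w := x 0
  let y := x 1
  let p := x 3
  let q := x 4
  let Y := Y α β g₃ w
  (6 * β * δ ^ 2 * Y ^ 3 / (4 * w ^ 3 - g₃) ^ 2 * y
      + 24 * δ ^ 2 * w * Y ^ 2 / (4 * w ^ 3 - g₃) ^ 2 * p
      + 12 * δ ^ 2 * (α * (8 * w ^ 3 + g₃) + 9 * β * g₃ * w ^ 2) / ((4 * w ^ 3 - g₃) * Y) * q) • X1 x
    - (8 * δ ^ 2 * (4 * w ^ 3 - g₃) / Y ^ 2) • X2 α β g₃ x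

noncomputable def S2 (x : R5) : R5 :=
  let w := x 0
  let Y := Y α β g₃ w
  (Y ^ 3 / (4 * δ * (4 * w ^ 3 - g₃) ^ 2)) • X1 x

noncomputable def S3 (x : R5) : R5 :=
  -(c1 α β g₃ δ x • S1 α β g₃ δ x) + c2 α β g₃ x • S2 α β g₃ δ x
    - c3 α β g₃ δ x ^ 2 • Z1 α β g₃ δ x

end Fields

section Smoothness

variable {α β g₃ δ : ℝ}

theorem contDiff_Y : ContDiff ℝ ∞ fun x : R5 => Y α β g₃ (x 0) := by
  unfold Y
  fun_prop

theorem contDiffAt_X2 {x : R5} (hx : x ∈ regularSet α β g₃) : ContDiffAt ℝ ∞ (X2 α β g₃) x := by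
  obtain ⟨hY, hT⟩ := hx
  have hc : ContDiffAt ℝ ∞ (fun x : R5 => Y α β g₃ (x 0)) x := contDiff_Y.contDiffAt
  rw [contDiffAt_pi]
  intro i
  fin_cases i <;> simp only [X2] <;> simp <;> fun_prop (disch := simp_all)

theorem contDiffOn_Z1 : ContDiffOn ℝ ∞ (Z1 α β g₃ δ) (regularSet α β g₃) := by
  intro x hx
  obtain ⟨hY, hT⟩ := hx
  have hc : ContDiffAt ℝ ∞ (fun x : R5 => Y α β g₃ (x 0)) x := contDiff_Y.contDiffAt
  apply ContDiffAt.contDiffWithinAt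
  rw [contDiffAt_pi]
  intro i
  fin_cases i <;> simp only [Z1] <;> simp <;> fun_prop (disch := simp_all)

theorem contDiffOn_c1 (hδ : δ ≠ 0) : ContDiffOn ℝ ∞ (c1 α β g₃ δ) (regularSet α β g₃) := by
  intro x hx
  obtain ⟨hY, hT⟩ := hx
  have hc : ContDiffAt ℝ ∞ (fun x : R5 => Y α β g₃ (x 0)) x := contDiff_Y.contDiffAt
  apply ContDiffAt.contDiffWithinAt
  unfold c1
  dsimp only
  fun_prop (disch := simp_all)

theorem contDiffOn_c2 : ContDiffOn ℝ ∞ (c2 α β g₃) (regularSet α β g₃) := by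
  intro x hx
  obtain ⟨hY, hT⟩ := hx
  have hc : ContDiffAt ℝ ∞ (fun x : R5 => Y α β g₃ (x 0)) x := contDiff_Y.contDiffAt
  apply ContDiffAt.contDiffWithinAt
  unfold c2
  dsimp only
  fun_prop (disch := simp_all)

theorem contDiffOn_c3 (hδ : δ ≠ 0) : ContDiffOn ℝ ∞ (c3 α β g₃ δ) (regularSet α β g₃) := by
  intro x hx
  obtain ⟨hY, hT⟩ := hx
  have hc : ContDiffAt ℝ ∞ (fun x : R5 => Y α β g₃ (x 0)) x := contDiff_Y.contDiffAt
  apply ContDiffAt.contDiffWithinAt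
  unfold c3
  dsimp only
  fun_prop (disch := simp_all)

theorem contDiffOn_S1 : ContDiffOn ℝ ∞ (S1 α β g₃ δ) (regularSet α β g₃) := by
  intro x hx
  have hX := contDiffAt_X2 hx
  obtain ⟨hY, hT⟩ := hx
  have hc : ContDiffAt ℝ ∞ (fun x : R5 => Y α β g₃ (x 0)) x := contDiff_Y.contDiffAt
  apply ContDiffAt.contDiffWithinAt
  unfold S1 X1
  dsimp only
  fun_prop (disch := simp_all)

theorem contDiffOn_S2 (hδ : δ ≠ 0) : ContDiffOn ℝ ∞ (S2 α β g₃ δ) (regularSet α β g₃) := by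
  intro x hx
  obtain ⟨hY, hT⟩ := hx
  have hc : ContDiffAt ℝ ∞ (fun x : R5 => Y α β g₃ (x 0)) x := contDiff_Y.contDiffAt
  apply ContDiffAt.contDiffWithinAt
  unfold S2 X1
  dsimp only
  fun_prop (disch := simp_all)

theorem contDiffOn_S3 (hδ : δ ≠ 0) : ContDiffOn ℝ ∞ (S3 α β g₃ δ) (regularSet α β g₃) :=
  (((contDiffOn_c1 hδ).smul contDiffOn_S1).neg.add
    (contDiffOn_c2.smul (contDiffOn_S2 hδ))).sub
      (((contDiffOn_c3 hδ).pow 2).smul contDiffOn_Z1)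

end Smoothness

section FieldsOnOpenSet

variable {α β g₃ δ : ℝ} {U : Opens R5}

/-- `S¹` as an element of the Lie algebra of smooth vector fields on `U`. -/
noncomputable def fieldS1 (δ : ℝ) (hU : (U : Set R5) ⊆ regularSet α β g₃) : SmoothVectorField U :=
  SmoothVectorField.ofContDiffOn (S1 α β g₃ δ) (contDiffOn_S1.mono hU)

/-- `S²` as an element of the Lie algebra of smooth vector fields on `U`. -/
noncomputable def fieldS2 (hδ : δ ≠ 0) (hU : (U : Set R5) ⊆ regularSet α β g₃) :
    SmoothVectorField U :=
  SmoothVectorField.ofContDiffOn (S2 α β g₃ δ) ((contDiffOn_S2 hδ).mono hU)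

/-- `S³` as an element of the Lie algebra of smooth vector fields on `U`. -/
noncomputable def fieldS3 (hδ : δ ≠ 0) (hU : (U : Set R5) ⊆ regularSet α β g₃) :
    SmoothVectorField U :=
  SmoothVectorField.ofContDiffOn (S3 α β g₃ δ) ((contDiffOn_S3 hδ).mono hU)

end FieldsOnOpenSet

end HalphenG2

open HalphenG2

/-! The three fields become polynomial in suitable coordinates. Take $a=-w/(4\delta^2)$, the
function $b$ given by `flatCoord`, and corrected multiples of $c_1,c_2,c_3$. The resulting map
`flatChart` has invertible derivative on the regular set and carries $S^1,S^2,S^3$ to polynomial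
fields on $\mathbb R^5$, the first two of which span the flat Cartan distribution. Since $S^1,S^2$
also span $\mathcal D$ (`span_S1_S2`), the inverse function theorem gives maximal symmetry.

The same map settles the Lie algebra. Pulling fields back along a map with invertible derivative is
a homomorphism (`SmoothVectorField.pullbackHom`), so the bracket relations collected in
`G2FrameRelations` need only be checked for the polynomial fields, where they are finitely many
polynomial identities (`FlatModel.flat_frameRelations`).

These relations force split $\mathfrak g_2$. The vectors $S^1$, $L^3$ and rescalings of $S^5$, $L^6$
satisfy the Serre relations (`G2FrameRelations.serreG2`), so the algebra they generate is a quotient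
of $\mathfrak g_2$ in Serre's presentation, which is spanned by fourteen elements
(`SerreG2.rootSpan_eq_top`). Conversely, the fourteen members of the frame are independent: the root
vectors are non-zero and have distinct non-zero eigenvalues under one Cartan element, and the two
Cartan elements are told apart by their action on $S^1$ and $S^2$. Hence $14\le\dim\le 14$: the
homomorphism from $\mathfrak g_2$ is injective and the frame is a basis of its image. The lower
bound on $\dim\mathfrak g_2$ thus comes from the vector fields themselves. The Cartan subalgebra is
self-normalising because no root vanishes on both Cartan elements.

The growth $(2,3,5)$ and the annihilating forms are direct computations with $X^1$, $X^2$. -/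

/-- The Serre relations of type `G₂`, with `e₀` attached to the short simple root and `e₁` to the
long one. -/
structure SerreG2 {L : Type*} [LieRing L] [LieAlgebra ℝ L] (e₀ e₁ f₀ f₁ h₀ h₁ : L) : Prop where
  hh : ⁅h₀, h₁⁆ = 0
  ef00 : ⁅e₀, f₀⁆ = h₀
  ef01 : ⁅e₀, f₁⁆ = 0
  ef10 : ⁅e₁, f₀⁆ = 0
  ef11 : ⁅e₁, f₁⁆ = h₁
  he00 : ⁅h₀, e₀⁆ = (2 : ℝ) • e₀
  he01 : ⁅h₀, e₁⁆ = (-3 : ℝ) • e₁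
  he10 : ⁅h₁, e₀⁆ = (-1 : ℝ) • e₀
  he11 : ⁅h₁, e₁⁆ = (2 : ℝ) • e₁
  hf00 : ⁅h₀, f₀⁆ = (-2 : ℝ) • f₀
  hf01 : ⁅h₀, f₁⁆ = (3 : ℝ) • f₁
  hf10 : ⁅h₁, f₀⁆ = (1 : ℝ) • f₀
  hf11 : ⁅h₁, f₁⁆ = (-2 : ℝ) • f₁
  ee0 : ⁅e₀, ⁅e₀, ⁅e₀, ⁅e₀, e₁⁆⁆⁆⁆ = 0
  ee1 : ⁅e₁, ⁅e₁, e₀⁆⁆ = 0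
  ff0 : ⁅f₀, ⁅f₀, ⁅f₀, ⁅f₀, f₁⁆⁆⁆⁆ = 0
  ff1 : ⁅f₁, ⁅f₁, f₀⁆⁆ = 0

/-! ### Fourteen spanning elements from the Serre relations. -/

namespace SerreG2

variable {L : Type*} [LieRing L] [LieAlgebra ℝ L] {e₀ e₁ f₀ f₁ h₀ h₁ : L}

/-- The Chevalley involution exchanges the positive and the negative generators. -/
theorem symm (s : SerreG2 e₀ e₁ f₀ f₁ h₀ h₁) : SerreG2 f₀ f₁ e₀ e₁ (-h₀) (-h₁) where
  hh := by simp [s.hh]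
  ef00 := by rw [← lie_skew, s.ef00]
  ef01 := by rw [← lie_skew, s.ef10, neg_zero]
  ef10 := by rw [← lie_skew, s.ef01, neg_zero]
  ef11 := by rw [← lie_skew, s.ef11]
  he00 := by rw [neg_lie, s.hf00]; module
  he01 := by rw [neg_lie, s.hf01]; module
  he10 := by rw [neg_lie, s.hf10]; module
  he11 := by rw [neg_lie, s.hf11]; module
  hf00 := by rw [neg_lie, s.he00]; module
  hf01 := by rw [neg_lie, s.he01]; module
  hf10 := by rw [neg_lie, s.he10]; module
  hf11 := by rw [neg_lie, s.he11]; module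
  ee0 := s.ff0
  ee1 := s.ff1
  ff0 := s.ee0
  ff1 := s.ee1

/-- The span of the two Cartan generators and of the twelve root vectors. -/
def rootSpan (e₀ e₁ f₀ f₁ h₀ h₁ : L) : Submodule ℝ L :=
  Submodule.span ℝ (Set.range ![h₀, h₁,
    e₀, e₁, ⁅e₀, e₁⁆, ⁅e₀, ⁅e₀, e₁⁆⁆, ⁅e₀, ⁅e₀, ⁅e₀, e₁⁆⁆⁆, ⁅e₁, ⁅e₀, ⁅e₀, ⁅e₀, e₁⁆⁆⁆⁆,
    f₀, f₁, ⁅f₀, f₁⁆, ⁅f₀, ⁅f₀, f₁⁆⁆, ⁅f₀, ⁅f₀, ⁅f₀, f₁⁆⁆⁆, ⁅f₁, ⁅f₀, ⁅f₀, ⁅f₀, f₁⁆⁆⁆⁆])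

theorem basis_mem_rootSpan (e₀ e₁ f₀ f₁ h₀ h₁ : L) (i : Fin 14) :
    (![h₀, h₁,
    e₀, e₁, ⁅e₀, e₁⁆, ⁅e₀, ⁅e₀, e₁⁆⁆, ⁅e₀, ⁅e₀, ⁅e₀, e₁⁆⁆⁆, ⁅e₁, ⁅e₀, ⁅e₀, ⁅e₀, e₁⁆⁆⁆⁆,
    f₀, f₁, ⁅f₀, f₁⁆, ⁅f₀, ⁅f₀, f₁⁆⁆, ⁅f₀, ⁅f₀, ⁅f₀, f₁⁆⁆⁆, ⁅f₁, ⁅f₀, ⁅f₀, ⁅f₀, f₁⁆⁆⁆⁆] : Fin 14 → L) i ∈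
      rootSpan e₀ e₁ f₀ f₁ h₀ h₁ :=
  Submodule.subset_span ⟨i, rfl⟩

/-- The exchange permutes the spanning elements up to the sign of the Cartan ones. One inclusion
suffices, because exchanging twice is the identity. -/
theorem rootSpan_symm (e₀ e₁ f₀ f₁ h₀ h₁ : L) :
    rootSpan f₀ f₁ e₀ e₁ (-h₀) (-h₁) = rootSpan e₀ e₁ f₀ f₁ h₀ h₁ := by
  have key : ∀ e₀ e₁ f₀ f₁ h₀ h₁ : L,
      rootSpan f₀ f₁ e₀ e₁ (-h₀) (-h₁) ≤ rootSpan e₀ e₁ f₀ f₁ h₀ h₁ := by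
    intro e₀ e₁ f₀ f₁ h₀ h₁
    have h := basis_mem_rootSpan e₀ e₁ f₀ f₁ h₀ h₁
    refine Submodule.span_le.2 ?_
    rintro _ ⟨i, rfl⟩
    fin_cases i
    exacts [Submodule.neg_mem _ (h 0), Submodule.neg_mem _ (h 1), h 8, h 9, h 10, h 11, h 12, h 13,
      h 2, h 3, h 4, h 5, h 6, h 7]
  refine le_antisymm (key _ _ _ _ _ _) ?_
  simpa only [neg_neg] using key f₀ f₁ e₀ e₁ (-h₀) (-h₁)

theorem lie_e₁_e₀e₁ (s : SerreG2 e₀ e₁ f₀ f₁ h₀ h₁) : ⁅e₁, ⁅e₀, e₁⁆⁆ = 0 := by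
  rw [← lie_skew e₀ e₁, lie_neg, s.ee1, neg_zero]

theorem lie_e₁_e₀e₀e₁ (s : SerreG2 e₀ e₁ f₀ f₁ h₀ h₁) : ⁅e₁, ⁅e₀, ⁅e₀, e₁⁆⁆⁆ = 0 := by
  rw [leibniz_lie, s.lie_e₁_e₀e₁, ← lie_skew e₁ e₀, neg_lie, lie_self, neg_zero, lie_zero, add_zero]

/-- A second expression for the highest root vector; comparing the two shows that both positive
generators kill it. -/
theorem lie_e₁_e₀e₀e₀e₁ (s : SerreG2 e₀ e₁ f₀ f₁ h₀ h₁) :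
    ⁅e₁, ⁅e₀, ⁅e₀, ⁅e₀, e₁⁆⁆⁆⁆ = -⁅⁅e₀, e₁⁆, ⁅e₀, ⁅e₀, e₁⁆⁆⁆ := by
  rw [leibniz_lie, s.lie_e₁_e₀e₀e₁, ← lie_skew e₁ e₀]
  simp

/-- The Jacobi identity applied to the two expressions of the highest root vector yields the same
bracket with opposite signs, so the element equals its own negative. -/
theorem lie_e₀_highest (s : SerreG2 e₀ e₁ f₀ f₁ h₀ h₁) :
    ⁅e₀, ⁅e₁, ⁅e₀, ⁅e₀, ⁅e₀, e₁⁆⁆⁆⁆⁆ = 0 := by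
  have h1 : ⁅e₀, ⁅e₁, ⁅e₀, ⁅e₀, ⁅e₀, e₁⁆⁆⁆⁆⁆ = ⁅⁅e₀, e₁⁆, ⁅e₀, ⁅e₀, ⁅e₀, e₁⁆⁆⁆⁆ := by
    rw [leibniz_lie, s.ee0]; simp
  have h2 : ⁅e₀, ⁅e₁, ⁅e₀, ⁅e₀, ⁅e₀, e₁⁆⁆⁆⁆⁆ = -⁅⁅e₀, e₁⁆, ⁅e₀, ⁅e₀, ⁅e₀, e₁⁆⁆⁆⁆ := by
    rw [s.lie_e₁_e₀e₀e₀e₁, lie_neg, leibniz_lie]; simp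
  rw [← h1] at h2
  have h3 : (2 : ℝ) • ⁅e₀, ⁅e₁, ⁅e₀, ⁅e₀, ⁅e₀, e₁⁆⁆⁆⁆⁆ = 0 := by
    rw [two_smul]
    exact eq_neg_iff_add_eq_zero.1 h2
  exact (smul_eq_zero.1 h3).resolve_left two_ne_zero

theorem lie_e₁_highest (s : SerreG2 e₀ e₁ f₀ f₁ h₀ h₁) :
    ⁅e₁, ⁅e₁, ⁅e₀, ⁅e₀, ⁅e₀, e₁⁆⁆⁆⁆⁆ = 0 := by
  rw [s.lie_e₁_e₀e₀e₀e₁, lie_neg, leibniz_lie, s.lie_e₁_e₀e₁, s.lie_e₁_e₀e₀e₁]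
  simp

/-! Brackets of a positive generator with the negative root vectors. -/

theorem lie_h₀_n3 (s : SerreG2 e₀ e₁ f₀ f₁ h₀ h₁) : ⁅h₀, ⁅f₀, f₁⁆⁆ = ⁅f₀, f₁⁆ := by
  rw [leibniz_lie, s.hf00, s.hf01, smul_lie, lie_smul]; module

theorem lie_h₀_n4 (s : SerreG2 e₀ e₁ f₀ f₁ h₀ h₁) :
    ⁅h₀, ⁅f₀, ⁅f₀, f₁⁆⁆⁆ = -⁅f₀, ⁅f₀, f₁⁆⁆ := by
  rw [leibniz_lie, s.hf00, s.lie_h₀_n3, smul_lie]; module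

theorem lie_h₁_n3 (s : SerreG2 e₀ e₁ f₀ f₁ h₀ h₁) : ⁅h₁, ⁅f₀, f₁⁆⁆ = -⁅f₀, f₁⁆ := by
  rw [leibniz_lie, s.hf10, s.hf11, smul_lie, lie_smul]; module

theorem lie_h₁_n4 (s : SerreG2 e₀ e₁ f₀ f₁ h₀ h₁) : ⁅h₁, ⁅f₀, ⁅f₀, f₁⁆⁆⁆ = 0 := by
  rw [leibniz_lie, s.hf10, s.lie_h₁_n3, smul_lie, lie_neg]; module

theorem lie_h₁_n5 (s : SerreG2 e₀ e₁ f₀ f₁ h₀ h₁) :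
    ⁅h₁, ⁅f₀, ⁅f₀, ⁅f₀, f₁⁆⁆⁆⁆ = ⁅f₀, ⁅f₀, ⁅f₀, f₁⁆⁆⁆ := by
  rw [leibniz_lie, s.hf10, s.lie_h₁_n4, smul_lie, lie_zero]; module

theorem lie_e₀_n3 (s : SerreG2 e₀ e₁ f₀ f₁ h₀ h₁) : ⁅e₀, ⁅f₀, f₁⁆⁆ = (3 : ℝ) • f₁ := by
  rw [leibniz_lie, s.ef00, s.ef01, s.hf01, lie_zero, add_zero]

theorem lie_e₀_n4 (s : SerreG2 e₀ e₁ f₀ f₁ h₀ h₁) :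
    ⁅e₀, ⁅f₀, ⁅f₀, f₁⁆⁆⁆ = (4 : ℝ) • ⁅f₀, f₁⁆ := by
  rw [leibniz_lie, s.ef00, s.lie_h₀_n3, s.lie_e₀_n3, lie_smul]; module

theorem lie_e₀_n5 (s : SerreG2 e₀ e₁ f₀ f₁ h₀ h₁) :
    ⁅e₀, ⁅f₀, ⁅f₀, ⁅f₀, f₁⁆⁆⁆⁆ = (3 : ℝ) • ⁅f₀, ⁅f₀, f₁⁆⁆ := by
  rw [leibniz_lie, s.ef00, s.lie_h₀_n4, s.lie_e₀_n4, lie_smul]; module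

theorem lie_e₀_n6 (s : SerreG2 e₀ e₁ f₀ f₁ h₀ h₁) :
    ⁅e₀, ⁅f₁, ⁅f₀, ⁅f₀, ⁅f₀, f₁⁆⁆⁆⁆⁆ = 0 := by
  rw [leibniz_lie, s.ef01, s.lie_e₀_n5, lie_smul, s.symm.lie_e₁_e₀e₀e₁]; simp

theorem lie_e₁_n3 (s : SerreG2 e₀ e₁ f₀ f₁ h₀ h₁) : ⁅e₁, ⁅f₀, f₁⁆⁆ = -f₀ := by
  rw [leibniz_lie, s.ef10, s.ef11, ← lie_skew f₀ h₁, s.hf10]; simp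

theorem lie_e₁_n4 (s : SerreG2 e₀ e₁ f₀ f₁ h₀ h₁) : ⁅e₁, ⁅f₀, ⁅f₀, f₁⁆⁆⁆ = 0 := by
  rw [leibniz_lie, s.ef10, s.lie_e₁_n3]; simp

theorem lie_e₁_n5 (s : SerreG2 e₀ e₁ f₀ f₁ h₀ h₁) : ⁅e₁, ⁅f₀, ⁅f₀, ⁅f₀, f₁⁆⁆⁆⁆ = 0 := by
  rw [leibniz_lie, s.ef10, s.lie_e₁_n4]; simp

theorem lie_e₁_n6 (s : SerreG2 e₀ e₁ f₀ f₁ h₀ h₁) :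
    ⁅e₁, ⁅f₁, ⁅f₀, ⁅f₀, ⁅f₀, f₁⁆⁆⁆⁆⁆ = ⁅f₀, ⁅f₀, ⁅f₀, f₁⁆⁆⁆ := by
  rw [leibniz_lie, s.ef11, s.lie_e₁_n5, s.lie_h₁_n5]; simp

/-- On positive root vectors `e₀` either steps to the next listed element or gives zero; on negative
ones it removes one `f₀`, up to a scalar, or gives zero or `h₀`. -/
theorem lie_e₀_mem_rootSpan (s : SerreG2 e₀ e₁ f₀ f₁ h₀ h₁) {v : L}
    (hv : v ∈ rootSpan e₀ e₁ f₀ f₁ h₀ h₁) : ⁅e₀, v⁆ ∈ rootSpan e₀ e₁ f₀ f₁ h₀ h₁ := by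
  have h := basis_mem_rootSpan e₀ e₁ f₀ f₁ h₀ h₁
  suffices rootSpan e₀ e₁ f₀ f₁ h₀ h₁ ≤
      (rootSpan e₀ e₁ f₀ f₁ h₀ h₁).comap (LieAlgebra.ad ℝ L e₀ : L →ₗ[ℝ] L) from this hv
  refine Submodule.span_le.2 ?_
  rintro _ ⟨i, rfl⟩
  simp only [Submodule.comap_coe, Set.mem_preimage, LieAlgebra.ad_apply, SetLike.mem_coe]
  fin_cases i
  · change ⁅e₀, h₀⁆ ∈ _
    rw [← lie_skew, s.he00]; exact Submodule.neg_mem _ (Submodule.smul_mem _ _ (h 2))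
  · change ⁅e₀, h₁⁆ ∈ _
    rw [← lie_skew, s.he10]; exact Submodule.neg_mem _ (Submodule.smul_mem _ _ (h 2))
  · change ⁅e₀, e₀⁆ ∈ _
    rw [lie_self]; exact Submodule.zero_mem _
  · exact h 4
  · exact h 5
  · exact h 6
  · change ⁅e₀, ⁅e₀, ⁅e₀, ⁅e₀, e₁⁆⁆⁆⁆ ∈ _
    rw [s.ee0]; exact Submodule.zero_mem _
  · change ⁅e₀, ⁅e₁, ⁅e₀, ⁅e₀, ⁅e₀, e₁⁆⁆⁆⁆⁆ ∈ _
    rw [s.lie_e₀_highest]; exact Submodule.zero_mem _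
  · change ⁅e₀, f₀⁆ ∈ _
    rw [s.ef00]; exact h 0
  · change ⁅e₀, f₁⁆ ∈ _
    rw [s.ef01]; exact Submodule.zero_mem _
  · change ⁅e₀, ⁅f₀, f₁⁆⁆ ∈ _
    rw [s.lie_e₀_n3]; exact Submodule.smul_mem _ _ (h 9)
  · change ⁅e₀, ⁅f₀, ⁅f₀, f₁⁆⁆⁆ ∈ _
    rw [s.lie_e₀_n4]; exact Submodule.smul_mem _ _ (h 10)
  · change ⁅e₀, ⁅f₀, ⁅f₀, ⁅f₀, f₁⁆⁆⁆⁆ ∈ _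
    rw [s.lie_e₀_n5]; exact Submodule.smul_mem _ _ (h 11)
  · change ⁅e₀, ⁅f₁, ⁅f₀, ⁅f₀, ⁅f₀, f₁⁆⁆⁆⁆⁆ ∈ _
    rw [s.lie_e₀_n6]; exact Submodule.zero_mem _

theorem lie_e₁_mem_rootSpan (s : SerreG2 e₀ e₁ f₀ f₁ h₀ h₁) {v : L}
    (hv : v ∈ rootSpan e₀ e₁ f₀ f₁ h₀ h₁) : ⁅e₁, v⁆ ∈ rootSpan e₀ e₁ f₀ f₁ h₀ h₁ := by
  have h := basis_mem_rootSpan e₀ e₁ f₀ f₁ h₀ h₁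
  suffices rootSpan e₀ e₁ f₀ f₁ h₀ h₁ ≤
      (rootSpan e₀ e₁ f₀ f₁ h₀ h₁).comap (LieAlgebra.ad ℝ L e₁ : L →ₗ[ℝ] L) from this hv
  refine Submodule.span_le.2 ?_
  rintro _ ⟨i, rfl⟩
  simp only [Submodule.comap_coe, Set.mem_preimage, LieAlgebra.ad_apply, SetLike.mem_coe]
  fin_cases i
  · change ⁅e₁, h₀⁆ ∈ _
    rw [← lie_skew, s.he01]; exact Submodule.neg_mem _ (Submodule.smul_mem _ _ (h 3))
  · change ⁅e₁, h₁⁆ ∈ _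
    rw [← lie_skew, s.he11]; exact Submodule.neg_mem _ (Submodule.smul_mem _ _ (h 3))
  · change ⁅e₁, e₀⁆ ∈ _
    rw [← lie_skew]; exact Submodule.neg_mem _ (h 4)
  · change ⁅e₁, e₁⁆ ∈ _
    rw [lie_self]; exact Submodule.zero_mem _
  · change ⁅e₁, ⁅e₀, e₁⁆⁆ ∈ _
    rw [s.lie_e₁_e₀e₁]; exact Submodule.zero_mem _
  · change ⁅e₁, ⁅e₀, ⁅e₀, e₁⁆⁆⁆ ∈ _
    rw [s.lie_e₁_e₀e₀e₁]; exact Submodule.zero_mem _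
  · exact h 7
  · change ⁅e₁, ⁅e₁, ⁅e₀, ⁅e₀, ⁅e₀, e₁⁆⁆⁆⁆⁆ ∈ _
    rw [s.lie_e₁_highest]; exact Submodule.zero_mem _
  · change ⁅e₁, f₀⁆ ∈ _
    rw [s.ef10]; exact Submodule.zero_mem _
  · change ⁅e₁, f₁⁆ ∈ _
    rw [s.ef11]; exact h 1
  · change ⁅e₁, ⁅f₀, f₁⁆⁆ ∈ _
    rw [s.lie_e₁_n3]; exact Submodule.neg_mem _ (h 8)
  · change ⁅e₁, ⁅f₀, ⁅f₀, f₁⁆⁆⁆ ∈ _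
    rw [s.lie_e₁_n4]; exact Submodule.zero_mem _
  · change ⁅e₁, ⁅f₀, ⁅f₀, ⁅f₀, f₁⁆⁆⁆⁆ ∈ _
    rw [s.lie_e₁_n5]; exact Submodule.zero_mem _
  · change ⁅e₁, ⁅f₁, ⁅f₀, ⁅f₀, ⁅f₀, f₁⁆⁆⁆⁆⁆ ∈ _
    rw [s.lie_e₁_n6]; exact h 12

/-- If the four root generators generate the Lie algebra, then it is spanned by the fourteen
standard elements. -/
theorem rootSpan_eq_top (s : SerreG2 e₀ e₁ f₀ f₁ h₀ h₁)
    (hgen : LieSubalgebra.lieSpan ℝ L {e₀, e₁, f₀, f₁} = ⊤) :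
    rootSpan e₀ e₁ f₀ f₁ h₀ h₁ = ⊤ := by
  have h := basis_mem_rootSpan e₀ e₁ f₀ f₁ h₀ h₁
  -- Stability under the negative generators is the positive case read through the Chevalley
  -- involution.
  have hf₀ : ∀ v ∈ rootSpan e₀ e₁ f₀ f₁ h₀ h₁, ⁅f₀, v⁆ ∈ rootSpan e₀ e₁ f₀ f₁ h₀ h₁ := by
    rw [← rootSpan_symm]; exact fun v hv => s.symm.lie_e₀_mem_rootSpan hv
  have hf₁ : ∀ v ∈ rootSpan e₀ e₁ f₀ f₁ h₀ h₁, ⁅f₁, v⁆ ∈ rootSpan e₀ e₁ f₀ f₁ h₀ h₁ := by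
    rw [← rootSpan_symm]; exact fun v hv => s.symm.lie_e₁_mem_rootSpan hv
  -- The elements whose adjoint action preserves the span form a subalgebra. It contains the
  -- generators, hence everything, so the span is an ideal.
  have hstab : ∀ x v : L, v ∈ rootSpan e₀ e₁ f₀ f₁ h₀ h₁ →
      ⁅x, v⁆ ∈ rootSpan e₀ e₁ f₀ f₁ h₀ h₁ := by
    intro x
    have hx : x ∈ LieSubalgebra.lieSpan ℝ L {e₀, e₁, f₀, f₁} := hgen ▸ LieSubalgebra.mem_top x
    induction hx using LieSubalgebra.lieSpan_induction with
    | mem x hx =>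
      rcases hx with rfl | rfl | rfl | rfl
      exacts [fun _ => s.lie_e₀_mem_rootSpan, fun _ => s.lie_e₁_mem_rootSpan, hf₀, hf₁]
    | zero => intro v _; simp
    | add x y _ _ hx hy => intro v hv; rw [add_lie]; exact Submodule.add_mem _ (hx v hv) (hy v hv)
    | smul c x _ hx => intro v hv; rw [smul_lie]; exact Submodule.smul_mem _ _ (hx v hv)
    | lie x y _ _ hx hy =>
      intro v hv
      rw [lie_lie]
      exact Submodule.sub_mem _ (hx _ (hy v hv)) (hy _ (hx v hv))
  rw [eq_top_iff]
  intro x _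
  have hx : x ∈ LieSubalgebra.lieSpan ℝ L {e₀, e₁, f₀, f₁} := hgen ▸ LieSubalgebra.mem_top x
  induction hx using LieSubalgebra.lieSpan_induction with
  | mem x hx =>
    rcases hx with rfl | rfl | rfl | rfl
    exacts [h 2, h 3, h 8, h 9]
  | zero => exact Submodule.zero_mem _
  | add x y _ _ hx hy => exact Submodule.add_mem _ (hx trivial) (hy trivial)
  | smul c x _ hx => exact Submodule.smul_mem _ _ (hx trivial)
  | lie x y _ _ hx hy => exact hstab x y (hy trivial)

/-- Only the upper bound is available here; equality in the case of `𝔤₂` follows once an independent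
realisation is exhibited. -/
theorem finite_and_finrank_le (s : SerreG2 e₀ e₁ f₀ f₁ h₀ h₁)
    (hgen : LieSubalgebra.lieSpan ℝ L {e₀, e₁, f₀, f₁} = ⊤) :
    Module.Finite ℝ L ∧ Module.finrank ℝ L ≤ 14 := by
  have h := s.rootSpan_eq_top hgen
  refine ⟨⟨h ▸ Submodule.fg_span (Set.finite_range _)⟩, ?_⟩
  rw [← finrank_top, ← h]
  exact (finrank_range_le_card _).trans_eq (Fintype.card_fin 14)

end SerreG2

/-! ### Split `𝔤₂` by generators and relations, and its universal property. -/

section SerreConstruction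

open CartanMatrix

/-- By freeness the generators lift to a homomorphism into the subalgebra they generate. Followed by
the inclusion it fixes the generators, so it is the identity, and every element lies in the
subalgebra. -/
theorem FreeLieAlgebra.lieSpan_range_of (X : Type*) :
    LieSubalgebra.lieSpan ℝ (FreeLieAlgebra ℝ X) (Set.range (FreeLieAlgebra.of ℝ)) = ⊤ := by
  set K := LieSubalgebra.lieSpan ℝ (FreeLieAlgebra ℝ X) (Set.range (FreeLieAlgebra.of ℝ))
  let φ : FreeLieAlgebra ℝ X →ₗ⁅ℝ⁆ K :=
    FreeLieAlgebra.lift ℝ fun x => ⟨FreeLieAlgebra.of ℝ x, LieSubalgebra.subset_lieSpan ⟨x, rfl⟩⟩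
  have h : K.incl.comp φ = LieHom.id := FreeLieAlgebra.hom_ext fun x => by
    simp [φ]
  rw [eq_top_iff]
  intro x _
  have := LieHom.congr_fun h x
  simp only [LieHom.comp_apply, LieHom.id_apply] at this
  rw [← this]
  exact (φ x).2

/-- A homomorphism from the free Lie algebra kills the defining relations of `𝔤₂` exactly when the
images of the generators satisfy the Serre relations. -/
theorem serreG2_iff {L : Type*} [LieRing L] [LieAlgebra ℝ L]
    (φ : FreeLieAlgebra ℝ (Generators (Fin 2)) →ₗ⁅ℝ⁆ L) :
    (∀ x ∈ Relations.toSet ℝ CartanMatrix.G₂, φ x = 0) ↔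
      SerreG2 (φ (.of ℝ (.E 0))) (φ (.of ℝ (.E 1))) (φ (.of ℝ (.F 0))) (φ (.of ℝ (.F 1)))
        (φ (.of ℝ (.H 0))) (φ (.of ℝ (.H 1))) := by
  -- The exponents in the relations for `ad`, read off from the Cartan matrix. The diagonal entry
  -- gives exponent 0, so there the relation is the empty condition `⁅x, x⁆ = 0`.
  have t1 : (- -1 : ℤ).toNat = 1 := rfl
  have t2 : (-2 : ℤ).toNat = 0 := rfl
  have t3 : (- -3 : ℤ).toNat = 3 := rfl
  have z (n : ℤ) (x : L) : n • x = (n : ℝ) • x := (Int.cast_smul_eq_zsmul ℝ n x).symm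
  simp only [Relations.toSet, Set.mem_union, or_imp, forall_and, Set.forall_mem_range, Prod.forall,
    Fin.forall_fin_two, Relations.HH, Relations.EF, Relations.HE, Relations.HF,
    Relations.adE, Relations.adF, Function.uncurry, CartanMatrix.G₂, Function.comp_apply,
    Matrix.of_apply, Matrix.cons_val_zero, Matrix.cons_val_one, Matrix.cons_val', map_sub, map_add,
    LieHom.map_lie, map_zsmul, t1, t2, t3, pow_zero, pow_succ, Module.End.mul_apply,
    Module.End.one_apply, LieAlgebra.ad_apply, z, lie_self, if_true, one_ne_zero, zero_ne_one,
    if_false, sub_eq_zero]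
  constructor
  · rintro ⟨⟨⟨⟨⟨⟨⟨-, -⟩, hh, -⟩, ⟨ef00, ef10⟩, ef01, ef11⟩, ⟨he00, he10⟩, he01, he11⟩,
      ⟨hf00, hf10⟩, hf01, hf11⟩, ⟨-, ee1⟩, ee0, -⟩, ⟨-, ff1⟩, ff0, -⟩
    push_cast at he00 he01 he10 he11 hf00 hf01 hf10 hf11
    refine ⟨hh, ef00, ef01, ef10, ef11, he00, he01, he10, he11, ?_, ?_, ?_, ?_, ee0, ee1, ff0, ff1⟩
    · rw [eq_neg_of_add_eq_zero_left hf00, neg_smul]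
    · rw [eq_neg_of_add_eq_zero_left hf01, neg_smul, neg_neg]
    · rw [eq_neg_of_add_eq_zero_left hf10, neg_smul, neg_neg]
    · rw [eq_neg_of_add_eq_zero_left hf11, neg_smul]
  · intro s
    have hh : ⁅φ (.of ℝ (.H 1)), φ (.of ℝ (.H 0))⁆ = 0 := by rw [← lie_skew, s.hh, neg_zero]
    simp [hh, s.hh, s.ef00, s.ef01, s.ef10, s.ef11, s.he00, s.he01, s.he10, s.he11, s.hf00, s.hf01,
      s.hf10, s.hf11, s.ee0, s.ee1, s.ff0, s.ff1]

/-- The projection from the free Lie algebra to the split Lie algebra of type `G₂`. -/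
noncomputable def g₂Mk : FreeLieAlgebra ℝ (Generators (Fin 2)) →ₗ⁅ℝ⁆ LieAlgebra.g₂ ℝ where
  toFun := LieSubmodule.Quotient.mk' (Relations.toIdeal ℝ CartanMatrix.G₂)
  map_add' _ _ := rfl
  map_smul' _ _ := rfl
  map_lie' := rfl

theorem g₂Mk_surjective : Function.Surjective g₂Mk :=
  LieSubmodule.Quotient.surjective_mk' _

theorem g₂Mk_eq_zero_iff {x : FreeLieAlgebra ℝ (Generators (Fin 2))} :
    g₂Mk x = 0 ↔ x ∈ Relations.toIdeal ℝ CartanMatrix.G₂ :=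
  LieSubmodule.Quotient.mk_eq_zero (N := Relations.toIdeal ℝ CartanMatrix.G₂)

/-- The images in `𝔤₂` of the generators. -/
noncomputable def g₂Gen (x : Generators (Fin 2)) : LieAlgebra.g₂ ℝ :=
  g₂Mk (FreeLieAlgebra.of ℝ x)

theorem serreG2_g₂Gen :
    SerreG2 (g₂Gen (.E 0)) (g₂Gen (.E 1)) (g₂Gen (.F 0)) (g₂Gen (.F 1)) (g₂Gen (.H 0))
      (g₂Gen (.H 1)) :=
  (serreG2_iff g₂Mk).1 fun _ hx => g₂Mk_eq_zero_iff.2 (LieSubmodule.subset_lieSpan hx)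

/-- The Cartan generators are redundant, being the brackets of each `E` with its `F`. -/
theorem lieSpan_g₂Gen :
    LieSubalgebra.lieSpan ℝ (LieAlgebra.g₂ ℝ)
      {g₂Gen (.E 0), g₂Gen (.E 1), g₂Gen (.F 0), g₂Gen (.F 1)} = ⊤ := by
  set K := LieSubalgebra.lieSpan ℝ (LieAlgebra.g₂ ℝ)
    {g₂Gen (.E 0), g₂Gen (.E 1), g₂Gen (.F 0), g₂Gen (.F 1)} with hK
  have hE : ∀ i, g₂Gen (.E i) ∈ K := by
    rw [Fin.forall_fin_two]
    constructor <;> exact LieSubalgebra.subset_lieSpan (by simp)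
  have hF : ∀ i, g₂Gen (.F i) ∈ K := by
    rw [Fin.forall_fin_two]
    constructor <;> exact LieSubalgebra.subset_lieSpan (by simp)
  have hH : ∀ i, g₂Gen (.H i) ∈ K := by
    rw [Fin.forall_fin_two, ← serreG2_g₂Gen.ef00, ← serreG2_g₂Gen.ef11]
    exact ⟨K.lie_mem (hE 0) (hF 0), K.lie_mem (hE 1) (hF 1)⟩
  have h : LieSubalgebra.lieSpan ℝ _ (Set.range (FreeLieAlgebra.of ℝ)) ≤ K.comap g₂Mk := by
    rw [LieSubalgebra.lieSpan_le]
    rintro _ ⟨x, rfl⟩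
    cases x with
    | H i => exact hH i
    | E i => exact hE i
    | F i => exact hF i
  rw [FreeLieAlgebra.lieSpan_range_of] at h
  rw [eq_top_iff]
  intro x _
  obtain ⟨x, rfl⟩ := g₂Mk_surjective x
  exact h (LieSubalgebra.mem_top x)

theorem finite_g₂ : Module.Finite ℝ (LieAlgebra.g₂ ℝ) :=
  (serreG2_g₂Gen.finite_and_finrank_le lieSpan_g₂Gen).1

theorem finrank_g₂_le : Module.finrank ℝ (LieAlgebra.g₂ ℝ) ≤ 14 :=
  (serreG2_g₂Gen.finite_and_finrank_le lieSpan_g₂Gen).2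

/-- The universal property of `𝔤₂`: elements satisfying the Serre relations define a homomorphism,
whose range is the subalgebra they generate. -/
theorem SerreG2.exists_hom {L : Type*} [LieRing L] [LieAlgebra ℝ L] {e₀ e₁ f₀ f₁ h₀ h₁ : L}
    (s : SerreG2 e₀ e₁ f₀ f₁ h₀ h₁) :
    ∃ ψ : LieAlgebra.g₂ ℝ →ₗ⁅ℝ⁆ L, ψ.range = LieSubalgebra.lieSpan ℝ L {e₀, e₁, f₀, f₁} := by
  let φ : FreeLieAlgebra ℝ (Generators (Fin 2)) →ₗ⁅ℝ⁆ L := FreeLieAlgebra.lift ℝ fun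
    | .H i => ![h₀, h₁] i
    | .E i => ![e₀, e₁] i
    | .F i => ![f₀, f₁] i
  have hφ : ∀ x ∈ Relations.toSet ℝ CartanMatrix.G₂, φ x = 0 :=
    (serreG2_iff φ).2 (by simp only [φ, FreeLieAlgebra.lift_of_apply]; exact s)
  have hker : Relations.toIdeal ℝ CartanMatrix.G₂ ≤ φ.ker :=
    LieSubmodule.lieSpan_le.2 fun x hx => LieHom.mem_ker.2 (hφ x hx)
  have hlift : ∀ x y, g₂Mk x = g₂Mk y → φ x = φ y := by
    intro x y hxy
    rw [← sub_eq_zero, ← map_sub, g₂Mk_eq_zero_iff] at hxy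
    rw [← sub_eq_zero, ← map_sub]
    exact LieHom.mem_ker.1 (hker hxy)
  -- The homomorphism descends to the quotient by evaluating on a set-theoretic section; `hlift`
  -- makes the choice of section irrelevant, which gives linearity and compatibility with brackets.
  have hsec := Function.surjInv_eq g₂Mk_surjective
  let ψ : LieAlgebra.g₂ ℝ →ₗ⁅ℝ⁆ L :=
    { toFun := fun x => φ (Function.surjInv g₂Mk_surjective x)
      map_add' := fun x y => by
        rw [← map_add]; exact hlift _ _ (by rw [map_add, hsec, hsec, hsec])
      map_smul' := fun c x => by
        rw [RingHom.id_apply, ← map_smul]; exact hlift _ _ (by rw [map_smul, hsec, hsec])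
      map_lie' := fun {x y} => by
        rw [← LieHom.map_lie]; exact hlift _ _ (by rw [LieHom.map_lie, hsec, hsec, hsec]) }
  have hψ : ∀ x, ψ (g₂Mk x) = φ x := fun x => hlift _ _ (hsec _)
  refine ⟨ψ, ?_⟩
  rw [LieHom.range_eq_map, ← lieSpan_g₂Gen, LieSubalgebra.map_lieSpan]
  congr 1
  simp only [Set.image_insert_eq, Set.image_singleton, g₂Gen, hψ, φ, FreeLieAlgebra.lift_of_apply]
  rfl

end SerreConstruction

/-! ### Frames of type `G₂`: from bracket relations to split `𝔤₂`. -/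

/-- Bracket relations among fourteen elements `S₁, …, S₆, L₁, …, L₆, h, k` of a Lie algebra that
present split `𝔤₂` in terms of the three generators `S₁, S₂, S₃`. -/
structure G2FrameRelations {L : Type*} [LieRing L] [LieAlgebra ℝ L]
    (S₁ S₂ S₃ S₄ S₅ S₆ L₁ L₂ L₃ L₄ L₅ L₆ h k : L) : Prop where
  lie_S₁_S₂ : ⁅S₁, S₂⁆ = S₄
  lie_S₂_S₃ : ⁅S₂, S₃⁆ = S₅
  lie_S₃_S₁ : ⁅S₃, S₁⁆ = S₆
  lie_S₁_S₄ : ⁅S₁, S₄⁆ = L₁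
  lie_S₂_S₄ : ⁅S₂, S₄⁆ = L₂
  lie_S₂_S₅ : ⁅S₂, S₅⁆ = L₃
  lie_S₃_S₅ : ⁅S₃, S₅⁆ = L₄
  lie_S₃_S₆ : ⁅S₃, S₆⁆ = L₅
  lie_S₁_S₆ : ⁅S₁, S₆⁆ = L₆
  lie_S₂_S₆ : ⁅S₂, S₆⁆ = (2 : ℝ) • k - (2 : ℝ) • h
  lie_S₄_S₃ : ⁅S₄, S₃⁆ = (2 : ℝ) • k + (2 : ℝ) • h
  lie_h_S₁ : ⁅h, S₁⁆ = (1 : ℝ) • S₁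
  lie_h_S₂ : ⁅h, S₂⁆ = (-1 / 2 : ℝ) • S₂
  lie_h_S₃ : ⁅h, S₃⁆ = (-1 / 2 : ℝ) • S₃
  lie_k_S₁ : ⁅k, S₁⁆ = (0 : ℝ) • S₁
  lie_k_S₂ : ⁅k, S₂⁆ = (3 / 2 : ℝ) • S₂
  lie_k_S₃ : ⁅k, S₃⁆ = (-3 / 2 : ℝ) • S₃
  lie_S₁_S₅ : ⁅S₁, S₅⁆ = (4 : ℝ) • h
  lie_L₃_L₆ : ⁅L₃, L₆⁆ = (12 : ℝ) • k - (36 : ℝ) • h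
  lie_S₁_L₆ : ⁅S₁, L₆⁆ = 0
  lie_L₃_S₅ : ⁅L₃, S₅⁆ = 0
  lie_S₁_L₃ : ⁅S₁, L₃⁆ = (-6 : ℝ) • S₂
  lie_S₁_L₁ : ⁅S₁, L₁⁆ = 0
  lie_L₃_S₂ : ⁅L₃, S₂⁆ = 0
  lie_S₅_L₆ : ⁅S₅, L₆⁆ = (6 : ℝ) • S₆
  lie_S₅_S₆ : ⁅S₅, S₆⁆ = (-8 : ℝ) • S₃
  lie_S₅_L₄ : ⁅S₅, L₄⁆ = 0
  lie_L₆_S₆ : ⁅L₆, S₆⁆ = 0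

section Weights

variable {L : Type*} [LieRing L] [LieAlgebra ℝ L]

/-- Weights add up under the bracket. -/
theorem lie_eq_smul_of_lie_eq {h x y z : L} {a b : ℝ} (hx : ⁅h, x⁆ = a • x) (hy : ⁅h, y⁆ = b • y)
    (hz : ⁅x, y⁆ = z) : ⁅h, z⁆ = (a + b) • z := by
  rw [← hz, leibniz_lie, hx, hy, smul_lie, lie_smul, add_smul]

/-- Simultaneous eigenvectors with distinct non-zero eigenvalues together with two independent
elements of eigenvalue zero are linearly independent. -/
theorem eq_zero_of_sum_weight_vectors {ι : Type*} [Fintype ι] (t : L) (μ : ι → ℝ)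
    (hμ : Function.Injective μ) (hμ0 : ∀ i, μ i ≠ 0) (v : ι → L) (hv0 : ∀ i, v i ≠ 0)
    (hv : ∀ i, ⁅t, v i⁆ = μ i • v i) {u : L} (hu : ⁅t, u⁆ = 0) (c : ι → ℝ)
    (hsum : u + ∑ i, c i • v i = 0) : u = 0 ∧ ∀ i, c i = 0 := by
  -- A non-zero weightless vector can be adjoined as an eigenvector of eigenvalue 0, distinct from
  -- all `μ i`. If `u` were non-zero, the given relation would then contradict independence, its
  -- coefficient on `u` being 1.
  have hind : ∀ w : L, w ≠ 0 → ⁅t, w⁆ = 0 →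
      LinearIndependent ℝ (fun o : Option ι => o.elim w v) := by
    intro w hw htw
    refine Module.End.eigenvectors_linearIndependent' (LieAlgebra.ad ℝ L t)
      (fun o : Option ι => o.elim 0 μ) ?_ _ ?_
    · rintro (_ | i) (_ | j) hij
      · rfl
      · exact absurd hij.symm (hμ0 j)
      · exact absurd hij (hμ0 i)
      · exact congrArg some (hμ hij)
    · rintro (_ | i)
      · exact ⟨Module.End.mem_eigenspace_iff.2 (by simpa using htw), hw⟩
      · exact ⟨Module.End.mem_eigenspace_iff.2 (by simpa using hv i), hv0 i⟩
  have hu0 : u = 0 := by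
    by_contra hne
    have := Fintype.linearIndependent_iff.1 (hind u hne hu) (fun o => o.elim 1 c)
      (by simpa [Fintype.sum_option] using hsum) none
    simp at this
  refine ⟨hu0, ?_⟩
  have hvi : LinearIndependent ℝ v :=
    Module.End.eigenvectors_linearIndependent' (LieAlgebra.ad ℝ L t) μ hμ _ fun i =>
      ⟨Module.End.mem_eigenspace_iff.2 (by simpa using hv i), hv0 i⟩
  exact Fintype.linearIndependent_iff.1 hvi c (by simpa [hu0] using hsum)

end Weights

namespace G2FrameRelations

variable {L : Type*} [LieRing L] [LieAlgebra ℝ L] {S₁ S₂ S₃ S₄ S₅ S₆ L₁ L₂ L₃ L₄ L₅ L₆ h k : L}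

/-- The relations are equations, so they pass along any homomorphism; this moves them from
polynomial fields to the fields on `U`. -/
theorem map {L' : Type*} [LieRing L'] [LieAlgebra ℝ L']
    (r : G2FrameRelations S₁ S₂ S₃ S₄ S₅ S₆ L₁ L₂ L₃ L₄ L₅ L₆ h k) (φ : L →ₗ⁅ℝ⁆ L') :
    G2FrameRelations (φ S₁) (φ S₂) (φ S₃) (φ S₄) (φ S₅) (φ S₆) (φ L₁) (φ L₂) (φ L₃) (φ L₄) (φ L₅)
      (φ L₆) (φ h) (φ k) := by
  constructor <;> simp only [← LieHom.map_lie, ← map_smul, ← map_add, ← map_sub]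
  · rw [r.lie_S₁_S₂]
  · rw [r.lie_S₂_S₃]
  · rw [r.lie_S₃_S₁]
  · rw [r.lie_S₁_S₄]
  · rw [r.lie_S₂_S₄]
  · rw [r.lie_S₂_S₅]
  · rw [r.lie_S₃_S₅]
  · rw [r.lie_S₃_S₆]
  · rw [r.lie_S₁_S₆]
  · rw [r.lie_S₂_S₆]
  · rw [r.lie_S₄_S₃]
  · rw [r.lie_h_S₁]
  · rw [r.lie_h_S₂]
  · rw [r.lie_h_S₃]
  · rw [r.lie_k_S₁]
  · rw [r.lie_k_S₂]
  · rw [r.lie_k_S₃]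
  · rw [r.lie_S₁_S₅]
  · rw [r.lie_L₃_L₆]
  · rw [r.lie_S₁_L₆, map_zero]
  · rw [r.lie_L₃_S₅, map_zero]
  · rw [r.lie_S₁_L₃]
  · rw [r.lie_S₁_L₁, map_zero]
  · rw [r.lie_L₃_S₂, map_zero]
  · rw [r.lie_S₅_L₆]
  · rw [r.lie_S₅_S₆]
  · rw [r.lie_S₅_L₄, map_zero]
  · rw [r.lie_L₆_S₆, map_zero]

/-- The element `k` is $\sqrt3\,h^2$, a normalisation that keeps $\sqrt3$ out of the bracket
relations. -/
theorem g2Frame_eq (r : G2FrameRelations S₁ S₂ S₃ S₄ S₅ S₆ L₁ L₂ L₃ L₄ L₅ L₆ h k) :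
    g2Frame S₁ S₂ S₃ =
      ![S₁, S₂, S₃, S₄, S₅, S₆, h, (√3 / 3 : ℝ) • k, L₁, L₂, L₃, L₄, L₅, L₆] := by
  simp only [g2Frame, r.lie_S₁_S₂, r.lie_S₂_S₃, r.lie_S₃_S₁, r.lie_S₁_S₄, r.lie_S₂_S₄, r.lie_S₂_S₅,
    r.lie_S₃_S₅, r.lie_S₃_S₆, r.lie_S₁_S₆, r.lie_S₂_S₆, r.lie_S₄_S₃]
  congr 7
  · module
  · congr 1
    module

theorem lie_h_S₄ (r : G2FrameRelations S₁ S₂ S₃ S₄ S₅ S₆ L₁ L₂ L₃ L₄ L₅ L₆ h k) :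
    ⁅h, S₄⁆ = (1 / 2 : ℝ) • S₄ := by
  rw [lie_eq_smul_of_lie_eq r.lie_h_S₁ r.lie_h_S₂ r.lie_S₁_S₂]; norm_num

theorem lie_h_S₅ (r : G2FrameRelations S₁ S₂ S₃ S₄ S₅ S₆ L₁ L₂ L₃ L₄ L₅ L₆ h k) :
    ⁅h, S₅⁆ = (-1 : ℝ) • S₅ := by
  rw [lie_eq_smul_of_lie_eq r.lie_h_S₂ r.lie_h_S₃ r.lie_S₂_S₃]; norm_num

theorem lie_h_S₆ (r : G2FrameRelations S₁ S₂ S₃ S₄ S₅ S₆ L₁ L₂ L₃ L₄ L₅ L₆ h k) :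
    ⁅h, S₆⁆ = (1 / 2 : ℝ) • S₆ := by
  rw [lie_eq_smul_of_lie_eq r.lie_h_S₃ r.lie_h_S₁ r.lie_S₃_S₁]; norm_num

theorem lie_h_L₁ (r : G2FrameRelations S₁ S₂ S₃ S₄ S₅ S₆ L₁ L₂ L₃ L₄ L₅ L₆ h k) :
    ⁅h, L₁⁆ = (3 / 2 : ℝ) • L₁ := by
  rw [lie_eq_smul_of_lie_eq r.lie_h_S₁ r.lie_h_S₄ r.lie_S₁_S₄]; norm_num

theorem lie_h_L₂ (r : G2FrameRelations S₁ S₂ S₃ S₄ S₅ S₆ L₁ L₂ L₃ L₄ L₅ L₆ h k) :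
    ⁅h, L₂⁆ = (0 : ℝ) • L₂ := by
  rw [lie_eq_smul_of_lie_eq r.lie_h_S₂ r.lie_h_S₄ r.lie_S₂_S₄]; norm_num

theorem lie_h_L₃ (r : G2FrameRelations S₁ S₂ S₃ S₄ S₅ S₆ L₁ L₂ L₃ L₄ L₅ L₆ h k) :
    ⁅h, L₃⁆ = (-3 / 2 : ℝ) • L₃ := by
  rw [lie_eq_smul_of_lie_eq r.lie_h_S₂ r.lie_h_S₅ r.lie_S₂_S₅]; norm_num

theorem lie_h_L₄ (r : G2FrameRelations S₁ S₂ S₃ S₄ S₅ S₆ L₁ L₂ L₃ L₄ L₅ L₆ h k) :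
    ⁅h, L₄⁆ = (-3 / 2 : ℝ) • L₄ := by
  rw [lie_eq_smul_of_lie_eq r.lie_h_S₃ r.lie_h_S₅ r.lie_S₃_S₅]; norm_num

theorem lie_h_L₅ (r : G2FrameRelations S₁ S₂ S₃ S₄ S₅ S₆ L₁ L₂ L₃ L₄ L₅ L₆ h k) :
    ⁅h, L₅⁆ = (0 : ℝ) • L₅ := by
  rw [lie_eq_smul_of_lie_eq r.lie_h_S₃ r.lie_h_S₆ r.lie_S₃_S₆]; norm_num

theorem lie_h_L₆ (r : G2FrameRelations S₁ S₂ S₃ S₄ S₅ S₆ L₁ L₂ L₃ L₄ L₅ L₆ h k) :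
    ⁅h, L₆⁆ = (3 / 2 : ℝ) • L₆ := by
  rw [lie_eq_smul_of_lie_eq r.lie_h_S₁ r.lie_h_S₆ r.lie_S₁_S₆]; norm_num

theorem lie_k_S₄ (r : G2FrameRelations S₁ S₂ S₃ S₄ S₅ S₆ L₁ L₂ L₃ L₄ L₅ L₆ h k) :
    ⁅k, S₄⁆ = (3 / 2 : ℝ) • S₄ := by
  rw [lie_eq_smul_of_lie_eq r.lie_k_S₁ r.lie_k_S₂ r.lie_S₁_S₂]; norm_num

theorem lie_k_S₅ (r : G2FrameRelations S₁ S₂ S₃ S₄ S₅ S₆ L₁ L₂ L₃ L₄ L₅ L₆ h k) :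
    ⁅k, S₅⁆ = (0 : ℝ) • S₅ := by
  rw [lie_eq_smul_of_lie_eq r.lie_k_S₂ r.lie_k_S₃ r.lie_S₂_S₃]; norm_num

theorem lie_k_S₆ (r : G2FrameRelations S₁ S₂ S₃ S₄ S₅ S₆ L₁ L₂ L₃ L₄ L₅ L₆ h k) :
    ⁅k, S₆⁆ = (-3 / 2 : ℝ) • S₆ := by
  rw [lie_eq_smul_of_lie_eq r.lie_k_S₃ r.lie_k_S₁ r.lie_S₃_S₁]; norm_num

theorem lie_k_L₁ (r : G2FrameRelations S₁ S₂ S₃ S₄ S₅ S₆ L₁ L₂ L₃ L₄ L₅ L₆ h k) :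
    ⁅k, L₁⁆ = (3 / 2 : ℝ) • L₁ := by
  rw [lie_eq_smul_of_lie_eq r.lie_k_S₁ r.lie_k_S₄ r.lie_S₁_S₄]; norm_num

theorem lie_k_L₂ (r : G2FrameRelations S₁ S₂ S₃ S₄ S₅ S₆ L₁ L₂ L₃ L₄ L₅ L₆ h k) :
    ⁅k, L₂⁆ = (3 : ℝ) • L₂ := by
  rw [lie_eq_smul_of_lie_eq r.lie_k_S₂ r.lie_k_S₄ r.lie_S₂_S₄]; norm_num

theorem lie_k_L₃ (r : G2FrameRelations S₁ S₂ S₃ S₄ S₅ S₆ L₁ L₂ L₃ L₄ L₅ L₆ h k) :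
    ⁅k, L₃⁆ = (3 / 2 : ℝ) • L₃ := by
  rw [lie_eq_smul_of_lie_eq r.lie_k_S₂ r.lie_k_S₅ r.lie_S₂_S₅]; norm_num

theorem lie_k_L₄ (r : G2FrameRelations S₁ S₂ S₃ S₄ S₅ S₆ L₁ L₂ L₃ L₄ L₅ L₆ h k) :
    ⁅k, L₄⁆ = (-3 / 2 : ℝ) • L₄ := by
  rw [lie_eq_smul_of_lie_eq r.lie_k_S₃ r.lie_k_S₅ r.lie_S₃_S₅]; norm_num

theorem lie_k_L₅ (r : G2FrameRelations S₁ S₂ S₃ S₄ S₅ S₆ L₁ L₂ L₃ L₄ L₅ L₆ h k) :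
    ⁅k, L₅⁆ = (-3 : ℝ) • L₅ := by
  rw [lie_eq_smul_of_lie_eq r.lie_k_S₃ r.lie_k_S₆ r.lie_S₃_S₆]; norm_num

theorem lie_k_L₆ (r : G2FrameRelations S₁ S₂ S₃ S₄ S₅ S₆ L₁ L₂ L₃ L₄ L₅ L₆ h k) :
    ⁅k, L₆⁆ = (-3 / 2 : ℝ) • L₆ := by
  rw [lie_eq_smul_of_lie_eq r.lie_k_S₁ r.lie_k_S₆ r.lie_S₁_S₆]; norm_num

theorem lie_h_k (r : G2FrameRelations S₁ S₂ S₃ S₄ S₅ S₆ L₁ L₂ L₃ L₄ L₅ L₆ h k) : ⁅h, k⁆ = 0 := by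
  -- The bracket of `S₂` and `S₆`, of opposite `h`-weights, has weight zero, and it equals `2k -
  -- 2h`.
  have h1 := lie_eq_smul_of_lie_eq r.lie_h_S₂ r.lie_h_S₆ r.lie_S₂_S₆
  have h2 : ⁅h, k⁆ = (1 / 2 : ℝ) • ⁅h, (2 : ℝ) • k - (2 : ℝ) • h⁆ := by
    rw [lie_sub, lie_smul, lie_smul, lie_self]; module
  rw [h2, h1]; norm_num

/-- The Serre generators inside a `G₂`-frame. -/
theorem serreG2 (r : G2FrameRelations S₁ S₂ S₃ S₄ S₅ S₆ L₁ L₂ L₃ L₄ L₅ L₆ h k) :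
    SerreG2 S₁ L₃ ((1 / 2 : ℝ) • S₅) ((1 / 36 : ℝ) • L₆) ((2 : ℝ) • h)
      ((1 / 3 : ℝ) • k - h) where
  -- The simple roots are those of `S₁` (short) and `L₃` (long), at an angle of 150°, with negatives
  -- at `S₅` and `L₆`. The factors 1/2 and 1/36 make each coroot act by 2 on its own root vector.
  hh := by rw [smul_lie, lie_sub, lie_smul, r.lie_h_k, lie_self]; simp
  ef00 := by rw [lie_smul, r.lie_S₁_S₅]; module
  ef01 := by rw [lie_smul, r.lie_S₁_L₆, smul_zero]
  ef10 := by rw [lie_smul, r.lie_L₃_S₅, smul_zero]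
  ef11 := by rw [lie_smul, r.lie_L₃_L₆]; module
  he00 := by rw [smul_lie, r.lie_h_S₁]; module
  he01 := by rw [smul_lie, r.lie_h_L₃]; module
  he10 := by rw [sub_lie, smul_lie, r.lie_h_S₁, r.lie_k_S₁]; module
  he11 := by rw [sub_lie, smul_lie, r.lie_h_L₃, r.lie_k_L₃]; module
  hf00 := by rw [smul_lie, lie_smul, r.lie_h_S₅]; module
  hf01 := by rw [smul_lie, lie_smul, r.lie_h_L₆]; module
  hf10 := by rw [lie_smul, sub_lie, smul_lie, r.lie_h_S₅, r.lie_k_S₅]; module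
  hf11 := by rw [lie_smul, sub_lie, smul_lie, r.lie_h_L₆, r.lie_k_L₆]; module
  -- The root string under `S₁` is `L₃ → S₂ → S₄ → L₁ → 0`, up to scalars.
  ee0 := by
    rw [r.lie_S₁_L₃]
    simp only [lie_smul, r.lie_S₁_S₂, r.lie_S₁_S₄, r.lie_S₁_L₁, smul_zero]
  ee1 := by
    rw [← lie_skew L₃ S₁, r.lie_S₁_L₃]
    simp only [lie_neg, lie_smul, r.lie_L₃_S₂, smul_zero, neg_zero]
  -- The opposite string, under `S₅`, is `L₆ → S₆ → S₃ → L₄ → 0`.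
  ff0 := by
    simp only [smul_lie, lie_smul, r.lie_S₅_L₆, r.lie_S₅_S₆]
    rw [← lie_skew S₅ S₃, r.lie_S₃_S₅, lie_neg, r.lie_S₅_L₄]
    simp
  ff1 := by
    simp only [smul_lie, lie_smul]
    rw [← lie_skew L₆ S₅, r.lie_S₅_L₆]
    simp only [lie_neg, lie_smul, r.lie_L₆_S₆, smul_zero, neg_zero]

/-- This relation and the three after it follow by the Jacobi identity. Each recovers a short root
vector from a long one, which shows that the long one is non-zero. -/
theorem lie_S₁_L₄ (r : G2FrameRelations S₁ S₂ S₃ S₄ S₅ S₆ L₁ L₂ L₃ L₄ L₅ L₆ h k) :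
    ⁅S₁, L₄⁆ = (-6 : ℝ) • S₃ := by
  rw [← r.lie_S₃_S₅, leibniz_lie, r.lie_S₁_S₅, ← lie_skew S₁ S₃, r.lie_S₃_S₁, neg_lie,
    lie_skew, r.lie_S₅_S₆, lie_smul, ← lie_skew S₃ h, r.lie_h_S₃]
  module

theorem lie_S₂_L₅ (r : G2FrameRelations S₁ S₂ S₃ S₄ S₅ S₆ L₁ L₂ L₃ L₄ L₅ L₆ h k) :
    ⁅S₂, L₅⁆ = (-6 : ℝ) • S₃ := by
  rw [← r.lie_S₃_S₆, leibniz_lie, r.lie_S₂_S₃, r.lie_S₅_S₆, r.lie_S₂_S₆, lie_sub, lie_smul,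
    lie_smul, ← lie_skew S₃ h, r.lie_h_S₃, ← lie_skew S₃ k, r.lie_k_S₃]
  module

theorem lie_S₃_L₁ (r : G2FrameRelations S₁ S₂ S₃ S₄ S₅ S₆ L₁ L₂ L₃ L₄ L₅ L₆ h k) :
    ⁅S₃, L₁⁆ = (-6 : ℝ) • S₁ := by
  -- Writing `S₂` as a multiple of `⁅S₁, L₃⁆` reduces this to the known Cartan bracket `⁅L₃, L₆⁆`.
  -- Expanding `⁅S₂, L₆⁆` through `L₆ = ⁅S₁, S₆⁆` instead then determines `⁅S₄, S₆⁆`.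
  have h1 : ⁅S₂, L₆⁆ = (-6 : ℝ) • S₁ := by
    have : S₂ = (-1 / 6 : ℝ) • ⁅S₁, L₃⁆ := by rw [r.lie_S₁_L₃]; module
    rw [this, smul_lie, lie_lie, r.lie_L₃_L₆, r.lie_S₁_L₆, lie_sub, lie_smul, lie_smul,
      ← lie_skew S₁ h, r.lie_h_S₁, ← lie_skew S₁ k, r.lie_k_S₁, lie_zero]
    module
  have h2 : ⁅S₄, S₆⁆ = (8 : ℝ) • S₁ := by
    have h3 : ⁅S₂, L₆⁆ = -⁅S₄, S₆⁆ + (2 : ℝ) • S₁ := by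
      rw [← r.lie_S₁_S₆, leibniz_lie, ← lie_skew S₂ S₁, r.lie_S₁_S₂, neg_lie, r.lie_S₂_S₆, lie_sub,
        lie_smul, lie_smul, ← lie_skew S₁ h, r.lie_h_S₁, ← lie_skew S₁ k, r.lie_k_S₁]
      module
    rw [h1] at h3
    calc ⁅S₄, S₆⁆ = (2 : ℝ) • S₁ - (-⁅S₄, S₆⁆ + (2 : ℝ) • S₁) := by module
      _ = (8 : ℝ) • S₁ := by rw [← h3]; module
  rw [← r.lie_S₁_S₄, leibniz_lie, r.lie_S₃_S₁, ← lie_skew S₆ S₄, h2, ← lie_skew S₃ S₄, r.lie_S₄_S₃,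
    lie_neg, lie_add, lie_smul, lie_smul, ← lie_skew S₁ h, r.lie_h_S₁, ← lie_skew S₁ k, r.lie_k_S₁]
  module

theorem lie_S₃_L₂ (r : G2FrameRelations S₁ S₂ S₃ S₄ S₅ S₆ L₁ L₂ L₃ L₄ L₅ L₆ h k) :
    ⁅S₃, L₂⁆ = (-6 : ℝ) • S₂ := by
  have h1 : ⁅S₁, L₃⁆ = ⁅S₄, S₅⁆ + (2 : ℝ) • S₂ := by
    rw [← r.lie_S₂_S₅, leibniz_lie, r.lie_S₁_S₂, r.lie_S₁_S₅, lie_smul, ← lie_skew S₂ h,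
      r.lie_h_S₂]
    module
  rw [r.lie_S₁_L₃] at h1
  have h2 : ⁅S₄, S₅⁆ = (-8 : ℝ) • S₂ := by
    calc ⁅S₄, S₅⁆ = (⁅S₄, S₅⁆ + (2 : ℝ) • S₂) - (2 : ℝ) • S₂ := by module
      _ = (-8 : ℝ) • S₂ := by rw [← h1]; module
  rw [← r.lie_S₂_S₄, leibniz_lie, ← lie_skew S₃ S₂, r.lie_S₂_S₃, neg_lie, lie_skew, h2,
    ← lie_skew S₃ S₄, r.lie_S₄_S₃, lie_neg, lie_add, lie_smul, lie_smul, ← lie_skew S₂ h,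
    r.lie_h_S₂, ← lie_skew S₂ k, r.lie_k_S₂]
  module

/-- Acting on `S₁` isolates `a`, since `k` kills `S₁`; acting on `S₂` then isolates `b`. -/
theorem h_k_independent (r : G2FrameRelations S₁ S₂ S₃ S₄ S₅ S₆ L₁ L₂ L₃ L₄ L₅ L₆ h k)
    (hS₁ : S₁ ≠ 0) (hS₂ : S₂ ≠ 0) {a b : ℝ} (hab : a • h + b • k = 0) : a = 0 ∧ b = 0 := by
  have h1 : ⁅a • h + b • k, S₁⁆ = a • S₁ := by
    rw [add_lie, smul_lie, smul_lie, r.lie_h_S₁, r.lie_k_S₁]; module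
  rw [hab, zero_lie, eq_comm, smul_eq_zero] at h1
  have ha := h1.resolve_right hS₁
  have h2 : ⁅a • h + b • k, S₂⁆ = (b * (3 / 2)) • S₂ := by
    rw [add_lie, smul_lie, smul_lie, r.lie_h_S₂, r.lie_k_S₂, ha]; module
  rw [hab, zero_lie, eq_comm, smul_eq_zero] at h2
  have hb := h2.resolve_right hS₂
  exact ⟨ha, by linarith⟩

/-- Non-vanishing spreads from `S₁` and `S₂`: each remaining vector has a bracket that is a non-zero
multiple, or combination, of elements already known not to vanish. -/
theorem root_vectors_ne_zero (r : G2FrameRelations S₁ S₂ S₃ S₄ S₅ S₆ L₁ L₂ L₃ L₄ L₅ L₆ h k)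
    (hS₁ : S₁ ≠ 0) (hS₂ : S₂ ≠ 0) (i : Fin 12) :
    (![S₁, S₂, S₃, S₄, S₅, S₆, L₁, L₂, L₃, L₄, L₅, L₆] : Fin 12 → L) i ≠ 0 := by
  have hh : h ≠ 0 := by
    intro h0
    have := (r.h_k_independent hS₁ hS₂ (a := 1) (b := 0) (by simp [h0])).1
    norm_num at this
  have hS₅ : S₅ ≠ 0 := by
    intro h0
    have := r.lie_S₁_S₅
    rw [h0, lie_zero, eq_comm, smul_eq_zero] at this
    exact hh (this.resolve_left (by norm_num))
  have hS₃ : S₃ ≠ 0 := by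
    rintro h0; exact hS₅ (by rw [← r.lie_S₂_S₃, h0, lie_zero])
  have hS₆ : S₆ ≠ 0 := by
    intro h0
    have := r.lie_S₅_S₆
    rw [h0, lie_zero, eq_comm, smul_eq_zero] at this
    exact hS₃ (this.resolve_left (by norm_num))
  have hS₄ : S₄ ≠ 0 := by
    intro h0
    have := r.lie_S₄_S₃
    rw [h0, zero_lie, eq_comm, add_comm] at this
    have := (r.h_k_independent hS₁ hS₂ this).1
    norm_num at this
  have hL₃ : L₃ ≠ 0 := by
    intro h0
    have := r.lie_S₁_L₃
    rw [h0, lie_zero, eq_comm, smul_eq_zero] at this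
    exact hS₂ (this.resolve_left (by norm_num))
  have hL₆ : L₆ ≠ 0 := by
    intro h0
    have := r.lie_S₅_L₆
    rw [h0, lie_zero, eq_comm, smul_eq_zero] at this
    exact hS₆ (this.resolve_left (by norm_num))
  have hL₄ : L₄ ≠ 0 := by
    intro h0
    have := r.lie_S₁_L₄
    rw [h0, lie_zero, eq_comm, smul_eq_zero] at this
    exact hS₃ (this.resolve_left (by norm_num))
  have hL₅ : L₅ ≠ 0 := by
    intro h0
    have := r.lie_S₂_L₅
    rw [h0, lie_zero, eq_comm, smul_eq_zero] at this
    exact hS₃ (this.resolve_left (by norm_num))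
  have hL₁ : L₁ ≠ 0 := by
    intro h0
    have := r.lie_S₃_L₁
    rw [h0, lie_zero, eq_comm, smul_eq_zero] at this
    exact hS₁ (this.resolve_left (by norm_num))
  have hL₂ : L₂ ≠ 0 := by
    intro h0
    have := r.lie_S₃_L₂
    rw [h0, lie_zero, eq_comm, smul_eq_zero] at this
    exact hS₂ (this.resolve_left (by norm_num))
  fin_cases i
  exacts [hS₁, hS₂, hS₃, hS₄, hS₅, hS₆, hL₁, hL₂, hL₃, hL₄, hL₅, hL₆]

/-- The indices of the root vectors of a `G₂`-frame among its fourteen members. -/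
def rootIndex : Fin 12 → Fin 14 := ![0, 1, 2, 3, 4, 5, 8, 9, 10, 11, 12, 13]

theorem sum_rootIndex {M : Type*} [AddCommMonoid M] (f : Fin 14 → M) :
    ∑ i, f i = (f 6 + f 7) + ∑ i, f (rootIndex i) := by
  simp only [Fin.sum_univ_succ, rootIndex, Fin.sum_univ_zero]
  simp
  abel

theorem linearIndependent (r : G2FrameRelations S₁ S₂ S₃ S₄ S₅ S₆ L₁ L₂ L₃ L₄ L₅ L₆ h k)
    (hS₁ : S₁ ≠ 0) (hS₂ : S₂ ≠ 0) :
    LinearIndependent ℝ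
      (![S₁, S₂, S₃, S₄, S₅, S₆, h, (√3 / 3 : ℝ) • k, L₁, L₂, L₃, L₄, L₅, L₆] : Fin 14 → L) := by
  rw [Fintype.linearIndependent_iff]
  intro c hc
  rw [sum_rootIndex] at hc
  -- These are the eigenvalues of `6h + (14/3)k` on the twelve root vectors. The coefficients are
  -- chosen so that all are non-zero and pairwise distinct integers, and injectivity can be decided
  -- over `ℤ`.
  have hμ : Function.Injective
      (![6, 4, -10, 10, -6, -4, 16, 14, -2, -16, -14, 2] : Fin 12 → ℝ) := by
    have hZ : Function.Injective
        (![6, 4, -10, 10, -6, -4, 16, 14, -2, -16, -14, 2] : Fin 12 → ℤ) := by decide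
    have hcast : (![6, 4, -10, 10, -6, -4, 16, 14, -2, -16, -14, 2] : Fin 12 → ℝ) =
        Int.cast ∘ (![6, 4, -10, 10, -6, -4, 16, 14, -2, -16, -14, 2] : Fin 12 → ℤ) := by
      ext i; fin_cases i <;> simp
    exact hcast ▸ Int.cast_injective.comp hZ
  have key := eq_zero_of_sum_weight_vectors ((6 : ℝ) • h + (14 / 3 : ℝ) • k)
    (![6, 4, -10, 10, -6, -4, 16, 14, -2, -16, -14, 2] : Fin 12 → ℝ) hμ
    (by intro i; fin_cases i <;> norm_num)
    (![S₁, S₂, S₃, S₄, S₅, S₆, L₁, L₂, L₃, L₄, L₅, L₆] : Fin 12 → L)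
    (r.root_vectors_ne_zero hS₁ hS₂) (by
      intro i
      fin_cases i <;> simp <;>
        simp only [r.lie_h_S₁, r.lie_h_S₂, r.lie_h_S₃, r.lie_h_S₄, r.lie_h_S₅, r.lie_h_S₆,
          r.lie_h_L₁, r.lie_h_L₂, r.lie_h_L₃, r.lie_h_L₄, r.lie_h_L₅, r.lie_h_L₆,
          r.lie_k_S₁, r.lie_k_S₂, r.lie_k_S₃, r.lie_k_S₄, r.lie_k_S₅, r.lie_k_S₆,
          r.lie_k_L₁, r.lie_k_L₂, r.lie_k_L₃, r.lie_k_L₄, r.lie_k_L₅, r.lie_k_L₆] <;> module)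
    (u := c 6 • h + c 7 • (√3 / 3 : ℝ) • k) (by
      have : ⁅k, h⁆ = 0 := by rw [← lie_skew, r.lie_h_k, neg_zero]
      simp [r.lie_h_k, this]) (fun i => c (rootIndex i)) (by
      rw [← hc]
      congr 1)
  obtain ⟨hu, hroot⟩ := key
  rw [smul_smul] at hu
  obtain ⟨h6, h7⟩ := r.h_k_independent hS₁ hS₂ hu
  have h7 : c 7 = 0 := by
    have : (√3 / 3 : ℝ) ≠ 0 := by positivity
    exact (mul_eq_zero.1 h7).resolve_right this
  intro i
  fin_cases i
  exacts [hroot 0, hroot 1, hroot 2, hroot 3, hroot 4, hroot 5, h6, h7, hroot 6, hroot 7, hroot 8,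
    hroot 9, hroot 10, hroot 11]

theorem weights (r : G2FrameRelations S₁ S₂ S₃ S₄ S₅ S₆ L₁ L₂ L₃ L₄ L₅ L₆ h k) (i : Fin 14) :
    let b : Fin 14 → L := ![S₁, S₂, S₃, S₄, S₅, S₆, h, (√3 / 3 : ℝ) • k, L₁, L₂, L₃, L₄, L₅, L₆]
    ⁅b 6, b i⁆ = (g2Diagram i).1 • b i ∧ ⁅b 7, b i⁆ = (g2Diagram i).2 • b i := by
  intro b
  have hkh : ⁅k, h⁆ = 0 := by rw [← lie_skew, r.lie_h_k, neg_zero]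
  have e6 : b 6 = h := rfl
  have e7 : b 7 = (√3 / 3 : ℝ) • k := rfl
  rw [e6, e7]
  fin_cases i <;> simp [b, g2Diagram, r.lie_h_k, hkh] <;>
    simp only [r.lie_h_S₁, r.lie_h_S₂, r.lie_h_S₃, r.lie_h_S₄, r.lie_h_S₅, r.lie_h_S₆,
      r.lie_h_L₁, r.lie_h_L₂, r.lie_h_L₃, r.lie_h_L₄, r.lie_h_L₅, r.lie_h_L₆,
      r.lie_k_S₁, r.lie_k_S₂, r.lie_k_S₃, r.lie_k_S₄, r.lie_k_S₅, r.lie_k_S₆,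
      r.lie_k_L₁, r.lie_k_L₂, r.lie_k_L₃, r.lie_k_L₄, r.lie_k_L₅, r.lie_k_L₆, smul_smul]
  all_goals constructor <;> first | trivial | module

/-- The two weightless members of a basis of simultaneous eigenvectors, whose eigenvalues are given
by the root diagram, span a Cartan subalgebra. -/
theorem exists_cartan (𝔤 : LieSubalgebra ℝ L) (b : Fin 14 → L) (hli : LinearIndependent ℝ b)
    (hspan : 𝔤.toSubmodule = Submodule.span ℝ (Set.range b))
    (hw : ∀ i, ⁅b 6, b i⁆ = (g2Diagram i).1 • b i ∧ ⁅b 7, b i⁆ = (g2Diagram i).2 • b i) :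
    ∃ 𝔥 : LieSubalgebra ℝ 𝔤, 𝔥.IsCartanSubalgebra ∧
      𝔥.toSubmodule.map 𝔤.toSubmodule.subtype = Submodule.span ℝ {b 6, b 7} := by
  have h67 : ⁅b 6, b 7⁆ = 0 := by simpa [g2Diagram] using (hw 7).1
  have h76 : ⁅b 7, b 6⁆ = 0 := by rw [← lie_skew, h67, neg_zero]
  have hb𝔤 : ∀ i, b i ∈ 𝔤 := fun i =>
    (hspan ▸ Submodule.subset_span ⟨i, rfl⟩ : b i ∈ 𝔤.toSubmodule)
  have habel : ∀ x ∈ Submodule.span ℝ {b 6, b 7}, ∀ y ∈ Submodule.span ℝ {b 6, b 7},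
      ⁅x, y⁆ = 0 := by
    intro x hx y hy
    obtain ⟨a, c, rfl⟩ := Submodule.mem_span_pair.1 hx
    obtain ⟨a', c', rfl⟩ := Submodule.mem_span_pair.1 hy
    simp [h67, h76]
  let 𝔥 : LieSubalgebra ℝ 𝔤 :=
    { (Submodule.span ℝ {b 6, b 7}).comap 𝔤.toSubmodule.subtype with
      lie_mem' := fun {x y} hx hy => by
        change ⁅(x : L), (y : L)⁆ ∈ Submodule.span ℝ {b 6, b 7}
        rw [habel (x : L) hx (y : L) hy]
        exact Submodule.zero_mem _ }
  have hmem : ∀ x : 𝔤, x ∈ 𝔥 ↔ (x : L) ∈ Submodule.span ℝ {b 6, b 7} := fun x => Iff.rfl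
  refine ⟨𝔥, ⟨?_, ?_⟩, ?_⟩
  · have : IsLieAbelian 𝔥 := ⟨fun x y => Subtype.ext (Subtype.ext (habel _ x.2 _ y.2))⟩
    infer_instance
  · refine le_antisymm (fun x hx => ?_) (LieSubalgebra.le_normalizer 𝔥)
    rw [LieSubalgebra.mem_normalizer_iff'] at hx
    have hx𝔤 : (x : L) ∈ Submodule.span ℝ (Set.range b) := hspan ▸ x.2
    obtain ⟨c, hc⟩ := (Submodule.mem_span_range_iff_exists_fun ℝ).1 hx𝔤
    -- If `x` normalises the span of the weightless vectors, its bracket with either of them has no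
    -- component along a root vector. By independence each coefficient of `x`, multiplied by the
    -- corresponding root value, vanishes.
    have hvan : ∀ (j : Fin 14) (d : Fin 14 → ℝ), (∀ i, ⁅b j, b i⁆ = d i • b i) →
        ⁅b j, (x : L)⁆ ∈ Submodule.span ℝ {b 6, b 7} → ∀ i, i ≠ 6 → i ≠ 7 → c i * d i = 0 := by
      intro j d hd hj i hi6 hi7
      obtain ⟨u, v, huv⟩ := Submodule.mem_span_pair.1 hj
      rw [← hc, lie_sum] at huv
      simp only [lie_smul, hd, smul_smul] at huv
      have h0 : ∑ i, (c i * d i - (if i = 6 then u else 0) - (if i = 7 then v else 0)) • b i = 0 := by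
        simp only [sub_smul, Finset.sum_sub_distrib, ite_smul, zero_smul, Finset.sum_ite_eq',
          Finset.mem_univ, if_true, ← huv]
        abel
      simpa [hi6, hi7] using Fintype.linearIndependent_iff.1 hli _ h0 i
    have h6 := hvan 6 _ (fun i => (hw i).1)
      (hx ⟨b 6, hb𝔤 6⟩ ((hmem _).2 (Submodule.subset_span (by simp))))
    have h7 := hvan 7 _ (fun i => (hw i).2)
      (hx ⟨b 7, hb𝔤 7⟩ ((hmem _).2 (Submodule.subset_span (by simp))))
    have hc0 : ∀ i, i ≠ 6 → i ≠ 7 → c i = 0 := by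
      intro i hi6 hi7
      -- A non-zero coefficient would force both coordinates of its root to vanish, but every root
      -- is non-zero.
      by_contra hne
      have g6 := (mul_eq_zero.1 (h6 i hi6 hi7)).resolve_left hne
      have g7 := (mul_eq_zero.1 (h7 i hi6 hi7)).resolve_left hne
      have h3 : √3 ≠ 0 := by positivity
      fin_cases i <;> simp [g2Diagram] at g6 g7 hi6 hi7
    rw [hmem, ← hc]
    refine Submodule.sum_mem _ fun i _ => ?_
    by_cases hi6 : i = 6
    · exact Submodule.smul_mem _ _ (Submodule.subset_span (by simp [hi6]))
    by_cases hi7 : i = 7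
    · exact Submodule.smul_mem _ _ (Submodule.subset_span (by simp [hi7]))
    rw [hc0 i hi6 hi7, zero_smul]
    exact Submodule.zero_mem _
  · change ((Submodule.span ℝ {b 6, b 7}).comap 𝔤.toSubmodule.subtype).map _ = _
    rw [Submodule.map_comap_subtype, inf_eq_right, hspan]
    exact Submodule.span_mono (by rintro _ (rfl | rfl) <;> simp)

/-- A Lie algebra containing `S₁, S₂, S₃` as in `G2FrameRelations` contains a copy of split `𝔤₂`
which they pairwise bracket-generate. -/
theorem pairwiseBracketGenerateSplitG2
    (r : G2FrameRelations S₁ S₂ S₃ S₄ S₅ S₆ L₁ L₂ L₃ L₄ L₅ L₆ h k)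
    (hS₁ : S₁ ≠ 0) (hS₂ : S₂ ≠ 0) : PairwiseBracketGenerateSplitG2 S₁ S₂ S₃ := by
  obtain ⟨ψ, hψ⟩ := r.serreG2.exists_hom
  have hli := r.linearIndependent hS₁ hS₂
  set b : Fin 14 → L :=
    ![S₁, S₂, S₃, S₄, S₅, S₆, h, (√3 / 3 : ℝ) • k, L₁, L₂, L₃, L₄, L₅, L₆] with hb
  set 𝔤 : LieSubalgebra ℝ L := LieSubalgebra.lieSpan ℝ L {S₁, S₂, S₃} with h𝔤
  have m₁ : S₁ ∈ 𝔤 := LieSubalgebra.subset_lieSpan (by simp)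
  have m₂ : S₂ ∈ 𝔤 := LieSubalgebra.subset_lieSpan (by simp)
  have m₃ : S₃ ∈ 𝔤 := LieSubalgebra.subset_lieSpan (by simp)
  have m₄ : S₄ ∈ 𝔤 := r.lie_S₁_S₂ ▸ 𝔤.lie_mem m₁ m₂
  have m₅ : S₅ ∈ 𝔤 := r.lie_S₂_S₃ ▸ 𝔤.lie_mem m₂ m₃
  have m₆ : S₆ ∈ 𝔤 := r.lie_S₃_S₁ ▸ 𝔤.lie_mem m₃ m₁
  have mh : h ∈ 𝔤 := by
    have : h = (1 / 4 : ℝ) • ⁅S₁, S₅⁆ := by rw [r.lie_S₁_S₅]; module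
    exact this ▸ 𝔤.smul_mem _ (𝔤.lie_mem m₁ m₅)
  have mk : k ∈ 𝔤 := by
    have : k = (1 / 2 : ℝ) • (⁅S₂, S₆⁆ + (2 : ℝ) • h) := by rw [r.lie_S₂_S₆]; module
    exact this ▸ 𝔤.smul_mem _ (𝔤.add_mem (𝔤.lie_mem m₂ m₆) (𝔤.smul_mem _ mh))
  have n₁ : L₁ ∈ 𝔤 := r.lie_S₁_S₄ ▸ 𝔤.lie_mem m₁ m₄
  have n₂ : L₂ ∈ 𝔤 := r.lie_S₂_S₄ ▸ 𝔤.lie_mem m₂ m₄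
  have n₃ : L₃ ∈ 𝔤 := r.lie_S₂_S₅ ▸ 𝔤.lie_mem m₂ m₅
  have n₄ : L₄ ∈ 𝔤 := r.lie_S₃_S₅ ▸ 𝔤.lie_mem m₃ m₅
  have n₅ : L₅ ∈ 𝔤 := r.lie_S₃_S₆ ▸ 𝔤.lie_mem m₃ m₆
  have n₆ : L₆ ∈ 𝔤 := r.lie_S₁_S₆ ▸ 𝔤.lie_mem m₁ m₆
  have hb𝔤 : ∀ i, b i ∈ 𝔤 := by
    intro i
    fin_cases i
    exacts [m₁, m₂, m₃, m₄, m₅, m₆, mh, 𝔤.smul_mem _ mk, n₁, n₂, n₃, n₄, n₅, n₆]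
  -- The Serre generators and the triple `S₁, S₂, S₃` generate the same subalgebra: `S₂`, `S₆` and
  -- `S₃` are recovered in turn from `⁅S₁, L₃⁆`, `⁅S₅, L₆⁆` and `⁅S₅, S₆⁆`.
  have hrange : ψ.range = 𝔤 := by
    rw [hψ]
    apply le_antisymm
    · rw [LieSubalgebra.lieSpan_le]
      rintro x (rfl | rfl | rfl | rfl)
      exacts [m₁, n₃, 𝔤.smul_mem _ m₅, 𝔤.smul_mem _ n₆]
    · set K := LieSubalgebra.lieSpan ℝ L {S₁, L₃, (1 / 2 : ℝ) • S₅, (1 / 36 : ℝ) • L₆}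
      have k₁ : S₁ ∈ K := LieSubalgebra.subset_lieSpan (by simp)
      have k₃ : L₃ ∈ K := LieSubalgebra.subset_lieSpan (by simp)
      have k₅ : S₅ ∈ K := by
        have : (1 / 2 : ℝ) • S₅ ∈ K := LieSubalgebra.subset_lieSpan (by simp)
        simpa using K.smul_mem 2 this
      have k₆ : L₆ ∈ K := by
        have : (1 / 36 : ℝ) • L₆ ∈ K := LieSubalgebra.subset_lieSpan (by simp)
        simpa using K.smul_mem 36 this
      have k₂ : S₂ ∈ K := by
        have : S₂ = (-1 / 6 : ℝ) • ⁅S₁, L₃⁆ := by rw [r.lie_S₁_L₃]; module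
        exact this ▸ K.smul_mem _ (K.lie_mem k₁ k₃)
      have j₆ : S₆ ∈ K := by
        have : S₆ = (1 / 6 : ℝ) • ⁅S₅, L₆⁆ := by rw [r.lie_S₅_L₆]; module
        exact this ▸ K.smul_mem _ (K.lie_mem k₅ k₆)
      have j₃ : S₃ ∈ K := by
        have : S₃ = (-1 / 8 : ℝ) • ⁅S₅, S₆⁆ := by rw [r.lie_S₅_S₆]; module
        exact this ▸ K.smul_mem _ (K.lie_mem k₅ j₆)
      rw [h𝔤, LieSubalgebra.lieSpan_le]
      rintro x (rfl | rfl | rfl)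
      exacts [k₁, k₂, j₃]
  have hfin := finite_g₂
  have hspan_le : Submodule.span ℝ (Set.range b) ≤ 𝔤.toSubmodule := by
    rw [Submodule.span_le]
    rintro _ ⟨i, rfl⟩
    exact hb𝔤 i
  -- The dimension is squeezed: independence gives at least 14, the surjection from `𝔤₂` at most 14.
  -- So the frame spans, and rank–nullity makes `ψ` injective.
  have hcard : Module.finrank ℝ (Submodule.span ℝ (Set.range b)) = 14 := by
    rw [finrank_span_eq_card hli, Fintype.card_fin]
  have hP : LinearMap.range (ψ : LieAlgebra.g₂ ℝ →ₗ[ℝ] L) = 𝔤.toSubmodule := by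
    rw [← hrange]; rfl
  have hfin𝔤 : FiniteDimensional ℝ 𝔤.toSubmodule := hP ▸ inferInstance
  have hle : Module.finrank ℝ 𝔤.toSubmodule ≤ 14 :=
    hP ▸ (LinearMap.finrank_range_le _).trans finrank_g₂_le
  have hspan : 𝔤.toSubmodule = Submodule.span ℝ (Set.range b) :=
    (Submodule.eq_of_le_of_finrank_le hspan_le (hle.trans_eq hcard.symm)).symm
  have hinj : Function.Injective ψ := by
    have h1 := LinearMap.finrank_range_add_finrank_ker (ψ : LieAlgebra.g₂ ℝ →ₗ[ℝ] L)
    rw [hP, hspan, hcard] at h1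
    have h2 := finrank_g₂_le
    have h3 : Module.finrank ℝ (LinearMap.ker (ψ : LieAlgebra.g₂ ℝ →ₗ[ℝ] L)) = 0 := by omega
    exact LinearMap.ker_eq_bot.1 (Submodule.finrank_eq_zero.1 h3)
  have hiso : Nonempty (𝔤 ≃ₗ⁅ℝ⁆ LieAlgebra.g₂ ℝ) :=
    hrange ▸ ⟨(LieEquiv.ofInjective ψ hinj).symm⟩
  have hweights : ∀ i, ⁅b 6, b i⁆ = (g2Diagram i).1 • b i ∧ ⁅b 7, b i⁆ = (g2Diagram i).2 • b i :=
    r.weights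
  unfold PairwiseBracketGenerateSplitG2
  dsimp only
  rw [r.g2Frame_eq]
  refine ⟨hli, hspan, hiso, ?_, hweights⟩
  exact exists_cartan 𝔤 b hli hspan hweights

end G2FrameRelations

/-! ### The polynomial realisation of `𝔤₂` in flat coordinates. -/

namespace FlatModel

open MvPolynomial

/-- Polynomial vector fields on `ℝ⁵`. -/
abbrev PolyField : Type := Derivation ℝ (MvPolynomial (Fin 5) ℝ) (MvPolynomial (Fin 5) ℝ)

/-- A derivation is determined by its values on the variables, and a real polynomial by its values
at points, so each bracket relation becomes five identities of real numbers. -/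
theorem polyField_ext {D₁ D₂ : PolyField}
    (h : ∀ (i : Fin 5) (a : Fin 5 → ℝ), eval a (D₁ (X i)) = eval a (D₂ (X i))) : D₁ = D₂ :=
  derivation_ext fun i => MvPolynomial.funext (h i)

/-- The components of the left-invariant field `∂₄ - (a₃ + a₄ a₅ / 2) ∂₁ + (a₅ / 2) ∂₃` of the
flat Cartan distribution. -/
noncomputable def flatS₁ (i : Fin 5) : MvPolynomial (Fin 5) ℝ :=
  ![-(C (1 / 2) * X 3 * X 4) - X 2,
    0,
    C (1 / 2) * X 4,
    1,
    0] i

/-- The components of the left-invariant field `∂₅ - (a₃ - a₄ a₅ / 2) ∂₂ - (a₄ / 2) ∂₃` of the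
flat Cartan distribution. -/
noncomputable def flatS₂ (i : Fin 5) : MvPolynomial (Fin 5) ℝ :=
  ![0,
    C (1 / 2) * X 3 * X 4 - X 2,
    -(C (1 / 2) * X 3),
    0,
    1] i

/-- The components of the third generator of the polynomial realisation of split `𝔤₂` in flat
coordinates. -/
noncomputable def flatS₃ (i : Fin 5) : MvPolynomial (Fin 5) ℝ :=
  ![C (1 / 2) * X 3 ^ 3 * X 4 ^ 2 + C 3 * X 0 * X 3 * X 4 + C 6 * X 0 * X 2,
    C (1 / 2) * X 3 ^ 2 * X 4 ^ 3 - C 3 * X 1 * X 3 * X 4 + C 6 * X 1 * X 2,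
    -(X 3 ^ 2 * X 4 ^ 2) + C 2 * X 2 ^ 2 + C 3 * X 1 * X 3 - C 3 * X 0 * X 4,
    -(X 3 ^ 2 * X 4) + C 2 * X 2 * X 3 - C 6 * X 0,
    X 3 * X 4 ^ 2 + C 2 * X 2 * X 4 - C 6 * X 1] i

/-- The components of a member of the polynomial `G₂`-frame in flat coordinates. -/
noncomputable def flatS₄ (i : Fin 5) : MvPolynomial (Fin 5) ℝ :=
  ![0,
    0,
    -1,
    0,
    0] i

/-- The components of a member of the polynomial `G₂`-frame in flat coordinates. -/
noncomputable def flatS₅ (i : Fin 5) : MvPolynomial (Fin 5) ℝ :=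
  ![X 3 ^ 3 * X 4,
    -(X 3 ^ 2 * X 4 ^ 2) + C 4 * X 2 * X 3 * X 4 - C 4 * X 2 ^ 2,
    -(X 3 ^ 2 * X 4) - C 4 * X 2 * X 3 - C 6 * X 0,
    -(C 2 * X 3 ^ 2),
    -(C 2 * X 3 * X 4) + C 8 * X 2] i

/-- The components of a member of the polynomial `G₂`-frame in flat coordinates. -/
noncomputable def flatS₆ (i : Fin 5) : MvPolynomial (Fin 5) ℝ :=
  ![X 3 ^ 2 * X 4 ^ 2 + C 4 * X 2 * X 3 * X 4 + C 4 * X 2 ^ 2,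
    -(X 3 * X 4 ^ 3),
    X 3 * X 4 ^ 2 - C 4 * X 2 * X 4 - C 6 * X 1,
    -(C 2 * X 3 * X 4) - C 8 * X 2,
    -(C 2 * X 4 ^ 2)] i

/-- The components of a member of the polynomial `G₂`-frame in flat coordinates. -/
noncomputable def flatH (i : Fin 5) : MvPolynomial (Fin 5) ℝ :=
  ![-(C (3 / 2) * X 0),
    0,
    -(C (1 / 2) * X 2),
    -(X 3),
    C (1 / 2) * X 4] i

/-- The components of a member of the polynomial `G₂`-frame in flat coordinates. -/
noncomputable def flatK (i : Fin 5) : MvPolynomial (Fin 5) ℝ :=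
  ![-(C (3 / 2) * X 0),
    -(C 3 * X 1),
    -(C (3 / 2) * X 2),
    0,
    -(C (3 / 2) * X 4)] i

/-- The components of a member of the polynomial `G₂`-frame in flat coordinates. -/
noncomputable def flatL₁ (i : Fin 5) : MvPolynomial (Fin 5) ℝ :=
  ![-1,
    0,
    0,
    0,
    0] i

/-- The components of a member of the polynomial `G₂`-frame in flat coordinates. -/
noncomputable def flatL₂ (i : Fin 5) : MvPolynomial (Fin 5) ℝ :=
  ![0,
    -1,
    0,
    0,
    0] i

/-- The components of a member of the polynomial `G₂`-frame in flat coordinates. -/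
noncomputable def flatL₃ (i : Fin 5) : MvPolynomial (Fin 5) ℝ :=
  ![X 3 ^ 3,
    -(C 3 * X 3 ^ 2 * X 4) - C 6 * X 0,
    0,
    0,
    -(C 6 * X 3)] i

/-- The components of a member of the polynomial `G₂`-frame in flat coordinates. -/
noncomputable def flatL₄ (i : Fin 5) : MvPolynomial (Fin 5) ℝ :=
  ![-(C 6 * X 2 * X 3 ^ 3 * X 4) - C 6 * X 1 * X 3 ^ 3 + C 36 * X 0 ^ 2,
    -(C 2 * X 3 ^ 3 * X 4 ^ 3) + C 6 * X 2 * X 3 ^ 2 * X 4 ^ 2 - C 12 * X 2 ^ 2 * X 3 * X 4 +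
      C 8 * X 2 ^ 3 + C 18 * X 1 * X 3 ^ 2 * X 4 + C 36 * X 0 * X 1,
    C 6 * X 2 * X 3 ^ 2 * X 4 + C 12 * X 2 ^ 2 * X 3 + C 36 * X 0 * X 2,
    C 6 * X 3 ^ 3 * X 4 + C 12 * X 2 * X 3 ^ 2 + C 36 * X 0 * X 3,
    -(C 6 * X 3 ^ 2 * X 4 ^ 2) + C 12 * X 2 * X 3 * X 4 - C 24 * X 2 ^ 2 + C 36 * X 1 * X 3] i

/-- The components of a member of the polynomial `G₂`-frame in flat coordinates. -/
noncomputable def flatL₅ (i : Fin 5) : MvPolynomial (Fin 5) ℝ :=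
  ![-(C 2 * X 3 ^ 3 * X 4 ^ 3) - C 6 * X 2 * X 3 ^ 2 * X 4 ^ 2 - C 12 * X 2 ^ 2 * X 3 * X 4 -
      C 8 * X 2 ^ 3 - C 18 * X 0 * X 3 * X 4 ^ 2 + C 36 * X 0 * X 1,
    C 6 * X 2 * X 3 * X 4 ^ 3 + C 36 * X 1 ^ 2 + C 6 * X 0 * X 4 ^ 3,
    -(C 6 * X 2 * X 3 * X 4 ^ 2) + C 12 * X 2 ^ 2 * X 4 + C 36 * X 1 * X 2,
    C 6 * X 3 ^ 2 * X 4 ^ 2 + C 12 * X 2 * X 3 * X 4 + C 24 * X 2 ^ 2 + C 36 * X 0 * X 4,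
    -(C 6 * X 3 * X 4 ^ 3) + C 12 * X 2 * X 4 ^ 2 + C 36 * X 1 * X 4] i

/-- The components of a member of the polynomial `G₂`-frame in flat coordinates. -/
noncomputable def flatL₆ (i : Fin 5) : MvPolynomial (Fin 5) ℝ :=
  ![C 3 * X 3 * X 4 ^ 2 - C 6 * X 1,
    -(X 4 ^ 3),
    0,
    -(C 6 * X 4),
    0] i

-- Each relation is compared component by component. After the Leibniz rule and evaluation at a
-- point, only ring identities remain.
set_option linter.unusedSimpArgs false in
set_option maxHeartbeats 4000000 in
theorem flat_frameRelations :
    G2FrameRelations (L := PolyField)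
      (mkDerivation ℝ flatS₁) (mkDerivation ℝ flatS₂) (mkDerivation ℝ flatS₃)
      (mkDerivation ℝ flatS₄) (mkDerivation ℝ flatS₅) (mkDerivation ℝ flatS₆)
      (mkDerivation ℝ flatL₁) (mkDerivation ℝ flatL₂) (mkDerivation ℝ flatL₃)
      (mkDerivation ℝ flatL₄) (mkDerivation ℝ flatL₅) (mkDerivation ℝ flatL₆)
      (mkDerivation ℝ flatH) (mkDerivation ℝ flatK) := by
  constructor
  · refine polyField_ext fun i a => ?_
    simp only [Derivation.commutator_apply, mkDerivation_X, Derivation.add_apply, Derivation.sub_apply,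
      Derivation.smul_apply, Derivation.zero_apply]
    fin_cases i
    all_goals simp only [flatS₁, flatS₂, flatS₄, Fin.zero_eta,
      Fin.mk_one, Fin.reduceFinMk, Matrix.cons_val, map_add, map_sub, map_neg, map_zero,
      Derivation.leibniz, Derivation.leibniz_pow, mkDerivation_X, derivation_C,
      Derivation.map_one_eq_zero]
    all_goals try simp only [smul_eq_mul, nsmul_eq_mul, Nat.add_one_sub_one, pow_one, Nat.reduceSub,
      map_add, map_sub, map_neg, map_mul, map_pow, map_zero, map_one, eval_X, eval_C, map_natCast,
      smul_eval, smul_zero]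
    all_goals ring
  · refine polyField_ext fun i a => ?_
    simp only [Derivation.commutator_apply, mkDerivation_X, Derivation.add_apply, Derivation.sub_apply,
      Derivation.smul_apply, Derivation.zero_apply]
    fin_cases i
    all_goals simp only [flatS₂, flatS₃, flatS₅, Fin.zero_eta,
      Fin.mk_one, Fin.reduceFinMk, Matrix.cons_val, map_add, map_sub, map_neg, map_zero,
      Derivation.leibniz, Derivation.leibniz_pow, mkDerivation_X, derivation_C,
      Derivation.map_one_eq_zero]
    all_goals try simp only [smul_eq_mul, nsmul_eq_mul, Nat.add_one_sub_one, pow_one, Nat.reduceSub,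
      map_add, map_sub, map_neg, map_mul, map_pow, map_zero, map_one, eval_X, eval_C, map_natCast,
      smul_eval, smul_zero]
    all_goals push_cast
    all_goals ring
  · refine polyField_ext fun i a => ?_
    simp only [Derivation.commutator_apply, mkDerivation_X, Derivation.add_apply, Derivation.sub_apply,
      Derivation.smul_apply, Derivation.zero_apply]
    fin_cases i
    all_goals simp only [flatS₃, flatS₁, flatS₆, Fin.zero_eta,
      Fin.mk_one, Fin.reduceFinMk, Matrix.cons_val, map_add, map_sub, map_neg, map_zero,
      Derivation.leibniz, Derivation.leibniz_pow, mkDerivation_X, derivation_C,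
      Derivation.map_one_eq_zero]
    all_goals try simp only [smul_eq_mul, nsmul_eq_mul, Nat.add_one_sub_one, pow_one, Nat.reduceSub,
      map_add, map_sub, map_neg, map_mul, map_pow, map_zero, map_one, eval_X, eval_C, map_natCast,
      smul_eval, smul_zero]
    all_goals push_cast
    all_goals ring
  · refine polyField_ext fun i a => ?_
    simp only [Derivation.commutator_apply, mkDerivation_X, Derivation.add_apply, Derivation.sub_apply,
      Derivation.smul_apply, Derivation.zero_apply]
    fin_cases i
    all_goals simp only [flatS₁, flatS₄, flatL₁, Fin.zero_eta,
      Fin.mk_one, Fin.reduceFinMk, Matrix.cons_val, map_add, map_sub, map_neg, map_zero,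
      Derivation.leibniz, Derivation.leibniz_pow, mkDerivation_X, derivation_C,
      Derivation.map_one_eq_zero]
    all_goals try simp only [smul_eq_mul, nsmul_eq_mul, Nat.add_one_sub_one, pow_one, Nat.reduceSub,
      map_add, map_sub, map_neg, map_mul, map_pow, map_zero, map_one, eval_X, eval_C, map_natCast,
      smul_eval, smul_zero]
    all_goals ring
  · refine polyField_ext fun i a => ?_
    simp only [Derivation.commutator_apply, mkDerivation_X, Derivation.add_apply, Derivation.sub_apply,
      Derivation.smul_apply, Derivation.zero_apply]
    fin_cases i
    all_goals simp only [flatS₂, flatS₄, flatL₂, Fin.zero_eta,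
      Fin.mk_one, Fin.reduceFinMk, Matrix.cons_val, map_add, map_sub, map_neg, map_zero,
      Derivation.leibniz, Derivation.leibniz_pow, mkDerivation_X, derivation_C,
      Derivation.map_one_eq_zero]
    all_goals try simp only [smul_eq_mul, nsmul_eq_mul, Nat.add_one_sub_one, pow_one, Nat.reduceSub,
      map_add, map_sub, map_neg, map_mul, map_pow, map_zero, map_one, eval_X, eval_C, map_natCast,
      smul_eval, smul_zero]
    all_goals ring
  · refine polyField_ext fun i a => ?_
    simp only [Derivation.commutator_apply, mkDerivation_X, Derivation.add_apply, Derivation.sub_apply,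
      Derivation.smul_apply, Derivation.zero_apply]
    fin_cases i
    all_goals simp only [flatS₂, flatS₅, flatL₃, Fin.zero_eta,
      Fin.mk_one, Fin.reduceFinMk, Matrix.cons_val, map_add, map_sub, map_neg, map_zero,
      Derivation.leibniz, Derivation.leibniz_pow, mkDerivation_X, derivation_C,
      Derivation.map_one_eq_zero]
    all_goals try simp only [smul_eq_mul, nsmul_eq_mul, Nat.add_one_sub_one, pow_one, Nat.reduceSub,
      map_add, map_sub, map_neg, map_mul, map_pow, map_zero, map_one, eval_X, eval_C, map_natCast,
      smul_eval, smul_zero]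
    all_goals push_cast
    all_goals ring
  · refine polyField_ext fun i a => ?_
    simp only [Derivation.commutator_apply, mkDerivation_X, Derivation.add_apply, Derivation.sub_apply,
      Derivation.smul_apply, Derivation.zero_apply]
    fin_cases i
    all_goals simp only [flatS₃, flatS₅, flatL₄, Fin.zero_eta,
      Fin.mk_one, Fin.reduceFinMk, Matrix.cons_val, map_add, map_sub, map_neg, map_zero,
      Derivation.leibniz, Derivation.leibniz_pow, mkDerivation_X, derivation_C,
      Derivation.map_one_eq_zero]
    all_goals try simp only [smul_eq_mul, nsmul_eq_mul, Nat.add_one_sub_one, pow_one, Nat.reduceSub,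
      map_add, map_sub, map_neg, map_mul, map_pow, map_zero, map_one, eval_X, eval_C, map_natCast,
      smul_eval, smul_zero]
    all_goals push_cast
    all_goals ring
  · refine polyField_ext fun i a => ?_
    simp only [Derivation.commutator_apply, mkDerivation_X, Derivation.add_apply, Derivation.sub_apply,
      Derivation.smul_apply, Derivation.zero_apply]
    fin_cases i
    all_goals simp only [flatS₃, flatS₆, flatL₅, Fin.zero_eta,
      Fin.mk_one, Fin.reduceFinMk, Matrix.cons_val, map_add, map_sub, map_neg, map_zero,
      Derivation.leibniz, Derivation.leibniz_pow, mkDerivation_X, derivation_C,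
      Derivation.map_one_eq_zero]
    all_goals try simp only [smul_eq_mul, nsmul_eq_mul, Nat.add_one_sub_one, pow_one, Nat.reduceSub,
      map_add, map_sub, map_neg, map_mul, map_pow, map_zero, map_one, eval_X, eval_C, map_natCast,
      smul_eval, smul_zero]
    all_goals push_cast
    all_goals ring
  · refine polyField_ext fun i a => ?_
    simp only [Derivation.commutator_apply, mkDerivation_X, Derivation.add_apply, Derivation.sub_apply,
      Derivation.smul_apply, Derivation.zero_apply]
    fin_cases i
    all_goals simp only [flatS₁, flatS₆, flatL₆, Fin.zero_eta,
      Fin.mk_one, Fin.reduceFinMk, Matrix.cons_val, map_add, map_sub, map_neg, map_zero,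
      Derivation.leibniz, Derivation.leibniz_pow, mkDerivation_X, derivation_C,
      Derivation.map_one_eq_zero]
    all_goals try simp only [smul_eq_mul, nsmul_eq_mul, Nat.add_one_sub_one, pow_one, Nat.reduceSub,
      map_add, map_sub, map_neg, map_mul, map_pow, map_zero, map_one, eval_X, eval_C, map_natCast,
      smul_eval, smul_zero]
    all_goals push_cast
    all_goals ring
  · refine polyField_ext fun i a => ?_
    simp only [Derivation.commutator_apply, mkDerivation_X, Derivation.add_apply, Derivation.sub_apply,
      Derivation.smul_apply, Derivation.zero_apply]
    fin_cases i
    all_goals simp only [flatS₂, flatS₆, flatH, flatK, Fin.zero_eta,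
      Fin.mk_one, Fin.reduceFinMk, Matrix.cons_val, map_add, map_sub, map_neg, map_zero,
      Derivation.leibniz, Derivation.leibniz_pow, mkDerivation_X, derivation_C,
      Derivation.map_one_eq_zero]
    all_goals try simp only [smul_eq_mul, nsmul_eq_mul, Nat.add_one_sub_one, pow_one, Nat.reduceSub,
      map_add, map_sub, map_neg, map_mul, map_pow, map_zero, map_one, eval_X, eval_C, map_natCast,
      smul_eval, smul_zero]
    all_goals push_cast
    all_goals ring
  · refine polyField_ext fun i a => ?_
    simp only [Derivation.commutator_apply, mkDerivation_X, Derivation.add_apply, Derivation.sub_apply,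
      Derivation.smul_apply, Derivation.zero_apply]
    fin_cases i
    all_goals simp only [flatS₄, flatS₃, flatH, flatK, Fin.zero_eta,
      Fin.mk_one, Fin.reduceFinMk, Matrix.cons_val, map_add, map_sub, map_neg, map_zero,
      Derivation.leibniz, Derivation.leibniz_pow, mkDerivation_X, derivation_C,
      Derivation.map_one_eq_zero]
    all_goals try simp only [smul_eq_mul, nsmul_eq_mul, Nat.add_one_sub_one, pow_one, Nat.reduceSub,
      map_add, map_sub, map_neg, map_mul, map_pow, map_zero, map_one, eval_X, eval_C, map_natCast,
      smul_eval, smul_zero]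
    all_goals push_cast
    all_goals ring
  · refine polyField_ext fun i a => ?_
    simp only [Derivation.commutator_apply, mkDerivation_X, Derivation.add_apply, Derivation.sub_apply,
      Derivation.smul_apply, Derivation.zero_apply]
    fin_cases i
    all_goals simp only [flatH, flatS₁, Fin.zero_eta,
      Fin.mk_one, Fin.reduceFinMk, Matrix.cons_val, map_add, map_sub, map_neg, map_zero,
      Derivation.leibniz, Derivation.leibniz_pow, mkDerivation_X, derivation_C,
      Derivation.map_one_eq_zero]
    all_goals try simp only [smul_eq_mul, nsmul_eq_mul, Nat.add_one_sub_one, pow_one, Nat.reduceSub,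
      map_add, map_sub, map_neg, map_mul, map_pow, map_zero, map_one, eval_X, eval_C, map_natCast,
      smul_eval, smul_zero]
    all_goals ring
  · refine polyField_ext fun i a => ?_
    simp only [Derivation.commutator_apply, mkDerivation_X, Derivation.add_apply, Derivation.sub_apply,
      Derivation.smul_apply, Derivation.zero_apply]
    fin_cases i
    all_goals simp only [flatH, flatS₂, Fin.zero_eta,
      Fin.mk_one, Fin.reduceFinMk, Matrix.cons_val, map_add, map_sub, map_neg, map_zero,
      Derivation.leibniz, Derivation.leibniz_pow, mkDerivation_X, derivation_C,
      Derivation.map_one_eq_zero]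
    all_goals try simp only [smul_eq_mul, nsmul_eq_mul, Nat.add_one_sub_one, pow_one, Nat.reduceSub,
      map_add, map_sub, map_neg, map_mul, map_pow, map_zero, map_one, eval_X, eval_C, map_natCast,
      smul_eval, smul_zero]
    all_goals ring
  · refine polyField_ext fun i a => ?_
    simp only [Derivation.commutator_apply, mkDerivation_X, Derivation.add_apply, Derivation.sub_apply,
      Derivation.smul_apply, Derivation.zero_apply]
    fin_cases i
    all_goals simp only [flatH, flatS₃, Fin.zero_eta,
      Fin.mk_one, Fin.reduceFinMk, Matrix.cons_val, map_add, map_sub, map_neg, map_zero,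
      Derivation.leibniz, Derivation.leibniz_pow, mkDerivation_X, derivation_C,
      Derivation.map_one_eq_zero]
    all_goals try simp only [smul_eq_mul, nsmul_eq_mul, Nat.add_one_sub_one, pow_one, Nat.reduceSub,
      map_add, map_sub, map_neg, map_mul, map_pow, map_zero, map_one, eval_X, eval_C, map_natCast,
      smul_eval, smul_zero]
    all_goals push_cast
    all_goals ring
  · refine polyField_ext fun i a => ?_
    simp only [Derivation.commutator_apply, mkDerivation_X, Derivation.add_apply, Derivation.sub_apply,
      Derivation.smul_apply, Derivation.zero_apply]
    fin_cases i
    all_goals simp only [flatK, flatS₁, Fin.zero_eta,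
      Fin.mk_one, Fin.reduceFinMk, Matrix.cons_val, map_add, map_sub, map_neg, map_zero,
      Derivation.leibniz, Derivation.leibniz_pow, mkDerivation_X, derivation_C,
      Derivation.map_one_eq_zero]
    all_goals try simp only [smul_eq_mul, nsmul_eq_mul, Nat.add_one_sub_one, pow_one, Nat.reduceSub,
      map_add, map_sub, map_neg, map_mul, map_pow, map_zero, map_one, eval_X, eval_C, map_natCast,
      smul_eval, smul_zero]
    all_goals ring
  · refine polyField_ext fun i a => ?_
    simp only [Derivation.commutator_apply, mkDerivation_X, Derivation.add_apply, Derivation.sub_apply,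
      Derivation.smul_apply, Derivation.zero_apply]
    fin_cases i
    all_goals simp only [flatK, flatS₂, Fin.zero_eta,
      Fin.mk_one, Fin.reduceFinMk, Matrix.cons_val, map_add, map_sub, map_neg, map_zero,
      Derivation.leibniz, Derivation.leibniz_pow, mkDerivation_X, derivation_C,
      Derivation.map_one_eq_zero]
    all_goals try simp only [smul_eq_mul, nsmul_eq_mul, Nat.add_one_sub_one, pow_one, Nat.reduceSub,
      map_add, map_sub, map_neg, map_mul, map_pow, map_zero, map_one, eval_X, eval_C, map_natCast,
      smul_eval, smul_zero]
    all_goals ring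
  · refine polyField_ext fun i a => ?_
    simp only [Derivation.commutator_apply, mkDerivation_X, Derivation.add_apply, Derivation.sub_apply,
      Derivation.smul_apply, Derivation.zero_apply]
    fin_cases i
    all_goals simp only [flatK, flatS₃, Fin.zero_eta,
      Fin.mk_one, Fin.reduceFinMk, Matrix.cons_val, map_add, map_sub, map_neg, map_zero,
      Derivation.leibniz, Derivation.leibniz_pow, mkDerivation_X, derivation_C,
      Derivation.map_one_eq_zero]
    all_goals try simp only [smul_eq_mul, nsmul_eq_mul, Nat.add_one_sub_one, pow_one, Nat.reduceSub,
      map_add, map_sub, map_neg, map_mul, map_pow, map_zero, map_one, eval_X, eval_C, map_natCast,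
      smul_eval, smul_zero]
    all_goals push_cast
    all_goals ring
  · refine polyField_ext fun i a => ?_
    simp only [Derivation.commutator_apply, mkDerivation_X, Derivation.add_apply, Derivation.sub_apply,
      Derivation.smul_apply, Derivation.zero_apply]
    fin_cases i
    all_goals simp only [flatS₁, flatS₅, flatH, Fin.zero_eta,
      Fin.mk_one, Fin.reduceFinMk, Matrix.cons_val, map_add, map_sub, map_neg, map_zero,
      Derivation.leibniz, Derivation.leibniz_pow, mkDerivation_X, derivation_C,
      Derivation.map_one_eq_zero]
    all_goals try simp only [smul_eq_mul, nsmul_eq_mul, Nat.add_one_sub_one, pow_one, Nat.reduceSub,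
      map_add, map_sub, map_neg, map_mul, map_pow, map_zero, map_one, eval_X, eval_C, map_natCast,
      smul_eval, smul_zero]
    all_goals push_cast
    all_goals ring
  · refine polyField_ext fun i a => ?_
    simp only [Derivation.commutator_apply, mkDerivation_X, Derivation.add_apply, Derivation.sub_apply,
      Derivation.smul_apply, Derivation.zero_apply]
    fin_cases i
    all_goals simp only [flatL₃, flatL₆, flatH, flatK, Fin.zero_eta,
      Fin.mk_one, Fin.reduceFinMk, Matrix.cons_val, map_add, map_sub, map_neg, map_zero,
      Derivation.leibniz, Derivation.leibniz_pow, mkDerivation_X, derivation_C,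
      Derivation.map_one_eq_zero]
    all_goals try simp only [smul_eq_mul, nsmul_eq_mul, Nat.add_one_sub_one, pow_one, Nat.reduceSub,
      map_add, map_sub, map_neg, map_mul, map_pow, map_zero, map_one, eval_X, eval_C, map_natCast,
      smul_eval, smul_zero]
    all_goals push_cast
    all_goals ring
  · refine polyField_ext fun i a => ?_
    simp only [Derivation.commutator_apply, mkDerivation_X, Derivation.add_apply, Derivation.sub_apply,
      Derivation.smul_apply, Derivation.zero_apply]
    fin_cases i
    all_goals simp only [flatS₁, flatL₆, Fin.zero_eta,
      Fin.mk_one, Fin.reduceFinMk, Matrix.cons_val, map_add, map_sub, map_neg, map_zero,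
      Derivation.leibniz, Derivation.leibniz_pow, mkDerivation_X, derivation_C,
      Derivation.map_one_eq_zero]
    all_goals try simp only [smul_eq_mul, nsmul_eq_mul, Nat.add_one_sub_one, pow_one, Nat.reduceSub,
      map_add, map_sub, map_neg, map_mul, map_pow, map_zero, map_one, eval_X, eval_C, map_natCast,
      smul_eval, smul_zero]
    all_goals push_cast
    all_goals ring
  · refine polyField_ext fun i a => ?_
    simp only [Derivation.commutator_apply, mkDerivation_X, Derivation.add_apply, Derivation.sub_apply,
      Derivation.smul_apply, Derivation.zero_apply]
    fin_cases i
    all_goals simp only [flatL₃, flatS₅, Fin.zero_eta,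
      Fin.mk_one, Fin.reduceFinMk, Matrix.cons_val, map_add, map_sub, map_neg, map_zero,
      Derivation.leibniz, Derivation.leibniz_pow, mkDerivation_X, derivation_C,
      Derivation.map_one_eq_zero]
    all_goals try simp only [smul_eq_mul, nsmul_eq_mul, Nat.add_one_sub_one, pow_one, Nat.reduceSub,
      map_add, map_sub, map_neg, map_mul, map_pow, map_zero, map_one, eval_X, eval_C, map_natCast,
      smul_eval, smul_zero]
    all_goals push_cast
    all_goals ring
  · refine polyField_ext fun i a => ?_
    simp only [Derivation.commutator_apply, mkDerivation_X, Derivation.add_apply, Derivation.sub_apply,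
      Derivation.smul_apply, Derivation.zero_apply]
    fin_cases i
    all_goals simp only [flatS₁, flatL₃, flatS₂, Fin.zero_eta,
      Fin.mk_one, Fin.reduceFinMk, Matrix.cons_val, map_add, map_sub, map_neg, map_zero,
      Derivation.leibniz, Derivation.leibniz_pow, mkDerivation_X, derivation_C,
      Derivation.map_one_eq_zero]
    all_goals try simp only [smul_eq_mul, nsmul_eq_mul, Nat.add_one_sub_one, pow_one, Nat.reduceSub,
      map_add, map_sub, map_neg, map_mul, map_pow, map_zero, map_one, eval_X, eval_C, map_natCast,
      smul_eval, smul_zero]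
    all_goals push_cast
    all_goals ring
  · refine polyField_ext fun i a => ?_
    simp only [Derivation.commutator_apply, mkDerivation_X, Derivation.add_apply, Derivation.sub_apply,
      Derivation.smul_apply, Derivation.zero_apply]
    fin_cases i
    all_goals simp only [flatS₁, flatL₁, Fin.zero_eta,
      Fin.mk_one, Fin.reduceFinMk, Matrix.cons_val, map_add, map_sub, map_neg, map_zero,
      Derivation.leibniz, Derivation.leibniz_pow, mkDerivation_X, derivation_C,
      Derivation.map_one_eq_zero]
    all_goals try simp only [smul_eq_mul, nsmul_eq_mul, Nat.add_one_sub_one, pow_one, Nat.reduceSub,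
      map_add, map_sub, map_neg, map_mul, map_pow, map_zero, map_one, eval_X, eval_C, map_natCast,
      smul_eval, smul_zero]
    all_goals ring
  · refine polyField_ext fun i a => ?_
    simp only [Derivation.commutator_apply, mkDerivation_X, Derivation.add_apply, Derivation.sub_apply,
      Derivation.smul_apply, Derivation.zero_apply]
    fin_cases i
    all_goals simp only [flatL₃, flatS₂, Fin.zero_eta,
      Fin.mk_one, Fin.reduceFinMk, Matrix.cons_val, map_add, map_sub, map_neg, map_zero,
      Derivation.leibniz, Derivation.leibniz_pow, mkDerivation_X, derivation_C,
      Derivation.map_one_eq_zero]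
    all_goals try simp only [smul_eq_mul, nsmul_eq_mul, Nat.add_one_sub_one, pow_one, Nat.reduceSub,
      map_add, map_sub, map_neg, map_mul, map_pow, map_zero, map_one, eval_X, eval_C, map_natCast,
      smul_eval, smul_zero]
    all_goals push_cast
    all_goals ring
  · refine polyField_ext fun i a => ?_
    simp only [Derivation.commutator_apply, mkDerivation_X, Derivation.add_apply, Derivation.sub_apply,
      Derivation.smul_apply, Derivation.zero_apply]
    fin_cases i
    all_goals simp only [flatS₅, flatL₆, flatS₆, Fin.zero_eta,
      Fin.mk_one, Fin.reduceFinMk, Matrix.cons_val, map_add, map_sub, map_neg, map_zero,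
      Derivation.leibniz, Derivation.leibniz_pow, mkDerivation_X, derivation_C,
      Derivation.map_one_eq_zero]
    all_goals try simp only [smul_eq_mul, nsmul_eq_mul, Nat.add_one_sub_one, pow_one, Nat.reduceSub,
      map_add, map_sub, map_neg, map_mul, map_pow, map_zero, map_one, eval_X, eval_C, map_natCast,
      smul_eval, smul_zero]
    all_goals push_cast
    all_goals ring
  · refine polyField_ext fun i a => ?_
    simp only [Derivation.commutator_apply, mkDerivation_X, Derivation.add_apply, Derivation.sub_apply,
      Derivation.smul_apply, Derivation.zero_apply]
    fin_cases i
    all_goals simp only [flatS₅, flatS₆, flatS₃, Fin.zero_eta,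
      Fin.mk_one, Fin.reduceFinMk, Matrix.cons_val, map_add, map_sub, map_neg, map_zero,
      Derivation.leibniz, Derivation.leibniz_pow, mkDerivation_X, derivation_C,
      Derivation.map_one_eq_zero]
    all_goals try simp only [smul_eq_mul, nsmul_eq_mul, Nat.add_one_sub_one, pow_one, Nat.reduceSub,
      map_add, map_sub, map_neg, map_mul, map_pow, map_zero, map_one, eval_X, eval_C, map_natCast,
      smul_eval, smul_zero]
    all_goals push_cast
    all_goals ring
  · refine polyField_ext fun i a => ?_
    simp only [Derivation.commutator_apply, mkDerivation_X, Derivation.add_apply, Derivation.sub_apply,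
      Derivation.smul_apply, Derivation.zero_apply]
    fin_cases i
    all_goals simp only [flatS₅, flatL₄, Fin.zero_eta,
      Fin.mk_one, Fin.reduceFinMk, Matrix.cons_val, map_add, map_sub, map_neg, map_zero,
      Derivation.leibniz, Derivation.leibniz_pow, mkDerivation_X, derivation_C,
      Derivation.map_one_eq_zero]
    all_goals try simp only [smul_eq_mul, nsmul_eq_mul, Nat.add_one_sub_one, pow_one, Nat.reduceSub,
      map_add, map_sub, map_neg, map_mul, map_pow, map_zero, map_one, eval_X, eval_C, map_natCast,
      smul_eval, smul_zero]
    all_goals push_cast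
    all_goals ring
  · refine polyField_ext fun i a => ?_
    simp only [Derivation.commutator_apply, mkDerivation_X, Derivation.add_apply, Derivation.sub_apply,
      Derivation.smul_apply, Derivation.zero_apply]
    fin_cases i
    all_goals simp only [flatL₆, flatS₆, Fin.zero_eta,
      Fin.mk_one, Fin.reduceFinMk, Matrix.cons_val, map_add, map_sub, map_neg, map_zero,
      Derivation.leibniz, Derivation.leibniz_pow, mkDerivation_X, derivation_C,
      Derivation.map_one_eq_zero]
    all_goals try simp only [smul_eq_mul, nsmul_eq_mul, Nat.add_one_sub_one, pow_one, Nat.reduceSub,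
      map_add, map_sub, map_neg, map_mul, map_pow, map_zero, map_one, eval_X, eval_C, map_natCast,
      smul_eval, smul_zero]
    all_goals push_cast
    all_goals ring

end FlatModel

/-! ### Pulling back Lie algebras of vector fields. -/

section PullbackHom

variable {E F : Type*} [NormedAddCommGroup E] [NormedSpace ℝ E] [NormedAddCommGroup F]
  [NormedSpace ℝ F] [CompleteSpace E]

/-- Pulling back vector fields along a local diffeomorphism is a homomorphism of Lie algebras. -/
noncomputable def SmoothVectorField.pullbackHom (U : Opens E) (Φ : E → F)
    (hΦ : ContDiffOn ℝ ∞ Φ U) (hinv : ∀ x ∈ U, (fderiv ℝ Φ x).IsInvertible) :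
    SmoothVectorField (⊤ : Opens F) →ₗ⁅ℝ⁆ SmoothVectorField U where
  toFun V := SmoothVectorField.ofContDiffOn (VectorField.pullback ℝ Φ (V : F → F)) (by
    intro x hx
    have h1 : ContDiffAt ℝ ∞ Φ x := hΦ.contDiffAt (U.isOpen.mem_nhds hx)
    have h2 : ContDiffAt ℝ ∞ (fderiv ℝ Φ) x := h1.fderiv_right (by simp)
    -- Inversion of operators is smooth at an invertible one. `Φ` need not be injective: the target
    -- fields are defined on all of `F`, so invertible derivatives are enough.
    have h3 : ContDiffAt ℝ ∞ (fun y => (fderiv ℝ Φ y).inverse) x :=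
      ((hinv x hx).contDiffAt_map_inverse).comp x h2
    have h4 : ContDiffAt ℝ ∞ (fun y => (V : F → F) (Φ y)) x :=
      (SmoothVectorField.contDiffAt V (U := ⊤) trivial).comp x h1
    exact (h3.clm_apply h4).contDiffWithinAt)
  map_add' V W := SmoothVectorField.ext_on fun x hx => by
    have hx' : x ∈ (U : Set E) := hx
    simp [SmoothVectorField.ofContDiffOn, Set.indicator_of_mem hx', VectorField.pullback]
  map_smul' c V := SmoothVectorField.ext_on fun x hx => by
    have hx' : x ∈ (U : Set E) := hx
    simp [SmoothVectorField.ofContDiffOn, Set.indicator_of_mem hx', VectorField.pullback]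
  map_lie' {V W} := SmoothVectorField.ext_on fun x hx => by
    have h1 : ContDiffAt ℝ ∞ Φ x := hΦ.contDiffAt (U.isOpen.mem_nhds hx)
    have h2 := VectorField.pullback_lieBracket (𝕜 := ℝ) (n := ∞) (f := Φ) (x := x)
      (V := (V : F → F)) (W := (W : F → F)) (by
        rw [minSmoothness_of_isRCLikeNormedField]
        exact WithTop.coe_le_coe.2 (le_top : (2 : ℕ∞) ≤ ⊤)) h1
      (SmoothVectorField.differentiableAt V (U := ⊤) trivial)
      (SmoothVectorField.differentiableAt W (U := ⊤) trivial)
    -- The bracket depends only on germs, and the extension by zero does not change the field near a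
    -- point of `U`.
    have h3 : ∀ V : F → F, (U : Set E).indicator (VectorField.pullback ℝ Φ V) =ᶠ[nhds x]
        VectorField.pullback ℝ Φ V := fun V => by
      filter_upwards [U.isOpen.mem_nhds hx] with y hy using Set.indicator_of_mem hy _
    simp only [SmoothVectorField.ofContDiffOn, SmoothVectorField.coe_bracket]
    rw [Set.indicator_of_mem hx, h2]
    exact (Filter.EventuallyEq.lieBracket_vectorField_eq (h3 _) (h3 _)).symm

/-- Invertibility of the derivative makes a `Φ`-related field unique. This identifies the
pulled-back polynomial generators with the given fields. -/
theorem SmoothVectorField.pullbackHom_eq (U : Opens E) (Φ : E → F)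
    (hΦ : ContDiffOn ℝ ∞ Φ U) (hinv : ∀ x ∈ U, (fderiv ℝ Φ x).IsInvertible)
    (V : SmoothVectorField (⊤ : Opens F)) (W : E → E) (hW : ContDiffOn ℝ ∞ W U)
    (h : ∀ x ∈ U, fderiv ℝ Φ x (W x) = (V : F → F) (Φ x)) :
    SmoothVectorField.pullbackHom U Φ hΦ hinv V = SmoothVectorField.ofContDiffOn W hW :=
  SmoothVectorField.ext_on fun x hx => by
    obtain ⟨e, he⟩ := hinv x hx
    change (U : Set E).indicator _ x = (U : Set E).indicator _ x
    rw [Set.indicator_of_mem hx, Set.indicator_of_mem hx, VectorField.pullback, ← h x hx, ← he]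
    simp

end PullbackHom

/-! ### Polynomial fields as smooth fields. -/

namespace FlatModel

open MvPolynomial

theorem contDiff_eval (P : MvPolynomial (Fin 5) ℝ) : ContDiff ℝ ∞ fun a : R5 => eval a P := by
  induction P using MvPolynomial.induction_on with
  | C c => simpa using contDiff_const
  | add P Q hP hQ => simpa using hP.add hQ
  | mul_X P i hP => simpa using hP.mul (contDiff_apply ℝ ℝ i)

/-- The derivative of a polynomial function along a polynomial vector field. -/
theorem fderiv_eval (D : PolyField) (P : MvPolynomial (Fin 5) ℝ) (a : R5) :
    fderiv ℝ (fun a : R5 => eval a P) a (fun i => eval a (D (X i))) = eval a (D P) := by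
  have hd (P : MvPolynomial (Fin 5) ℝ) : DifferentiableAt ℝ (fun a : R5 => eval a P) a :=
    (contDiff_eval P).differentiable (by simp) a
  induction P using MvPolynomial.induction_on with
  | C c => simp [derivation_C]
  | add P Q hP hQ =>
    simp only [map_add]
    rw [fderiv_fun_add (hd P) (hd Q), add_apply, hP, hQ]
  | mul_X P i hP =>
    simp only [map_mul, eval_X, Derivation.leibniz, smul_eq_mul, map_add]
    rw [fderiv_fun_mul (hd P) (by fun_prop), add_apply,
      smul_apply, smul_apply, hP]
    have : fderiv ℝ (fun a : R5 => a i) a = ContinuousLinearMap.proj i :=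
      (ContinuousLinearMap.proj (R := ℝ) (φ := fun _ : Fin 5 => ℝ) i).fderiv
    rw [this]
    simp

/-- A polynomial vector field as a smooth vector field. -/
noncomputable def toSmooth : PolyField →ₗ⁅ℝ⁆ SmoothVectorField (⊤ : Opens R5) where
  toFun D := ⟨fun a i => eval a (D (X i)), by
    refine ⟨(contDiff_pi.2 fun i => contDiff_eval _).contDiffOn, fun x hx => absurd trivial hx⟩⟩
  map_add' D₁ D₂ := SmoothVectorField.ext_on fun x _ => by ext i; simp
  map_smul' c D := SmoothVectorField.ext_on fun x _ => by ext i; simp [smul_eval]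
  map_lie' {D₁ D₂} := SmoothVectorField.ext_on fun x _ => by
    ext i
    have hd (D : PolyField) (v : R5) :
        fderiv ℝ (fun (a : R5) (i : Fin 5) => eval a (D (X i))) x v i =
          fderiv ℝ (fun a : R5 => eval a (D (X i))) x v := by
      rw [fderiv_pi fun i => (contDiff_eval _).differentiable (by simp) x]
      rfl
    rw [SmoothVectorField.coe_bracket, VectorField.lieBracket, Pi.sub_apply, hd, hd,
      fderiv_eval, fderiv_eval]
    -- The sign conventions agree: `[V, W] = DW(V) - DV(W)` is the commutator of the derivations,
    -- evaluated on a coordinate.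
    change eval x (⁅D₁, D₂⁆ (X i)) = _
    rw [Derivation.commutator_apply, map_sub]

theorem toSmooth_apply (D : PolyField) (a : R5) (i : Fin 5) :
    (toSmooth D : R5 → R5) a i = eval a (D (X i)) := rfl

end FlatModel

/-! ### The flat coordinates and the images of the fields. -/

section FlatChart

/-- The fifth flat coordinate. -/
noncomputable def flatCoord (α β g₃ δ : ℝ) (x : R5) : ℝ :=
  let w := x 0
  let y := x 1
  let p := x 3
  let q := x 4
  let Y := Y α β g₃ w
  4 * δ * (4 * w ^ 3 - g₃) ^ 2 / Y ^ 3 * q + 24 * δ * w ^ 2 / Y * p + 6 * δ * β * w * y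

/-- The flat coordinates on the regular set, in which the distribution becomes the flat Cartan
distribution. -/
noncomputable def flatChart (α β g₃ δ : ℝ) (x : R5) : R5 :=
  let a := -(x 0 / (4 * δ ^ 2))
  let b := flatCoord α β g₃ δ x
  let c := c3 α β g₃ δ x
  -- Along $S^1$ and $S^2$ the pair $(a,b)$ has derivatives $(1,0)$ and $(0,1)$, while $c$ has
  -- derivatives $-b$ and $a$, which explains the coordinate $-c/2$. The terms subtracted from $c_1$
  -- and $-c_2$ turn their derivatives into those of the first two flat coordinates.
  ![(c1 α β g₃ δ x - a * c - a ^ 2 * b) / 6, (-c2 α β g₃ x - b * c + a * b ^ 2) / 6, -c / 2, a, b]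

variable {α β g₃ δ : ℝ}

theorem contDiffOn_flatCoord :
    ContDiffOn ℝ ∞ (flatCoord α β g₃ δ) (regularSet α β g₃) := by
  intro x hx
  obtain ⟨hY, hT⟩ := hx
  have hc : ContDiffAt ℝ ∞ (fun x : R5 => Y α β g₃ (x 0)) x := contDiff_Y.contDiffAt
  apply ContDiffAt.contDiffWithinAt
  unfold flatCoord
  dsimp only
  fun_prop (disch := simp_all)

theorem fderiv_proj (x v : R5) (i : Fin 5) : fderiv ℝ (fun x : R5 => x i) x v = v i := by
  have : fderiv ℝ (fun a : R5 => a i) x = ContinuousLinearMap.proj i :=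
    (ContinuousLinearMap.proj (R := ℝ) (φ := fun _ : Fin 5 => ℝ) i).fderiv
  rw [this]; rfl

theorem hasFDerivAt_Y (x : R5) :
    HasFDerivAt (fun x : R5 => Y α β g₃ (x 0)) ((α + 3 * β * x 0 ^ 2) • dx 0) x := by
  have h0 : HasFDerivAt (fun x : R5 => x 0) (dx 0) x := (dx 0).hasFDerivAt
  have h : HasDerivAt (Y α β g₃) (α + 3 * β * x 0 ^ 2) (x 0) := by
    refine (((hasDerivAt_id (x 0)).const_mul α).add
      (((hasDerivAt_pow 3 (x 0)).add_const (g₃ / 2)).const_mul β)).congr_deriv ?_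
    norm_num
    ring
  exact h.comp_hasFDerivAt x h0

theorem fderiv_Y (x v : R5) :
    fderiv ℝ (fun x : R5 => Y α β g₃ (x 0)) x v = (α + 3 * β * x 0 ^ 2) * v 0 := by
  rw [(hasFDerivAt_Y x).fderiv]; rfl

/-- The quotient rule. -/
theorem fderiv_fun_div_apply {f g : R5 → ℝ} {x : R5} (hf : DifferentiableAt ℝ f x)
    (hg : DifferentiableAt ℝ g x) (h0 : g x ≠ 0) (v : R5) :
    fderiv ℝ (fun y => f y / g y) x v =
      (fderiv ℝ f x v * g x - f x * fderiv ℝ g x v) / g x ^ 2 := by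
  have h := hf.hasFDerivAt.fun_mul ((hasDerivAt_inv h0).comp_hasFDerivAt x hg.hasFDerivAt)
  have h' : HasFDerivAt (fun y => f y / g y)
      (f x • ((-(g x ^ 2)⁻¹) • fderiv ℝ g x) + (g x)⁻¹ • fderiv ℝ f x) x := by
    simpa only [div_eq_mul_inv, Function.comp_def] using h
  rw [h'.fderiv]
  simp only [add_apply, smul_apply, smul_eq_mul]
  field_simp
  ring

/-- This and the derivatives of `c3`, `c1`, `c2` are stated in an arbitrary direction, so that the
actions of $S^1$, $S^2$, $Z^1$ follow by substitution. -/
theorem fderiv_flatCoord {x : R5} (hx : x ∈ regularSet α β g₃) (v : R5) :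
    fderiv ℝ (flatCoord α β g₃ δ) x v =
      let w := x 0
      let Y' := α + 3 * β * w ^ 2
      let Y := Y α β g₃ w
      let T := 4 * w ^ 3 - g₃
      ((96 * δ * w ^ 2 * T / Y ^ 3 - 12 * δ * T ^ 2 * Y' / Y ^ 4) * x 4
        + (48 * δ * w / Y - 24 * δ * w ^ 2 * Y' / Y ^ 2) * x 3 + 6 * δ * β * x 1) * v 0
      + 4 * δ * T ^ 2 / Y ^ 3 * v 4 + 24 * δ * w ^ 2 / Y * v 3 + 6 * δ * β * w * v 1 := by
  obtain ⟨hY, hT⟩ := hx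
  have hc : DifferentiableAt ℝ (fun x : R5 => Y α β g₃ (x 0)) x :=
    (hasFDerivAt_Y x).differentiableAt
  have hY' (n : ℕ) : Y α β g₃ (x 0) ^ n ≠ 0 := pow_ne_zero n hY
  unfold flatCoord
  dsimp only
  simp (disch := first | assumption | exact hY' _ | fun_prop (disch := simp_all)) only
    [fderiv_fun_add, fderiv_fun_sub, fderiv_fun_mul, fderiv_fun_pow, fderiv_fun_div_apply,
      fderiv_fun_const, add_apply, smul_apply, sub_apply, fderiv_proj, fderiv_Y, zero_apply,
      Pi.zero_apply, smul_eq_mul, nsmul_eq_mul]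
  field_simp
  push_cast
  ring

theorem fderiv_c3 (hδ : δ ≠ 0) {x : R5} (hx : x ∈ regularSet α β g₃) (v : R5) :
    fderiv ℝ (c3 α β g₃ δ) x v =
      let w := x 0
      let Y' := α + 3 * β * w ^ 2
      let Y := Y α β g₃ w
      let T := 4 * w ^ 3 - g₃
      1 / δ * (1 / 2 * α * v 1 - (2 * w ^ 3 + g₃) / Y * v 3 - w * T ^ 2 / Y ^ 3 * v 4
        - ((6 * w ^ 2 / Y - (2 * w ^ 3 + g₃) * Y' / Y ^ 2) * x 3
          + (T ^ 2 / Y ^ 3 + 24 * w ^ 3 * T / Y ^ 3 - 3 * w * T ^ 2 * Y' / Y ^ 4) * x 4) * v 0) := by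
  obtain ⟨hY, hT⟩ := hx
  have hc : DifferentiableAt ℝ (fun x : R5 => Y α β g₃ (x 0)) x :=
    (hasFDerivAt_Y x).differentiableAt
  have hY' (n : ℕ) : δ * Y α β g₃ (x 0) ^ n ≠ 0 := mul_ne_zero hδ (pow_ne_zero n hY)
  unfold c3
  dsimp only
  simp (disch := first | assumption | exact hY' _ | fun_prop (disch := simp_all)) only
    [fderiv_fun_add, fderiv_fun_sub, fderiv_fun_mul, fderiv_fun_pow, fderiv_fun_div_apply,
      fderiv_fun_const, add_apply, smul_apply, sub_apply, fderiv_proj, fderiv_Y, zero_apply,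
      Pi.zero_apply, smul_eq_mul, nsmul_eq_mul]
  field_simp
  push_cast
  ring

theorem fderiv_c1 (hδ : δ ≠ 0) {x : R5} (hx : x ∈ regularSet α β g₃) (v : R5) :
    fderiv ℝ (c1 α β g₃ δ) x v =
      let w := x 0
      let Y' := α + 3 * β * w ^ 2
      let Y := Y α β g₃ w
      let T := 4 * w ^ 3 - g₃
      1 / (4 * δ ^ 3) * (-2 * (α * w + 3 * g₃ / 8 * β) * v 1 + (8 * w ^ 4 + g₃ * w) / Y * v 3
        + 2 * w ^ 2 * T ^ 2 / Y ^ 3 * v 4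
        + (-2 * α * x 1 + ((32 * w ^ 3 + g₃) / Y - (8 * w ^ 4 + g₃ * w) * Y' / Y ^ 2) * x 3
          + (4 * w * T ^ 2 / Y ^ 3 + 48 * w ^ 4 * T / Y ^ 3 - 6 * w ^ 2 * T ^ 2 * Y' / Y ^ 4) * x 4)
          * v 0) := by
  obtain ⟨hY, hT⟩ := hx
  have hc : DifferentiableAt ℝ (fun x : R5 => Y α β g₃ (x 0)) x :=
    (hasFDerivAt_Y x).differentiableAt
  have hY' (n : ℕ) : 4 * δ ^ 3 * Y α β g₃ (x 0) ^ n ≠ 0 := by positivity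
  unfold c1
  dsimp only
  simp (disch := first | assumption | exact hY' _ | fun_prop (disch := simp_all)) only
    [fderiv_fun_add, fderiv_fun_sub, fderiv_fun_mul, fderiv_fun_pow, fderiv_fun_div_apply,
      fderiv_fun_const, add_apply, smul_apply, sub_apply, fderiv_proj, fderiv_Y, zero_apply,
      Pi.zero_apply, smul_eq_mul, nsmul_eq_mul]
  field_simp
  push_cast
  ring

theorem fderiv_c2 {x : R5} (hx : x ∈ regularSet α β g₃) (v : R5) :
    fderiv ℝ (c2 α β g₃) x v =
      let w := x 0
      let y := x 1
      let p := x 3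
      let q := x 4
      let Y' := α + 3 * β * w ^ 2
      let Y := Y α β g₃ w
      let T := 4 * w ^ 3 - g₃
      let N := 48 * β * w ^ 4 + 6 * β * g₃ * w - 48 * α * w ^ 2
      let M := T ^ 2 * (2 * α - 3 * β * w ^ 2)
      let R := (5 * w ^ 3 + g₃) * T ^ 2
      6 * v 2
      - 12 * β * α * y ^ 2 * v 0 - 24 * β * (α * w + 3 * g₃ * β / 16) * y * v 1
      + ((960 * w ^ 4 + 120 * g₃ * w) / Y ^ 2
          - 2 * (192 * w ^ 5 + 60 * g₃ * w ^ 2) * Y' / Y ^ 3) * p ^ 2 * v 0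
      + 2 * (192 * w ^ 5 + 60 * g₃ * w ^ 2) / Y ^ 2 * p * v 3
      + 12 * ((48 * w ^ 3 * T ^ 3 + T ^ 4) / Y ^ 6 - 6 * T ^ 4 * w * Y' / Y ^ 7) * q ^ 2 * v 0
      + 24 * T ^ 4 * w / Y ^ 6 * q * v 4
      + ((192 * β * w ^ 3 + 6 * β * g₃ - 96 * α * w) / Y - N * Y' / Y ^ 2) * y * p * v 0
      + N / Y * (p * v 1 + y * v 3)
      - 4 * (((24 * w ^ 2 * T * (2 * α - 3 * β * w ^ 2) - 6 * β * w * T ^ 2) / Y ^ 3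
          - 3 * M * Y' / Y ^ 4) * y * q * v 0 + M / Y ^ 3 * (q * v 1 + y * v 4))
      + 16 * (((15 * w ^ 2 * T ^ 2 + 24 * w ^ 2 * T * (5 * w ^ 3 + g₃)) / Y ^ 4
          - 4 * R * Y' / Y ^ 5) * p * q * v 0 + R / Y ^ 4 * (q * v 3 + p * v 4)) := by
  obtain ⟨hY, hT⟩ := hx
  have hc : DifferentiableAt ℝ (fun x : R5 => Y α β g₃ (x 0)) x :=
    (hasFDerivAt_Y x).differentiableAt
  have hY' (n : ℕ) : Y α β g₃ (x 0) ^ n ≠ 0 := pow_ne_zero n hY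
  unfold c2
  dsimp only
  simp (disch := first | assumption | exact hY' _ | fun_prop (disch := simp_all)) only
    [fderiv_fun_add, fderiv_fun_sub, fderiv_fun_mul, fderiv_fun_pow, fderiv_fun_div_apply,
      fderiv_fun_const, add_apply, smul_apply, sub_apply, fderiv_proj, fderiv_Y, zero_apply,
      Pi.zero_apply, smul_eq_mul, nsmul_eq_mul]
  field_simp
  push_cast
  ring

theorem S1_components (x : R5) (hx : x ∈ regularSet α β g₃) :
    let w := x 0
    let T := 4 * w ^ 3 - g₃
    let Y := Y α β g₃ w
    S1 α β g₃ δ x 0 = -4 * δ ^ 2 ∧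
    S1 α β g₃ δ x 1 = -8 * δ ^ 2 * T / Y ^ 2 * x 3 ∧
    S1 α β g₃ δ x 2 = -8 * δ ^ 2 * T ^ 4 / Y ^ 6 * x 4 ^ 2 ∧
    S1 α β g₃ δ x 3 = -8 * δ ^ 2 * T / Y ^ 2 * x 4 ∧
    S1 α β g₃ δ x 4 = 6 * β * δ ^ 2 * Y ^ 3 / T ^ 2 * x 1 + 24 * δ ^ 2 * w * Y ^ 2 / T ^ 2 * x 3
      + 12 * δ ^ 2 * (α * (8 * w ^ 3 + g₃) + 9 * β * g₃ * w ^ 2) / (T * Y) * x 4 := by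
  obtain ⟨hY, hT⟩ := hx
  intro w T Y'
  refine ⟨?_, ?_, ?_, ?_, ?_⟩ <;> simp [S1, X1, X2, T, Y', w] <;> (field_simp; try ring)

/-- The heart of the computation is a table of twelve derivatives: those of $b,c_3,c_1,c_2$ along
$S^1,S^2,Z^1$. Every entry is a polynomial in $a$, $b$, $c_3$, and this is why the fields become
polynomial in the chart. -/
theorem fderiv_flatCoord_S1 {x : R5} (hx : x ∈ regularSet α β g₃) :
    fderiv ℝ (flatCoord α β g₃ δ) x (S1 α β g₃ δ x) = 0 := by
  obtain ⟨e0, e1, e2, e3, e4⟩ := S1_components (δ := δ) x hx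
  rw [fderiv_flatCoord hx]
  dsimp only
  rw [e0, e1, e3, e4]
  obtain ⟨hY, hT⟩ := hx
  generalize hTw : 4 * x 0 ^ 3 - g₃ = T at *
  field_simp
  -- The explicit form of $Y$ enters here: for instance, the coefficient of $p$ cancels because
  -- $2(wY'-Y)=\beta(4w^3-g_3)$.
  simp only [← hTw, Y]
  ring

theorem fderiv_c3_S1 (hδ : δ ≠ 0) {x : R5} (hx : x ∈ regularSet α β g₃) :
    fderiv ℝ (c3 α β g₃ δ) x (S1 α β g₃ δ x) = -flatCoord α β g₃ δ x := by
  obtain ⟨e0, e1, e2, e3, e4⟩ := S1_components (δ := δ) x hx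
  rw [fderiv_c3 hδ hx]
  dsimp only [flatCoord]
  rw [e0, e1, e3, e4]
  obtain ⟨hY, hT⟩ := hx
  generalize hTw : 4 * x 0 ^ 3 - g₃ = T at *
  field_simp
  simp only [← hTw, Y]
  ring

theorem fderiv_c1_S1 (hδ : δ ≠ 0) {x : R5} (hx : x ∈ regularSet α β g₃) :
    fderiv ℝ (c1 α β g₃ δ) x (S1 α β g₃ δ x) =
      4 * c3 α β g₃ δ x + 2 * (x 0 / (4 * δ ^ 2)) * flatCoord α β g₃ δ x := by
  obtain ⟨e0, e1, e2, e3, e4⟩ := S1_components (δ := δ) x hx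
  rw [fderiv_c1 hδ hx]
  dsimp only [flatCoord, c3]
  rw [e0, e1, e3, e4]
  obtain ⟨hY, hT⟩ := hx
  generalize hTw : 4 * x 0 ^ 3 - g₃ = T at *
  field_simp
  simp only [← hTw, Y]
  ring

theorem fderiv_c2_S1 {x : R5} (hx : x ∈ regularSet α β g₃) :
    fderiv ℝ (c2 α β g₃) x (S1 α β g₃ δ x) = 2 * flatCoord α β g₃ δ x ^ 2 := by
  obtain ⟨e0, e1, e2, e3, e4⟩ := S1_components (δ := δ) x hx
  rw [fderiv_c2 hx]
  dsimp only [flatCoord]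
  rw [e0, e1, e2, e3, e4]
  obtain ⟨hY, hT⟩ := hx
  generalize hTw : 4 * x 0 ^ 3 - g₃ = T at *
  field_simp
  simp only [← hTw, Y]
  ring

theorem S2_components (x : R5) :
    S2 α β g₃ δ x 0 = 0 ∧ S2 α β g₃ δ x 1 = 0 ∧ S2 α β g₃ δ x 2 = 0 ∧ S2 α β g₃ δ x 3 = 0 ∧
    S2 α β g₃ δ x 4 = Y α β g₃ (x 0) ^ 3 / (4 * δ * (4 * x 0 ^ 3 - g₃) ^ 2) := by
  refine ⟨?_, ?_, ?_, ?_, ?_⟩ <;> simp [S2, X1]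

theorem fderiv_flatCoord_S2 (hδ : δ ≠ 0) {x : R5} (hx : x ∈ regularSet α β g₃) :
    fderiv ℝ (flatCoord α β g₃ δ) x (S2 α β g₃ δ x) = 1 := by
  obtain ⟨e0, e1, e2, e3, e4⟩ := S2_components (α := α) (β := β) (g₃ := g₃) (δ := δ) x
  rw [fderiv_flatCoord hx]
  dsimp only
  rw [e0, e1, e3, e4]
  obtain ⟨hY, hT⟩ := hx
  generalize hTw : 4 * x 0 ^ 3 - g₃ = T at *
  field_simp
  ring

theorem fderiv_c3_S2 (hδ : δ ≠ 0) {x : R5} (hx : x ∈ regularSet α β g₃) :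
    fderiv ℝ (c3 α β g₃ δ) x (S2 α β g₃ δ x) = -(x 0 / (4 * δ ^ 2)) := by
  obtain ⟨e0, e1, e2, e3, e4⟩ := S2_components (α := α) (β := β) (g₃ := g₃) (δ := δ) x
  rw [fderiv_c3 hδ hx]
  dsimp only
  rw [e0, e1, e3, e4]
  obtain ⟨hY, hT⟩ := hx
  generalize hTw : 4 * x 0 ^ 3 - g₃ = T at *
  field_simp
  ring

theorem fderiv_c1_S2 (hδ : δ ≠ 0) {x : R5} (hx : x ∈ regularSet α β g₃) :
    fderiv ℝ (c1 α β g₃ δ) x (S2 α β g₃ δ x) = 2 * (x 0 / (4 * δ ^ 2)) ^ 2 := by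
  obtain ⟨e0, e1, e2, e3, e4⟩ := S2_components (α := α) (β := β) (g₃ := g₃) (δ := δ) x
  rw [fderiv_c1 hδ hx]
  dsimp only
  rw [e0, e1, e3, e4]
  obtain ⟨hY, hT⟩ := hx
  generalize hTw : 4 * x 0 ^ 3 - g₃ = T at *
  field_simp
  ring

theorem fderiv_c2_S2 (hδ : δ ≠ 0) {x : R5} (hx : x ∈ regularSet α β g₃) :
    fderiv ℝ (c2 α β g₃) x (S2 α β g₃ δ x) =
      2 * (x 0 / (4 * δ ^ 2)) * flatCoord α β g₃ δ x - 4 * c3 α β g₃ δ x := by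
  obtain ⟨e0, e1, e2, e3, e4⟩ := S2_components (α := α) (β := β) (g₃ := g₃) (δ := δ) x
  rw [fderiv_c2 hx]
  dsimp only [flatCoord, c3]
  rw [e0, e1, e2, e3, e4]
  obtain ⟨hY, hT⟩ := hx
  generalize hTw : 4 * x 0 ^ 3 - g₃ = T at *
  field_simp
  simp only [← hTw, Y]
  ring

theorem Z1_components (x : R5) :
    let w := x 0
    let T := 4 * w ^ 3 - g₃
    let Y := Y α β g₃ w
    Z1 α β g₃ δ x 0 = 0 ∧
    Z1 α β g₃ δ x 1 = -(2 * δ * w / Y) ∧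
    Z1 α β g₃ δ x 2 = 4 * δ * T ^ 2 / Y ^ 3 * x 4 ∧
    Z1 α β g₃ δ x 3 = δ * (β * (8 * w ^ 3 + g₃) + 4 * α * w) / (2 * T) ∧
    Z1 α β g₃ δ x 4 = -(12 * δ * Y ^ 3 * w ^ 2 / T ^ 3) := by
  refine ⟨?_, ?_, ?_, ?_, ?_⟩ <;> simp [Z1]

theorem fderiv_flatCoord_Z1 {x : R5} (hx : x ∈ regularSet α β g₃) :
    fderiv ℝ (flatCoord α β g₃ δ) x (Z1 α β g₃ δ x) = 0 := by
  obtain ⟨e0, e1, e2, e3, e4⟩ := Z1_components (α := α) (β := β) (g₃ := g₃) (δ := δ) x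
  rw [fderiv_flatCoord hx]
  dsimp only
  rw [e0, e1, e3, e4]
  obtain ⟨hY, hT⟩ := hx
  generalize hTw : 4 * x 0 ^ 3 - g₃ = T at *
  field_simp
  simp only [← hTw, Y]
  ring

theorem fderiv_c3_Z1 (hδ : δ ≠ 0) {x : R5} (hx : x ∈ regularSet α β g₃) :
    fderiv ℝ (c3 α β g₃ δ) x (Z1 α β g₃ δ x) = 1 := by
  obtain ⟨e0, e1, e2, e3, e4⟩ := Z1_components (α := α) (β := β) (g₃ := g₃) (δ := δ) x
  rw [fderiv_c3 hδ hx]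
  dsimp only
  rw [e0, e1, e3, e4]
  obtain ⟨hY, hT⟩ := hx
  generalize hTw : 4 * x 0 ^ 3 - g₃ = T at *
  field_simp
  simp only [← hTw, Y]
  ring

theorem fderiv_c1_Z1 (hδ : δ ≠ 0) {x : R5} (hx : x ∈ regularSet α β g₃) :
    fderiv ℝ (c1 α β g₃ δ) x (Z1 α β g₃ δ x) = 2 * (x 0 / (4 * δ ^ 2)) := by
  obtain ⟨e0, e1, e2, e3, e4⟩ := Z1_components (α := α) (β := β) (g₃ := g₃) (δ := δ) x
  rw [fderiv_c1 hδ hx]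
  dsimp only
  rw [e0, e1, e3, e4]
  obtain ⟨hY, hT⟩ := hx
  generalize hTw : 4 * x 0 ^ 3 - g₃ = T at *
  field_simp
  simp only [← hTw, Y]
  ring

theorem fderiv_c2_Z1 {x : R5} (hx : x ∈ regularSet α β g₃) :
    fderiv ℝ (c2 α β g₃) x (Z1 α β g₃ δ x) = 2 * flatCoord α β g₃ δ x := by
  obtain ⟨e0, e1, e2, e3, e4⟩ := Z1_components (α := α) (β := β) (g₃ := g₃) (δ := δ) x
  rw [fderiv_c2 hx]
  dsimp only [flatCoord]
  rw [e0, e1, e2, e3, e4]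
  obtain ⟨hY, hT⟩ := hx
  generalize hTw : 4 * x 0 ^ 3 - g₃ = T at *
  field_simp
  simp only [← hTw, Y]
  ring

open FlatModel MvPolynomial

theorem contDiffOn_flatChart (hδ : δ ≠ 0) :
    ContDiffOn ℝ ∞ (flatChart α β g₃ δ) (regularSet α β g₃) := by
  have hb := contDiffOn_flatCoord (α := α) (β := β) (g₃ := g₃) (δ := δ)
  have h1 := contDiffOn_c1 (α := α) (β := β) (g₃ := g₃) hδ
  have h2 := contDiffOn_c2 (α := α) (β := β) (g₃ := g₃)
  have h3 := contDiffOn_c3 (α := α) (β := β) (g₃ := g₃) hδ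
  have ha : ContDiffOn ℝ ∞ (fun x : R5 => -(x 0 / (4 * δ ^ 2))) (regularSet α β g₃) :=
    ((contDiff_apply ℝ ℝ (0 : Fin 5)).div_const _).neg.contDiffOn
  rw [contDiffOn_pi]
  intro i
  fin_cases i
  · exact ((h1.sub (ha.mul h3)).sub ((ha.pow 2).mul hb)).div_const 6
  · exact ((h2.neg.sub (hb.mul h3)).add (ha.mul (hb.pow 2))).div_const 6
  · exact h3.neg.div_const 2
  · exact ha
  · exact hb

theorem isOpen_regularSet : IsOpen (regularSet α β g₃) := by
  refine IsOpen.inter ?_ ?_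
  · exact isOpen_ne_fun contDiff_Y.continuous continuous_const
  · exact isOpen_ne_fun (by fun_prop) continuous_const

theorem fderiv_flatChart (hδ : δ ≠ 0) {x : R5} (hx : x ∈ regularSet α β g₃) (v : R5) :
    fderiv ℝ (flatChart α β g₃ δ) x v =
      let a := -(x 0 / (4 * δ ^ 2))
      let b := flatCoord α β g₃ δ x
      let c := c3 α β g₃ δ x
      let a' := -(v 0 / (4 * δ ^ 2))
      let b' := fderiv ℝ (flatCoord α β g₃ δ) x v
      let c' := fderiv ℝ (c3 α β g₃ δ) x v
      ![(fderiv ℝ (c1 α β g₃ δ) x v - (a' * c + a * c') - (2 * a * a' * b + a ^ 2 * b')) / 6,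
        (-fderiv ℝ (c2 α β g₃) x v - (b' * c + b * c') + (a' * b ^ 2 + 2 * a * b * b')) / 6,
        -c' / 2, a', b'] := by
  have hn := isOpen_regularSet.mem_nhds hx
  have hb : HasFDerivAt (flatCoord α β g₃ δ) (fderiv ℝ (flatCoord α β g₃ δ) x) x :=
    ((contDiffOn_flatCoord.contDiffAt hn).differentiableAt (by simp)).hasFDerivAt
  have h1 : HasFDerivAt (c1 α β g₃ δ) (fderiv ℝ (c1 α β g₃ δ) x) x :=
    (((contDiffOn_c1 hδ).contDiffAt hn).differentiableAt (by simp)).hasFDerivAt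
  have h2 : HasFDerivAt (c2 α β g₃) (fderiv ℝ (c2 α β g₃) x) x :=
    ((contDiffOn_c2.contDiffAt hn).differentiableAt (by simp)).hasFDerivAt
  have h3 : HasFDerivAt (c3 α β g₃ δ) (fderiv ℝ (c3 α β g₃ δ) x) x :=
    (((contDiffOn_c3 hδ).contDiffAt hn).differentiableAt (by simp)).hasFDerivAt
  have ha : HasFDerivAt (fun x : R5 => -(x 0 / (4 * δ ^ 2))) (-((4 * δ ^ 2)⁻¹ • dx 0)) x := by
    have := ((dx 0).hasFDerivAt (x := x)).const_smul (4 * δ ^ 2)⁻¹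
    refine (this.neg).congr_of_eventuallyEq (.of_forall fun y => ?_)
    simp [dx, div_eq_inv_mul]
  have hpi := ((contDiffOn_flatChart hδ).contDiffAt hn).differentiableAt (n := ∞) (by simp)
  have hcomp (i : Fin 5) : fderiv ℝ (flatChart α β g₃ δ) x v i =
      fderiv ℝ (fun y => flatChart α β g₃ δ y i) x v := by
    rw [fderiv_apply hpi]; rfl
  ext i
  rw [hcomp]
  fin_cases i
  · have := (((h1.sub (ha.mul h3)).sub ((ha.pow 2).mul hb)).mul_const (6 : ℝ)⁻¹)
    have h : HasFDerivAt (fun y => flatChart α β g₃ δ y 0) _ x :=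
      this.congr_of_eventuallyEq (.of_forall fun y => by
        simp [flatChart, div_eq_mul_inv])
    change fderiv ℝ (fun y => flatChart α β g₃ δ y 0) x v = _
    rw [h.fderiv]
    simp [dx]
    ring
  · have := (((h2.neg.sub (hb.mul h3)).add (ha.mul (hb.pow 2))).mul_const (6 : ℝ)⁻¹)
    have h : HasFDerivAt (fun y => flatChart α β g₃ δ y 1) _ x :=
      this.congr_of_eventuallyEq (.of_forall fun y => by
        simp [flatChart, div_eq_mul_inv])
    change fderiv ℝ (fun y => flatChart α β g₃ δ y 1) x v = _
    rw [h.fderiv]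
    simp [dx]
    ring
  · have := h3.neg.mul_const (2 : ℝ)⁻¹
    have h : HasFDerivAt (fun y => flatChart α β g₃ δ y 2) _ x :=
      this.congr_of_eventuallyEq (.of_forall fun y => by
        simp [flatChart, div_eq_mul_inv])
    change fderiv ℝ (fun y => flatChart α β g₃ δ y 2) x v = _
    rw [h.fderiv]
    simp
    ring
  · change fderiv ℝ (fun x : R5 => -(x 0 / (4 * δ ^ 2))) x v = _
    rw [ha.fderiv]
    simp [dx]
    ring
  · rfl

/-- It is enough that the kernel vanishes. The fourth coordinate removes `v 0`; the others then give
linear equations for `v 1`, `v 3`, `v 4`, and finally `v 2`. -/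
theorem fderiv_flatChart_isInvertible (hδ : δ ≠ 0) {x : R5} (hx : x ∈ regularSet α β g₃) :
    (fderiv ℝ (flatChart α β g₃ δ) x).IsInvertible := by
  have hinj : Function.Injective (fderiv ℝ (flatChart α β g₃ δ) x) := by
    rw [injective_iff_map_eq_zero]
    intro v hv
    rw [fderiv_flatChart hδ hx] at hv
    have e0 := congrFun hv 0
    have e1 := congrFun hv 1
    have e2 := congrFun hv 2
    have e3 := congrFun hv 3
    have e4 := congrFun hv 4
    simp at e0 e1 e2 e3 e4
    have hv0 : v 0 = 0 := e3.resolve_right hδ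
    simp only [hv0, e2, e4, zero_div, neg_zero, mul_zero, zero_mul, add_zero, sub_zero] at e0 e1
    rw [fderiv_flatCoord hx] at e4
    rw [fderiv_c3 hδ hx] at e2
    rw [fderiv_c1 hδ hx] at e0
    rw [fderiv_c2 hx] at e1
    simp only [hv0, mul_zero, zero_add, add_zero, sub_zero] at e0 e1 e2 e4
    obtain ⟨hY, hT⟩ := hx
    have hY' : α * x 0 + β * (x 0 ^ 3 + g₃ / 2) = Y α β g₃ (x 0) := rfl
    generalize Y α β g₃ (x 0) = Y at *
    set w := x 0
    set T := 4 * w ^ 3 - g₃ with hTw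
    have q0 : -2 * (α * w + 3 * g₃ / 8 * β) * v 1 + (8 * w ^ 4 + g₃ * w) * (v 3 / Y) +
        2 * w ^ 2 * (T ^ 2 * v 4 / Y ^ 3) = 0 := by
      refine (mul_eq_zero.1 (Eq.trans ?_ e0)).resolve_left (by positivity : 1 / (4 * δ ^ 3) ≠ 0)
      ring
    have q2 : 1 / 2 * α * v 1 - (2 * w ^ 3 + g₃) * (v 3 / Y) - w * (T ^ 2 * v 4 / Y ^ 3) = 0 := by
      refine (mul_eq_zero.1 (Eq.trans ?_ e2)).resolve_left (by positivity : 1 / δ ≠ 0)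
      ring
    have q4 : 4 * (T ^ 2 * v 4 / Y ^ 3) + 24 * w ^ 2 * (v 3 / Y) + 6 * β * w * v 1 = 0 := by
      refine (mul_eq_zero.1 (Eq.trans ?_ e4)).resolve_left hδ
      ring
    have hv1 : v 1 = 0 := by
      -- This combination eliminates `v 3` and `v 4`, and the remaining coefficient of `v 1` is
      -- exactly $Y$.
      have : Y * v 1 = 0 := by
        rw [hTw] at q0 q2 q4
        linear_combination (-2 / 3) * q0 - 2 / 3 * w * q2 + w ^ 2 / 6 * q4 - v 1 * hY'
      exact (mul_eq_zero.1 this).resolve_left hY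
    have hv3 : v 3 = 0 := by
      have : T * (v 3 / Y) = 0 := by
        linear_combination q2 + w / 4 * q4 - (α / 2 + 3 / 2 * β * w ^ 2) * hv1
          + (v 3 / Y) * hTw
      exact (div_eq_zero_iff.1 ((mul_eq_zero.1 this).resolve_left hT)).resolve_right hY
    have hv4 : v 4 = 0 := by
      rw [hv1, hv3] at q4
      have : T ^ 2 * v 4 / Y ^ 3 = 0 := by linear_combination q4 / 4
      exact (mul_eq_zero.1 ((div_eq_zero_iff.1 this).resolve_right (pow_ne_zero 3 hY))).resolve_left
        (pow_ne_zero 2 hT)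
    -- The coordinate $z$ enters the chart only through the term $6z$ of $c_2$.
    have hv2 : v 2 = 0 := by
      rw [hv1, hv3, hv4] at e1
      linear_combination (-1 / 6) * e1
    ext i
    fin_cases i <;> assumption
  let e : R5 ≃L[ℝ] R5 := (LinearEquiv.ofInjectiveEndo
    (fderiv ℝ (flatChart α β g₃ δ) x).toLinearMap hinj).toContinuousLinearEquiv
  exact ⟨e, by ext; rfl⟩

theorem fderiv_flatChart_S1 (hδ : δ ≠ 0) {x : R5} (hx : x ∈ regularSet α β g₃) :
    fderiv ℝ (flatChart α β g₃ δ) x (S1 α β g₃ δ x) =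
      (toSmooth (mkDerivation ℝ flatS₁) : R5 → R5) (flatChart α β g₃ δ x) := by
  rw [fderiv_flatChart hδ hx, fderiv_flatCoord_S1 hx, fderiv_c3_S1 hδ hx, fderiv_c1_S1 hδ hx,
    fderiv_c2_S1 hx, (S1_components x hx).1]
  ext i
  rw [toSmooth_apply, mkDerivation_X]
  fin_cases i <;> simp [flatS₁, flatChart] <;> (try field_simp) <;> ring

theorem fderiv_flatChart_S2 (hδ : δ ≠ 0) {x : R5} (hx : x ∈ regularSet α β g₃) :
    fderiv ℝ (flatChart α β g₃ δ) x (S2 α β g₃ δ x) =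
      (toSmooth (mkDerivation ℝ flatS₂) : R5 → R5) (flatChart α β g₃ δ x) := by
  rw [fderiv_flatChart hδ hx, fderiv_flatCoord_S2 hδ hx, fderiv_c3_S2 hδ hx, fderiv_c1_S2 hδ hx,
    fderiv_c2_S2 hδ hx, (S2_components x).1]
  ext i
  rw [toSmooth_apply, mkDerivation_X]
  fin_cases i <;> simp [flatS₂, flatChart] <;> (try field_simp) <;> ring

/-- In flat coordinates $Z^1$ becomes $-\frac12(a_4\partial_1+a_5\partial_2+\partial_3)$. -/
theorem fderiv_flatChart_Z1 (hδ : δ ≠ 0) {x : R5} (hx : x ∈ regularSet α β g₃) :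
    fderiv ℝ (flatChart α β g₃ δ) x (Z1 α β g₃ δ x) =
      ![x 0 / (4 * δ ^ 2) / 2, -flatCoord α β g₃ δ x / 2, -1 / 2, 0, 0] := by
  rw [fderiv_flatChart hδ hx, fderiv_flatCoord_Z1 hx, fderiv_c3_Z1 hδ hx, fderiv_c1_Z1 hδ hx,
    fderiv_c2_Z1 hx, (Z1_components x).1]
  ext i
  fin_cases i <;> simp <;> ring

/-- Solving the chart for $c_1,c_2,c_3$ makes them polynomials in the flat coordinates, so the
combination defining $S^3$ is polynomial as well. -/
theorem fderiv_flatChart_S3 (hδ : δ ≠ 0) {x : R5} (hx : x ∈ regularSet α β g₃) :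
    fderiv ℝ (flatChart α β g₃ δ) x (S3 α β g₃ δ x) =
      (toSmooth (mkDerivation ℝ flatS₃) : R5 → R5) (flatChart α β g₃ δ x) := by
  rw [S3, map_sub, map_add, map_neg, map_smul, map_smul, map_smul, fderiv_flatChart_S1 hδ hx,
    fderiv_flatChart_S2 hδ hx, fderiv_flatChart_Z1 hδ hx]
  ext i
  simp only [Pi.sub_apply, Pi.add_apply, Pi.neg_apply, Pi.smul_apply, smul_eq_mul]
  rw [toSmooth_apply, toSmooth_apply, toSmooth_apply, mkDerivation_X, mkDerivation_X,
    mkDerivation_X]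
  fin_cases i <;> simp [flatS₁, flatS₂, flatS₃, flatChart] <;> ring

end FlatChart

/-! ### The distribution: annihilator, flatness, growth vector, and the conclusion. -/

section Distribution

variable {α β g₃ δ : ℝ}

theorem mem_annihilatedBy {η : Fin 3 → R5 → (R5 →L[ℝ] ℝ)} {x v : R5} :
    v ∈ annihilatedBy η x ↔ η 0 x v = 0 ∧ η 1 x v = 0 ∧ η 2 x v = 0 := by
  simp [annihilatedBy, Submodule.mem_iInf, Fin.forall_fin_succ]

theorem span_eq_annihilatedBy_omega {x : R5} (hx : x ∈ regularSet α β g₃) :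
    Submodule.span ℝ {X1 x, X2 α β g₃ x} = annihilatedBy (omega α β g₃) x := by
  obtain ⟨hY, hT⟩ := hx
  ext v
  rw [Submodule.mem_span_pair, mem_annihilatedBy]
  constructor
  · rintro ⟨a, b, rfl⟩
    refine ⟨?_, ?_, ?_⟩ <;> simp [omega, dx, X1, X2] <;> field_simp <;> ring
  · rintro ⟨h1, h2, h3⟩
    simp [omega, dx] at h1 h2 h3
    -- Only $X^2$ has a $\partial_w$ component and only $X^1$ a $\partial_q$ component, so these two
    -- entries of `v` dictate the coefficients.
    refine ⟨v 4, 2 * (4 * x 0 ^ 3 - g₃) / Y α β g₃ (x 0) ^ 2 * v 0, ?_⟩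
    ext i
    fin_cases i <;> simp [X1, X2]
    · field_simp
    · linear_combination -h1
    · rw [← sub_eq_zero, ← neg_eq_zero.2 h3]
      field_simp
      ring
    · linear_combination -h2

theorem span_flat_eq_annihilatedBy_flatForm (a : R5) :
    Submodule.span ℝ
      {(FlatModel.toSmooth (MvPolynomial.mkDerivation ℝ FlatModel.flatS₁) : R5 → R5) a,
        (FlatModel.toSmooth (MvPolynomial.mkDerivation ℝ FlatModel.flatS₂) : R5 → R5) a} =
      annihilatedBy flatForm a := by
  ext v
  rw [Submodule.mem_span_pair, mem_annihilatedBy]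
  constructor
  · rintro ⟨s, t, rfl⟩
    refine ⟨?_, ?_, ?_⟩ <;>
      simp [flatForm, dx, FlatModel.toSmooth_apply, FlatModel.flatS₁, FlatModel.flatS₂,
        MvPolynomial.mkDerivation_X] <;> ring
  · rintro ⟨h1, h2, h3⟩
    simp [flatForm, dx] at h1 h2 h3
    refine ⟨v 3, v 4, ?_⟩
    ext i
    fin_cases i <;>
      simp [FlatModel.toSmooth_apply, FlatModel.flatS₁, FlatModel.flatS₂,
        MvPolynomial.mkDerivation_X]
    · linear_combination -h1
    · linear_combination -h2
    · linear_combination -h3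

/-- The change of frame is triangular: $S^2=mX^1$ and $S^1=fX^1-kX^2$ with $m$ and $k$ non-zero. -/
theorem span_S1_S2 (hδ : δ ≠ 0) {x : R5} (hx : x ∈ regularSet α β g₃) :
    Submodule.span ℝ {S1 α β g₃ δ x, S2 α β g₃ δ x} =
      Submodule.span ℝ {X1 x, X2 α β g₃ x} := by
  obtain ⟨hY, hT⟩ := hx
  have hm : Y α β g₃ (x 0) ^ 3 / (4 * δ * (4 * x 0 ^ 3 - g₃) ^ 2) ≠ 0 := by positivity
  have hk : 8 * δ ^ 2 * (4 * x 0 ^ 3 - g₃) / Y α β g₃ (x 0) ^ 2 ≠ 0 := by positivity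
  unfold S1 S2
  dsimp only
  generalize Y α β g₃ (x 0) ^ 3 / (4 * δ * (4 * x 0 ^ 3 - g₃) ^ 2) = m at *
  generalize 8 * δ ^ 2 * (4 * x 0 ^ 3 - g₃) / Y α β g₃ (x 0) ^ 2 = k at *
  generalize (_ + _ : ℝ) = f
  apply le_antisymm <;> rw [Submodule.span_le, Set.pair_subset_iff] <;>
    simp only [SetLike.mem_coe, Submodule.mem_span_pair]
  · exact ⟨⟨f, -k, by module⟩, m, 0, by module⟩
  · refine ⟨⟨0, m⁻¹, ?_⟩, -k⁻¹, k⁻¹ * f * m⁻¹, ?_⟩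
    · rw [zero_smul, zero_add, smul_smul, inv_mul_cancel₀ hm, one_smul]
    · rw [smul_sub, smul_smul, smul_smul, smul_smul, mul_assoc, inv_mul_cancel₀ hm,
        neg_mul, neg_mul, inv_mul_cancel₀ hk]
      module

theorem map_span_fderiv_flatChart (hδ : δ ≠ 0) {x : R5} (hx : x ∈ regularSet α β g₃) :
    (Submodule.span ℝ {X1 x, X2 α β g₃ x}).map
        (fderiv ℝ (flatChart α β g₃ δ) x).toLinearMap =
      annihilatedBy flatForm (flatChart α β g₃ δ x) := by
  rw [← span_S1_S2 hδ hx, Submodule.map_span, Set.image_pair,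
    ← span_flat_eq_annihilatedBy_flatForm, ← fderiv_flatChart_S1 hδ hx,
    ← fderiv_flatChart_S2 hδ hx]
  rfl

/-- The distribution does not involve `δ`, so the chart with `δ = 1` serves. The inverse function
theorem turns it into a local diffeomorphism, which is then restricted to `U`. -/
theorem isMaximallySymmetric_span_X1_X2 {U : Opens R5} (hU : (U : Set R5) ⊆ regularSet α β g₃) :
    IsMaximallySymmetric U (fun x => Submodule.span ℝ {X1 x, X2 α β g₃ x}) := by
  intro x hx
  have hsm (u : R5) (hu : u ∈ U) : ContDiffAt ℝ ∞ (flatChart α β g₃ 1) u :=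
    (contDiffOn_flatChart one_ne_zero).contDiffAt (isOpen_regularSet.mem_nhds (hU hu))
  have hd (u : R5) (hu : u ∈ U) : ∃ e : R5 ≃L[ℝ] R5,
      HasFDerivAt (flatChart α β g₃ 1) (e : R5 →L[ℝ] R5) u := by
    obtain ⟨e, he⟩ := fderiv_flatChart_isInvertible (δ := 1) one_ne_zero (hU hu)
    exact ⟨e, he ▸ ((hsm u hu).differentiableAt (by simp)).hasFDerivAt⟩
  obtain ⟨e, he⟩ := hd x hx
  let φ := ((hsm x hx).toOpenPartialHomeomorph _ he (by simp)).restrOpen U U.isOpen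
  have hφ : (φ : R5 → R5) = flatChart α β g₃ 1 := rfl
  have hsrc : φ.source ⊆ U := Set.inter_subset_right
  refine ⟨φ, ⟨(hsm x hx).mem_toOpenPartialHomeomorph_source he (by simp), hx⟩, hsrc, ?_, ?_, ?_⟩
  · exact fun u hu => (hsm u (hsrc hu)).contDiffWithinAt
  · intro b hb
    have hb' := hsrc (φ.map_target hb)
    obtain ⟨e', he'⟩ := hd _ hb'
    exact (φ.contDiffAt_symm hb he' (hsm _ hb')).contDiffWithinAt
  · intro u hu
    rw [hφ]
    exact map_span_fderiv_flatChart one_ne_zero (hU (hsrc hu))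

/-- The bracket `[X¹, X²]` on the regular set. -/
noncomputable def derivedField (α β g₃ : ℝ) (x : R5) : R5 :=
  ![0, 0, 2 * (4 * x 0 ^ 3 - g₃) ^ 3 / Y α β g₃ (x 0) ^ 4 * x 4, 1, 0]

theorem contDiffAt_derivedField {x : R5} (hx : x ∈ regularSet α β g₃) :
    ContDiffAt ℝ ∞ (derivedField α β g₃) x := by
  obtain ⟨hY, hT⟩ := hx
  have hc : ContDiffAt ℝ ∞ (fun x : R5 => Y α β g₃ (x 0)) x := contDiff_Y.contDiffAt
  rw [contDiffAt_pi]
  intro i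
  fin_cases i <;> simp only [derivedField] <;> simp <;> fun_prop (disch := simp_all)

theorem fderiv_apply_of_contDiffAt {f : R5 → R5} {x : R5} (h : ContDiffAt ℝ ∞ f x) (v : R5)
    (i : Fin 5) : fderiv ℝ f x v i = fderiv ℝ (fun y => f y i) x v := by
  rw [fderiv_apply (h.differentiableAt (by simp))]
  rfl

/-- The derivative of `X²` in the directions transverse to `∂_w`. -/
theorem fderiv_X2_of_zero {x : R5} (hx : x ∈ regularSet α β g₃) {v : R5} (hv : v 0 = 0) :
    fderiv ℝ (X2 α β g₃) x v =
      ![0, v 3, 2 * (4 * x 0 ^ 3 - g₃) ^ 3 / Y α β g₃ (x 0) ^ 4 * x 4 * v 4, v 4, 0] := by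
  have hX := contDiffAt_X2 hx
  obtain ⟨hY, hT⟩ := hx
  have hc : DifferentiableAt ℝ (fun x : R5 => Y α β g₃ (x 0)) x :=
    (hasFDerivAt_Y x).differentiableAt
  ext i
  rw [fderiv_apply_of_contDiffAt hX]
  fin_cases i <;> simp only [X2] <;> simp
  · rw [fderiv_fun_div_apply (by fun_prop) (by fun_prop) (by simpa using hT)]
    simp (disch := first | assumption | fun_prop (disch := simp_all)) [fderiv_fun_pow, fderiv_Y,
      fderiv_proj, fderiv_const_mul, fderiv_fun_sub, hv]
  · rw [fderiv_proj]
  · simp (disch := first | assumption | fun_prop (disch := simp_all) | positivity) only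
      [fderiv_fun_sub, fderiv_fun_mul, fderiv_fun_pow, fderiv_fun_div_apply, fderiv_fun_const, add_apply, smul_apply, sub_apply, fderiv_proj, fderiv_Y, zero_apply,
      Pi.zero_apply, smul_eq_mul, nsmul_eq_mul, hv]
    field_simp
    ring
  · rw [fderiv_proj]

theorem lieBracket_X1_apply (W : R5 → R5) (x : R5) :
    VectorField.lieBracket ℝ X1 W x = fderiv ℝ W x (X1 x) := by
  have : fderiv ℝ X1 x = 0 := fderiv_const_apply _
  simp [VectorField.lieBracket, this]

theorem lieBracket_X1_X2 {x : R5} (hx : x ∈ regularSet α β g₃) :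
    VectorField.lieBracket ℝ X1 (X2 α β g₃) x = derivedField α β g₃ x := by
  rw [lieBracket_X1_apply, fderiv_X2_of_zero hx (by simp [X1])]
  simp [X1, derivedField]

theorem lieBracket_X1_X2_eventuallyEq {x : R5} (hx : x ∈ regularSet α β g₃) :
    VectorField.lieBracket ℝ X1 (X2 α β g₃) =ᶠ[nhds x] derivedField α β g₃ :=
  Filter.eventually_of_mem (isOpen_regularSet.mem_nhds hx) fun _ hy => lieBracket_X1_X2 hy

theorem lieBracket_X1_derivedField {x : R5} (hx : x ∈ regularSet α β g₃) :
    VectorField.lieBracket ℝ X1 (derivedField α β g₃) x =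
      ![0, 0, 2 * (4 * x 0 ^ 3 - g₃) ^ 3 / Y α β g₃ (x 0) ^ 4, 0, 0] := by
  have hX := contDiffAt_derivedField hx
  obtain ⟨hY, hT⟩ := hx
  have hc : DifferentiableAt ℝ (fun x : R5 => Y α β g₃ (x 0)) x :=
    (hasFDerivAt_Y x).differentiableAt
  rw [lieBracket_X1_apply]
  ext i
  rw [fderiv_apply_of_contDiffAt hX]
  fin_cases i <;> simp only [derivedField] <;> simp
  simp (disch := first | assumption | fun_prop (disch := simp_all) | positivity) only
      [fderiv_fun_sub, fderiv_fun_mul, fderiv_fun_pow, fderiv_fun_div_apply, fderiv_fun_const, add_apply, smul_apply, sub_apply, fderiv_proj, fderiv_Y, zero_apply,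
      Pi.zero_apply, smul_eq_mul, nsmul_eq_mul]
  simp [X1]

/-- The $z$-component needs no value, since $\partial_z$ is already supplied by the other
second-order bracket. Since `derivedField` has no $\partial_w$ component, the $w$-derivative of
$X^2$ is not needed either. -/
theorem exists_lieBracket_X2_derivedField {x : R5} (hx : x ∈ regularSet α β g₃) :
    ∃ κ, VectorField.lieBracket ℝ (X2 α β g₃) (derivedField α β g₃) x = ![0, -1, κ, 0, 0] := by
  refine ⟨VectorField.lieBracket ℝ (X2 α β g₃) (derivedField α β g₃) x 2, ?_⟩
  have h (i : Fin 5) : VectorField.lieBracket ℝ (X2 α β g₃) (derivedField α β g₃) x i =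
      fderiv ℝ (fun y => derivedField α β g₃ y i) x (X2 α β g₃ x) -
        (![0, 1, 0, 0, 0] : R5) i := by
    rw [VectorField.lieBracket, fderiv_X2_of_zero hx (by simp [derivedField]), Pi.sub_apply,
      fderiv_apply_of_contDiffAt (contDiffAt_derivedField hx)]
    simp [derivedField]
  ext i
  fin_cases i
  · refine (h 0).trans ?_
    simp [derivedField]
  · refine (h 1).trans ?_
    simp [derivedField]
  · rfl
  · refine (h 3).trans ?_
    simp [derivedField]
  · refine (h 4).trans ?_
    simp [derivedField]

theorem isTwoThreeFive_X1_X2 {U : Opens R5} (hU : (U : Set R5) ⊆ regularSet α β g₃) :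
    IsTwoThreeFive U X1 (X2 α β g₃) := by
  unfold IsTwoThreeFive
  intro X₃ X₄ X₅ x hxU
  have hx := hU hxU
  have h3 : X₃ x = derivedField α β g₃ x := lieBracket_X1_X2 hx
  have h4 : X₄ x = _ := (Filter.EventuallyEq.rfl.lieBracket_vectorField_eq
    (lieBracket_X1_X2_eventuallyEq hx)).trans (lieBracket_X1_derivedField hx)
  obtain ⟨κ, hκ⟩ := exists_lieBracket_X2_derivedField hx
  have h5 : X₅ x = _ := (Filter.EventuallyEq.rfl.lieBracket_vectorField_eq
    (lieBracket_X1_X2_eventuallyEq hx)).trans hκ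
  obtain ⟨hY, hT⟩ := hx
  -- The five fields are nearly triangular: $\partial_w$ occurs only in $X^2$, and once that is
  -- removed the rest contribute $\partial_q$, $\partial_p$, $\partial_z$, $\partial_y$ with
  -- non-zero coefficients.
  have hli : LinearIndependent ℝ ![X1 x, X2 α β g₃ x, X₃ x, X₄ x, X₅ x] := by
    rw [h3, h4, h5, Fintype.linearIndependent_iff]
    intro g hg
    have e0 := congrFun hg 0
    have e1 := congrFun hg 1
    have e2 := congrFun hg 2
    have e3 := congrFun hg 3
    have e4 := congrFun hg 4
    simp [Fin.sum_univ_five, X1, X2, derivedField, hY, hT] at e0 e1 e2 e3 e4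
    simp only [e0, zero_mul, zero_add] at e1 e2 e3
    have g4 : g 4 = 0 := by linarith
    have g3 : g 3 = 0 := by
      rw [e3, g4] at e2
      have : g 3 * (2 * (4 * x 0 ^ 3 - g₃) ^ 3 / Y α β g₃ (x 0) ^ 4) = 0 := by linarith
      exact (mul_eq_zero.1 this).resolve_right (by positivity)
    intro i
    fin_cases i <;> assumption
  refine ⟨?_, ?_, ?_⟩
  · have := finrank_span_eq_card (hli.comp ![0, 1] (by decide))
    have hr : Set.range (![X1 x, X2 α β g₃ x, X₃ x, X₄ x, X₅ x] ∘ ![0, 1]) =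
        {X1 x, X2 α β g₃ x} := by
      ext; simp [Fin.exists_fin_two, eq_comm]
    rw [hr] at this
    simpa using this
  · have := finrank_span_eq_card (hli.comp ![0, 1, 2] (by decide))
    have hr : Set.range (![X1 x, X2 α β g₃ x, X₃ x, X₄ x, X₅ x] ∘ ![0, 1, 2]) =
        {X1 x, X2 α β g₃ x, X₃ x} := by
      ext; simp [Fin.exists_fin_succ, eq_comm]
    rw [hr] at this
    simpa using this
  · have := hli.span_eq_top_of_card_eq_finrank (by simp)
    rw [← this]
    congr 1
    ext
    simp
    tauto

/-- The polynomial relations are carried to the smooth fields on the flat space and then pulled back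
to `U`. It remains to see that $S^1$ and $S^2$ are non-zero, which is checked at one point of `U`.
-/
theorem pairwiseBracketGenerateSplitG2_fields (hδ : δ ≠ 0) {U : Opens R5}
    (hne : (U : Set R5).Nonempty) (hU : (U : Set R5) ⊆ regularSet α β g₃) :
    PairwiseBracketGenerateSplitG2 (fieldS1 δ hU) (fieldS2 hδ hU) (fieldS3 hδ hU) := by
  have hΦ := (contDiffOn_flatChart (α := α) (β := β) (g₃ := g₃) hδ).mono hU
  have hinv (x : R5) (hx : x ∈ U) := fderiv_flatChart_isInvertible hδ (hU hx)
  have r := (FlatModel.flat_frameRelations.map FlatModel.toSmooth).map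
    (SmoothVectorField.pullbackHom U _ hΦ hinv)
  rw [SmoothVectorField.pullbackHom_eq U _ hΦ hinv _ (S1 α β g₃ δ) (contDiffOn_S1.mono hU)
      fun x hx => fderiv_flatChart_S1 hδ (hU hx),
    SmoothVectorField.pullbackHom_eq U _ hΦ hinv _ (S2 α β g₃ δ) ((contDiffOn_S2 hδ).mono hU)
      fun x hx => fderiv_flatChart_S2 hδ (hU hx),
    SmoothVectorField.pullbackHom_eq U _ hΦ hinv _ (S3 α β g₃ δ) ((contDiffOn_S3 hδ).mono hU)
      fun x hx => fderiv_flatChart_S3 hδ (hU hx)] at r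
  obtain ⟨x, hx⟩ := hne
  refine r.pairwiseBracketGenerateSplitG2 (fun h => ?_) fun h => ?_
  · have h0 : (fieldS1 δ hU : R5 → R5) x 0 = 0 := by rw [fieldS1, h]; rfl
    have h1 : (fieldS1 δ hU : R5 → R5) x = S1 α β g₃ δ x := Set.indicator_of_mem hx _
    rw [h1, (S1_components x (hU hx)).1] at h0
    exact hδ (by simpa using h0)
  · have h0 : (fieldS2 hδ hU : R5 → R5) x 4 = 0 := by rw [fieldS2, h]; rfl
    have h1 : (fieldS2 hδ hU : R5 → R5) x = S2 α β g₃ δ x := Set.indicator_of_mem hx _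
    obtain ⟨hY, hT⟩ := hU hx
    rw [h1, (S2_components x).2.2.2.2] at h0
    exact absurd h0 (by positivity)

end Distribution

theorem corollary5p2 (α β g₃ δ : ℝ) (hδ : δ ≠ 0)
    (U : Opens R5) (hne : (U : Set R5).Nonempty)
    (hU : (U : Set R5) ⊆ regularSet α β g₃) :
    IsTwoThreeFive U X1 (X2 α β g₃) ∧
    IsMaximallySymmetric U
      (fun x => Submodule.span ℝ {X1 x, X2 α β g₃ x}) ∧
    (∀ x ∈ U, Submodule.span ℝ {X1 x, X2 α β g₃ x} =
      annihilatedBy (omega α β g₃) x) ∧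
    PairwiseBracketGenerateSplitG2
      (fieldS1 δ hU) (fieldS2 hδ hU) (fieldS3 hδ hU) :=
  ⟨isTwoThreeFive_X1_X2 hU, isMaximallySymmetric_span_X1_X2 hU,
    fun _ hx => span_eq_annihilatedBy_omega (hU hx),
    pairwiseBracketGenerateSplitG2_fields hδ hne hU⟩
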